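/- Let $M>0$ and $0<e^2<M^2$, let $r_\pm=M\pm\sqrt{M^2-e^2}$ and $h(r)=1-\frac{2M}{r}+\frac{e^2}{r^2}$, and consider the maximally extended Reissner–Nordström spacetime with mass $M$ and charge $e$, i.e. the maximal analytic extension of $-h\,dt^2+h^{-1}dr^2+r^2(d\theta^2+\sin^2\theta\,d\phi^2)$, described by coordinates $(T,X,\theta,\phi)$ in which the metric is $\Omega^2(-dT^2+dX^2)+r^2(d\theta^2+\sin^2\theta\,d\phi^2)$. Here $(T,X)$ ranges over the Penrose diagram, an infinite vertical chain of blocks that is symmetric under $X\mapsto -X$ (as are $\Omega$ and $r$), and $\partial_T$ is future directed. A TSS-CMC hypersurface with mean curvature $H$ is a smooth spacelike, spherically symmetric hypersurface $\Sigma:(T=T(X),X,\theta,\phi)$ over an open interval of $X$ symmetric about $0$, with $T(-X)=T(X)$ and constant mean curvature $H$ (one third of the trace of the second fundamental form with respect to the future directed unit normal). Theorem. Given $H\in\mathbb{R}$ and boundary data $(T_0,X_0,\theta,\phi)$, $(T_0,-X_0,\theta,\phi)$ in the maximally extended Reissner–Nordström spacetime, there exists a unique inextendible TSS-CMC hypersurface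 $\Sigma:(T=T(X),X,\theta,\phi)$ with mean curvature $H$ satisfying the boundary value conditions $T(X_0)=T(-X_0)=T_0$. Moreover, every (not necessarily inextendible) TSS-CMC hypersurface with mean curvature $H$ satisfying these boundary conditions is a part of $\Sigma$. -/

import Mathlib

open scoped Matrix

noncomputable section

namespace LorentzGeometry

/-- The `i`-th partial derivative of `f : ℝⁿ → ℝ` at `x`. -/
def pd {n : ℕ} (i : Fin n) (f : (Fin n → ℝ) → ℝ) (x : Fin n → ℝ) : ℝ :=
  fderiv ℝ f x (Pi.single i 1)

/-- Christoffel symbols `Γᵏᵢⱼ` of the metric whose matrix in the coordinates `x` is `g x`. -/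
def christoffel {n : ℕ} (g : (Fin n → ℝ) → Matrix (Fin n) (Fin n) ℝ) (k i j : Fin n)
    (x : Fin n → ℝ) : ℝ :=
  (1 / 2) * ∑ l, (g x)⁻¹ k l *
    (pd i (fun y => g y j l) x + pd j (fun y => g y i l) x - pd l (fun y => g y i j) x)

/-- The coordinate tangent vector `∂ₐΦ` of a parametrized hypersurface. -/
def tangent (Φ : (Fin 3 → ℝ) → (Fin 4 → ℝ)) (a : Fin 3) (y : Fin 3 → ℝ) : Fin 4 → ℝ :=
  fun k => pd a (fun z => Φ z k) y

/-- First fundamental form (induced metric) of a parametrized hypersurface. -/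
def firstForm (g : (Fin 4 → ℝ) → Matrix (Fin 4) (Fin 4) ℝ) (Φ : (Fin 3 → ℝ) → (Fin 4 → ℝ))
    (y : Fin 3 → ℝ) : Matrix (Fin 3) (Fin 3) ℝ :=
  Matrix.of fun a b => tangent Φ a y ⬝ᵥ (g (Φ y) *ᵥ tangent Φ b y)

/-- The hypersurface is spacelike at the parameter `y`: its induced metric is positive definite. -/
def IsSpacelikeAt (g : (Fin 4 → ℝ) → Matrix (Fin 4) (Fin 4) ℝ) (Φ : (Fin 3 → ℝ) → (Fin 4 → ℝ))
    (y : Fin 3 → ℝ) : Prop :=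
  (firstForm g Φ y).PosDef

/-- The ambient covariant derivative `∇ₐ ∂_b Φ`. -/
def covDeriv (g : (Fin 4 → ℝ) → Matrix (Fin 4) (Fin 4) ℝ) (Φ : (Fin 3 → ℝ) → (Fin 4 → ℝ))
    (a b : Fin 3) (y : Fin 3 → ℝ) : Fin 4 → ℝ :=
  fun k => pd a (fun z => tangent Φ b z k) y +
    ∑ i, ∑ j, christoffel g k i j (Φ y) * tangent Φ a y i * tangent Φ b y j

/-- `ν` is the future directed unit normal at the parameter `y`; the coordinate vector field
`∂₀` is timelike and future directed, so "future" means `g(ν, ∂₀) < 0`. -/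
def IsFutureUnitNormal (g : (Fin 4 → ℝ) → Matrix (Fin 4) (Fin 4) ℝ)
    (Φ : (Fin 3 → ℝ) → (Fin 4 → ℝ)) (y : Fin 3 → ℝ) (ν : Fin 4 → ℝ) : Prop :=
  (∀ a, ν ⬝ᵥ (g (Φ y) *ᵥ tangent Φ a y) = 0) ∧ ν ⬝ᵥ (g (Φ y) *ᵥ ν) = -1 ∧ (g (Φ y) *ᵥ ν) 0 < 0

/-- Second fundamental form `K(∂ₐ, ∂_b) = g(∇ₐ ν, ∂_b) = - g(∇ₐ ∂_b Φ, ν)` with respect to the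
normal vector `ν`. -/
def secondForm (g : (Fin 4 → ℝ) → Matrix (Fin 4) (Fin 4) ℝ) (Φ : (Fin 3 → ℝ) → (Fin 4 → ℝ))
    (y : Fin 3 → ℝ) (ν : Fin 4 → ℝ) : Matrix (Fin 3) (Fin 3) ℝ :=
  Matrix.of fun a b => -(covDeriv g Φ a b y ⬝ᵥ (g (Φ y) *ᵥ ν))

/-- The hypersurface has mean curvature `H` at the parameter `y`: one third of the trace of the
second fundamental form with respect to the future directed unit normal equals `H`. -/
def HasMeanCurvatureAt (g : (Fin 4 → ℝ) → Matrix (Fin 4) (Fin 4) ℝ)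
    (Φ : (Fin 3 → ℝ) → (Fin 4 → ℝ)) (y : Fin 3 → ℝ) (H : ℝ) : Prop :=
  ∃ ν, IsFutureUnitNormal g Φ y ν ∧
    (1 / 3) * ((firstForm g Φ y)⁻¹ * secondForm g Φ y ν).trace = H

end LorentzGeometry

namespace ReissnerNordstrom

open LorentzGeometry

/-- Outer horizon radius `r₊ = M + √(M² - e²)`. -/
def rPlus (M e : ℝ) : ℝ := M + √(M ^ 2 - e ^ 2)

/-- Inner horizon radius `r₋ = M - √(M² - e²)`. -/
def rMinus (M e : ℝ) : ℝ := M - √(M ^ 2 - e ^ 2)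

/-- `sin (πU/2) · sin (πV/2)` for the null coordinates `U = T - X`, `V = T + X`. -/
def sinProd (T X : ℝ) : ℝ :=
  Real.sin (Real.pi * (T - X) / 2) * Real.sin (Real.pi * (T + X) / 2)

/-- `cos (πU/2) · cos (πV/2)` for the null coordinates `U = T - X`, `V = T + X`. -/
def cosProd (T X : ℝ) : ℝ :=
  Real.cos (Real.pi * (T - X) / 2) * Real.cos (Real.pi * (T + X) / 2)

/-- The relation between the Penrose coordinates `(T, X)` and the area radius `r` (`0 < e² < M²`).

Let `r* = r + (r₊² log|r - r₊| - r₋² log|r - r₋|) / (r₊ - r₋)`, so that `dr*/dr = 1 / h` with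
`h(r) = 1 - 2M/r + e²/r² = (r - r₊)(r - r₋) / r²`, and let
`F(U) = (2 / (r₊ - r₋)) (r₊² log|sin (πU/2)| - r₋² log|cos (πU/2)|)`.
In each block of the Penrose diagram the static coordinates are
`t = (F(V) - F(U)) / 2`, `r* = (F(U) + F(V)) / 2`, `U = T - X`, `V = T + X`.
Written with the positive quantities `a = (r₊ - r) / (sin (πU/2) sin (πV/2))` and
`b = (r - r₋) / (cos (πU/2) cos (πV/2))`, which stay regular at the horizons, the second equation
is `r₊² log a + (r₊ - r₋) r = r₋² log b`. This form also makes sense on the horizons `r = r₊`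
(where `sinProd = 0`) and `r = r₋` (where `cosProd = 0`). The components of `d` are `r, a, b`. -/
def IsPenroseData (M e T X : ℝ) (d : ℝ × ℝ × ℝ) : Prop :=
  0 < d.1 ∧ 0 < d.2.1 ∧ 0 < d.2.2 ∧
  rPlus M e - d.1 = d.2.1 * sinProd T X ∧
  d.1 - rMinus M e = d.2.2 * cosProd T X ∧
  (rPlus M e) ^ 2 * Real.log d.2.1 + (rPlus M e - rMinus M e) * d.1 =
    (rMinus M e) ^ 2 * Real.log d.2.2

/-- The relation determines `r, a, b` uniquely. -/
theorem IsPenroseData.unique {M e T X : ℝ} (hM : 0 < M) (he : e ≠ 0) (heM : e ^ 2 < M ^ 2)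
    {d d' : ℝ × ℝ × ℝ} (h : IsPenroseData M e T X d) (h' : IsPenroseData M e T X d') :
    d = d' := by
  have hq : 0 < √(M ^ 2 - e ^ 2) := Real.sqrt_pos.2 (by linarith)
  have hq2 : √(M ^ 2 - e ^ 2) ^ 2 = M ^ 2 - e ^ 2 := Real.sq_sqrt (by linarith)
  have he2 : 0 < e ^ 2 := by positivity
  have hqM : √(M ^ 2 - e ^ 2) < M := by nlinarith
  have hm : 0 < rMinus M e := by unfold rMinus; linarith
  have hp : 0 < rPlus M e := by unfold rPlus; linarith
  have hpm : rMinus M e < rPlus M e := by unfold rMinus rPlus; linarith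
  obtain ⟨r, a, b⟩ := d
  obtain ⟨r', a', b'⟩ := d'
  unfold IsPenroseData at h h'
  dsimp only at h h'
  generalize rPlus M e = p at *
  generalize rMinus M e = m at *
  generalize sinProd T X = s at *
  generalize cosProd T X = c at *
  have key : ∀ r a b r' a' b' : ℝ,
      (0 < r ∧ 0 < a ∧ 0 < b ∧ p - r = a * s ∧ r - m = b * c ∧
        p ^ 2 * Real.log a + (p - m) * r = m ^ 2 * Real.log b) →
      (0 < r' ∧ 0 < a' ∧ 0 < b' ∧ p - r' = a' * s ∧ r' - m = b' * c ∧
        p ^ 2 * Real.log a' + (p - m) * r' = m ^ 2 * Real.log b') → ¬ r < r' := by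
    rintro r a b r' a' b' ⟨h1, h2, h3, h4, h5, h6⟩ ⟨k1, k2, k3, k4, k5, k6⟩ hlt
    have hs : s ≠ 0 := by rintro rfl; linarith
    have hc : c ≠ 0 := by rintro rfl; linarith
    have no : ∀ x ∈ Set.Icc r r', x - p ≠ 0 ∧ x - m ≠ 0 := by
      rintro x ⟨hx, hx'⟩
      constructor
      · rcases lt_or_gt_of_ne hs with hs | hs
        · have := mul_neg_of_pos_of_neg h2 hs
          exact ne_of_gt (by linarith)
        · have := mul_pos k2 hs
          exact ne_of_lt (by linarith)
      · rcases lt_or_gt_of_ne hc with hc | hc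
        · have := mul_neg_of_pos_of_neg k3 hc
          exact ne_of_lt (by linarith)
        · have := mul_pos h3 hc
          exact ne_of_gt (by linarith)
    have dG : ∀ x ∈ Set.Icc r r', HasDerivAt
        (fun x => p ^ 2 * Real.log (x - p) - m ^ 2 * Real.log (x - m) + (p - m) * x)
        (p ^ 2 * (1 / (x - p)) - m ^ 2 * (1 / (x - m)) + (p - m) * 1) x := fun x hx =>
      ((((hasDerivAt_id x).sub_const p).log (no x hx).1).const_mul _).sub
        ((((hasDerivAt_id x).sub_const m).log (no x hx).2).const_mul _) |>.add
        ((hasDerivAt_id x).const_mul _)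
    have val : ∀ r a b : ℝ, 0 < a → 0 < b → p - r = a * s → r - m = b * c →
        p ^ 2 * Real.log a + (p - m) * r = m ^ 2 * Real.log b →
        p ^ 2 * Real.log (r - p) - m ^ 2 * Real.log (r - m) + (p - m) * r =
          p ^ 2 * Real.log s - m ^ 2 * Real.log c := by
      intro r a b ha hb e1 e2 e3
      have : r - p = -(a * s) := by linarith
      rw [this, e2, Real.log_neg_eq_log, Real.log_mul ha.ne' hs, Real.log_mul hb.ne' hc]
      linarith
    obtain ⟨x, hx, hx0⟩ := exists_hasDerivAt_eq_zero hlt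
      (fun x hx => (dG x hx).continuousAt.continuousWithinAt)
      ((val r a b h2 h3 h4 h5 h6).trans (val r' a' b' k2 k3 k4 k5 k6).symm)
      (fun x hx => dG x ⟨hx.1.le, hx.2.le⟩)
    obtain ⟨n1, n2⟩ := no x ⟨hx.1.le, hx.2.le⟩
    have hxpos : 0 < x := h1.trans hx.1
    have h9 : (p - m) * x ^ 2 = 0 := by
      field_simp at hx0
      linear_combination hx0
    have : 0 < (p - m) * x ^ 2 := mul_pos (by linarith) (by positivity)
    linarith
  have hr : r = r' := le_antisymm (not_lt.1 (key _ _ _ _ _ _ h' h)) (not_lt.1 (key _ _ _ _ _ _ h h'))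
  subst hr
  obtain ⟨h1, h2, h3, h4, h5, h6⟩ := h
  obtain ⟨k1, k2, k3, k4, k5, k6⟩ := h'
  by_cases hs : s = 0
  · have hc : c ≠ 0 := by
      rintro rfl
      subst hs
      linarith
    have hb : b = b' := mul_right_cancel₀ hc (h5.symm.trans k5)
    subst hb
    have hl : Real.log a = Real.log a' :=
      mul_left_cancel₀ (pow_ne_zero 2 hp.ne') (by linarith)
    rw [Real.log_injOn_pos h2 k2 hl]
  · have ha : a = a' := mul_right_cancel₀ hs (h4.symm.trans k4)
    subst ha
    have hl : Real.log b = Real.log b' :=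
      mul_left_cancel₀ (pow_ne_zero 2 hm.ne') (by linarith)
    rw [Real.log_injOn_pos h3 k3 hl]

/-- The set of `(T, X)` in the Penrose diagram of the maximally extended spacetime: the infinite
vertical chain of blocks of all types around the axis `X = 0`, together with the horizons that
separate them. (By periodicity the defining relation has further solutions with `1 ≤ |X|`; they
belong to other copies of blocks, which are not connected to this chain.) -/
def penroseDiagram (M e : ℝ) : Set (ℝ × ℝ) :=
  {p | |p.2| < 1 ∧ ∃ d, IsPenroseData M e p.1 p.2 d}

/-- The triple `(r, a, b)` attached to a point of the Penrose diagram. -/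
def penroseData (M e T X : ℝ) : ℝ × ℝ × ℝ :=
  Classical.epsilon (IsPenroseData M e T X)

/-- The area radius `r` as a function on the Penrose diagram. -/
def radius (M e T X : ℝ) : ℝ := (penroseData M e T X).1

/-- The factor `r₊² cos² (πu/2) + r₋² sin² (πu/2)`; one has
`F'(u) = π / (r₊ - r₋) * nullFactor u / (sin (πu/2) cos (πu/2))`. -/
def nullFactor (M e u : ℝ) : ℝ :=
  (rPlus M e) ^ 2 * Real.cos (Real.pi * u / 2) ^ 2 +
    (rMinus M e) ^ 2 * Real.sin (Real.pi * u / 2) ^ 2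

/-- The conformal factor `Ω² = - h(r) F'(U) F'(V)`, in the form that is regular at the horizons;
in each block `-h dt² + dr²/h = Ω² (-dT² + dX²)`. -/
def conformalFactor (M e T X : ℝ) : ℝ :=
  (Real.pi / (rPlus M e - rMinus M e)) ^ 2 * (penroseData M e T X).2.1 *
    (penroseData M e T X).2.2 / (radius M e T X) ^ 2 *
    nullFactor M e (T - X) * nullFactor M e (T + X)

/-- The Reissner–Nordström metric `Ω² (-dT² + dX²) + r² (dθ² + sin² θ dφ²)` in the coordinates
`x = (T, X, θ, φ)`. -/
def metric (M e : ℝ) (x : Fin 4 → ℝ) : Matrix (Fin 4) (Fin 4) ℝ :=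
  Matrix.diagonal ![-conformalFactor M e (x 0) (x 1), conformalFactor M e (x 0) (x 1),
    (radius M e (x 0) (x 1)) ^ 2, (radius M e (x 0) (x 1)) ^ 2 * Real.sin (x 2) ^ 2]

/-- The spherically symmetric hypersurface `(X, θ, φ) ↦ (T(X), X, θ, φ)`. -/
def graphMap (T : ℝ → ℝ) (y : Fin 3 → ℝ) : Fin 4 → ℝ := ![T (y 0), y 0, y 1, y 2]

/-- `T`, restricted to the open interval `I`, is a smooth graph in the Penrose diagram whose
hypersurface `Σ : (T = T(X), X, θ, φ)`, `X ∈ I`, is spacelike, spherically symmetric and of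
constant mean curvature `H`. -/
def IsSSCMC (M e H : ℝ) (I : Set ℝ) (T : ℝ → ℝ) : Prop :=
  IsOpen I ∧ I.OrdConnected ∧ I.Nonempty ∧ ContDiffOn ℝ (⊤ : ℕ∞) T I ∧
  (∀ X ∈ I, (T X, X) ∈ penroseDiagram M e) ∧
  ∀ X ∈ I, ∀ θ ∈ Set.Ioo 0 Real.pi, ∀ φ : ℝ,
    IsSpacelikeAt (metric M e) (graphMap T) ![X, θ, φ] ∧
    HasMeanCurvatureAt (metric M e) (graphMap T) ![X, θ, φ] H

/-- An SS-CMC hypersurface that is symmetric with respect to the `T`-axis `X = 0`. -/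
def IsTSSCMC (M e H : ℝ) (I : Set ℝ) (T : ℝ → ℝ) : Prop :=
  IsSSCMC M e H I T ∧ ∀ X ∈ I, -X ∈ I ∧ T (-X) = T X

/-- An SS-CMC hypersurface is inextendible if it is not a proper part of another SS-CMC
hypersurface with the same mean curvature. -/
def IsInextendible (M e H : ℝ) (I : Set ℝ) (T : ℝ → ℝ) : Prop :=
  ∀ (J : Set ℝ) (S : ℝ → ℝ), IsSSCMC M e H J S → I ⊆ J → Set.EqOn S T I → J = I

end ReissnerNordstrom

end

section

open Set Filter Topology LorentzGeometry
open scoped ContDiff Matrix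

namespace ReissnerNordstrom

/-! The constant mean curvature condition for a graph `T(X)` is a second order ODE. With the
rapidity `ψ = artanh T'` it becomes the first order system `T' = tanh ψ`, `ψ' = rhs`, which is
smooth on the whole Penrose diagram, horizons included (`hasMeanCurvatureAt_iff`, `IsSSCMC.isSolAt`,
`isSSCMC_of_isSolAt`). Both the metric and the system are invariant under `X ↦ -X`, so a symmetric
hypersurface is the same thing as a solution orthogonal to the axis, `ψ(0) = 0`, together with its
mirror image. The boundary problem is therefore a shooting problem: start at `(T₀, a)` with `a =
|X₀|`, choose the rapidity `b` there, and ask that the rapidity at `X = 0` vanish.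

Existence. A graph with `|T'| < 1` through `(T₀, a)` stays over `[0, a]` in the causal diamond with
corners `(T₀, ± a)`, and this compact diamond lies in the Penrose diagram (`diamond_subset`), so
such a graph cannot reach the singularity before the axis. On the diamond `rhs` is bounded uniformly
in `ψ`; after a cutoff (`exists_cutoff_rhs`) all solutions live on the whole interval. The rapidity
at the axis then differs from `b` by a bounded amount and depends continuously on `b`, so the
intermediate value theorem gives a zero (`exists_isSolAt`).

Uniqueness. The shooting map is shown to increase strictly through each of its zeros, and a
continuous function with that property has at most one zero (`zero_unique_of_eventually`). Strict
increase is a maximum principle for the Jacobi operator. In terms of the normal displacement and a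
weighted momentum, the linearized system takes the form `η' = A ζ`, `ζ' = B η` with `A > 0` and `B ≥
0`, because the potential `Ω² (|K|² + Ric(ν, ν))` is nonnegative (`hasDerivAt_jacobiCoeff`,
`jacobiPotential_nonneg`). Running from `X = a`, where the displacement vanishes, back to the axis,
the momentum keeps its sign (`pos_of_cone_system`); on the axis it is `r²` times the variation of
the rapidity (`jacobiCoeff_axis`). The argument is applied to the actual difference of two solutions
with quadratic error terms, so the flow never has to be differentiated in its initial data
(`eventually_pos_mul_of_axis`).

Two symmetric hypersurfaces with the same boundary data thus agree on the intersection of their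
domains (`IsTSSCMCThrough.eqOn`), and the union of all of them is the required maximal one. Any
spherically symmetric extension of it is still orthogonal to the axis, so it can be symmetrized and
must already belong to the union; this gives inextendibility. -/

/-- The parameters of a non-degenerate charged black hole: `0 < e² < M²`. -/
structure Subextremal (M e : ℝ) : Prop where
  mass_pos : 0 < M
  charge_ne : e ≠ 0
  charge_lt : e ^ 2 < M ^ 2

namespace Subextremal

variable {M e : ℝ}

theorem rMinus_pos (h : Subextremal M e) : 0 < rMinus M e := by
  have hq2 : √(M ^ 2 - e ^ 2) ^ 2 = M ^ 2 - e ^ 2 := Real.sq_sqrt (by linarith [h.charge_lt])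
  have he2 : 0 < e ^ 2 := by have := h.charge_ne; positivity
  have := h.mass_pos
  have : √(M ^ 2 - e ^ 2) < M := by nlinarith [Real.sqrt_nonneg (M ^ 2 - e ^ 2)]
  unfold rMinus
  linarith

theorem rMinus_lt_rPlus (h : Subextremal M e) : rMinus M e < rPlus M e := by
  have hq : 0 < √(M ^ 2 - e ^ 2) := Real.sqrt_pos.2 (by linarith [h.charge_lt])
  unfold rMinus rPlus
  linarith

theorem rPlus_add_rMinus (_ : Subextremal M e) : rPlus M e + rMinus M e = 2 * M := by
  unfold rMinus rPlus
  ring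

theorem rPlus_mul_rMinus (h : Subextremal M e) : rPlus M e * rMinus M e = e ^ 2 := by
  have hq2 : √(M ^ 2 - e ^ 2) ^ 2 = M ^ 2 - e ^ 2 := Real.sq_sqrt (by linarith [h.charge_lt])
  unfold rMinus rPlus
  linear_combination -hq2

end Subextremal

/-! ### Smooth dependence of the radius on the Penrose coordinates -/

theorem isPenroseData_penroseData {M e : ℝ} {q : ℝ × ℝ} (hq : q ∈ penroseDiagram M e) :
    IsPenroseData M e q.1 q.2 (penroseData M e q.1 q.2) :=
  Classical.epsilon_spec hq.2

theorem penroseData_eq {M e T X : ℝ} (h : Subextremal M e) {d : ℝ × ℝ × ℝ}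
    (hd : IsPenroseData M e T X d) : penroseData M e T X = d :=
  IsPenroseData.unique h.mass_pos h.charge_ne h.charge_lt (Classical.epsilon_spec ⟨d, hd⟩) hd

/-- `log b` as a function of `r` and `log a`. -/
noncomputable def logB (p m : ℝ) (x : ℝ × ℝ) : ℝ :=
  (m ^ 2)⁻¹ * (p ^ 2 * x.2 + (p - m) * x.1)

/-- The map `(r, log a) ↦ (sinProd, cosProd)` inverting the relation between Penrose coordinates
and the area radius. -/
noncomputable def penroseMap (p m : ℝ) (x : ℝ × ℝ) : ℝ × ℝ :=
  ((p - x.1) * Real.exp (-x.2), (x.1 - m) * Real.exp (-logB p m x))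

theorem contDiff_penroseMap (p m : ℝ) : ContDiff ℝ ∞ (penroseMap p m) := by
  unfold penroseMap logB
  fun_prop

/-- Up to nonvanishing factors the Jacobian determinant is `(p - m) r²`: eliminating `v` from the
kernel equations leaves `(p - m) r² w = 0`. It does not degenerate at `r = p` or `r = m`, so the
inverse function theorem also works on the horizons. -/
theorem hasFDerivAt_penroseMap {p m : ℝ} (hm : 0 < m) (hpm : m < p) {x : ℝ × ℝ} (hx : 0 < x.1) :
    ∃ f' : (ℝ × ℝ) ≃L[ℝ] (ℝ × ℝ), HasFDerivAt (penroseMap p m) (f' : ℝ × ℝ →L[ℝ] ℝ × ℝ) x := by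
  set f' := fderiv ℝ (penroseMap p m) x with hf'
  have hd : HasFDerivAt (penroseMap p m) f' x :=
    ((contDiff_penroseMap p m).differentiable (by simp) x).hasFDerivAt
  have h1 : HasFDerivAt (fun x : ℝ × ℝ => x.1) (ContinuousLinearMap.fst ℝ ℝ ℝ) x :=
    hasFDerivAt_fst
  have h2 : HasFDerivAt (fun x : ℝ × ℝ => x.2) (ContinuousLinearMap.snd ℝ ℝ ℝ) x :=
    hasFDerivAt_snd
  have hA := (h1.const_sub p).mul h2.neg.exp
  have hl : HasFDerivAt (logB p m) _ x :=
    ((h2.const_mul (p ^ 2)).add (h1.const_mul (p - m))).const_mul (m ^ 2)⁻¹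
  have hB := (h1.sub_const m).mul hl.neg.exp
  have hE : f' = _ := hd.unique (hA.prodMk hB)
  have hinj : Function.Injective (f' : ℝ × ℝ →ₗ[ℝ] ℝ × ℝ) := by
    rw [← LinearMap.ker_eq_bot, LinearMap.ker_eq_bot']
    rintro ⟨v, w⟩ hv
    have hv' : f' (v, w) = 0 := hv
    rw [hE] at hv'
    obtain ⟨e1, e2⟩ := Prod.mk_inj.1 hv'
    simp at e1 e2
    have E1 := (Real.exp_pos (-x.2)).ne'
    have E2 := (Real.exp_pos (-logB p m x)).ne'
    have e1' : -v - (p - x.1) * w = 0 := by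
      apply mul_right_cancel₀ E1
      linear_combination e1
    have e2' : v - (x.1 - m) * ((m ^ 2)⁻¹ * (p ^ 2 * w + (p - m) * v)) = 0 := by
      apply mul_right_cancel₀ E2
      linear_combination e2
    have hm0 := hm.ne'
    field_simp at e2'
    have hw : ((p - m) * x.1 ^ 2) * w = 0 := by
      linear_combination -(m ^ 2 - (x.1 - m) * (p - m)) * e1' - e2'
    have hw0 : w = 0 := by
      have : (p - m) * x.1 ^ 2 ≠ 0 := (mul_pos (by linarith) (by positivity)).ne'
      exact (mul_eq_zero.1 hw).resolve_left this
    subst hw0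
    have : v = 0 := by linear_combination -e1'
    simp [this]
  refine ⟨(LinearEquiv.ofInjectiveEndo (f' : ℝ × ℝ →ₗ[ℝ] ℝ × ℝ) hinj).toContinuousLinearEquiv, ?_⟩
  convert! hd

/-- The radius and the auxiliary quantities extend smoothly to a neighbourhood of every solution
of the defining relation. -/
theorem IsPenroseData.exists_contDiffAt {M e : ℝ} (h : Subextremal M e) {q : ℝ × ℝ}
    {d : ℝ × ℝ × ℝ} (hd : IsPenroseData M e q.1 q.2 d) :
    ∃ g : ℝ × ℝ → ℝ × ℝ × ℝ, ContDiffAt ℝ ∞ g q ∧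
      ∀ᶠ x in 𝓝 q, IsPenroseData M e x.1 x.2 (g x) := by
  obtain ⟨r, a, b⟩ := d
  obtain ⟨hr, ha, hb, e1, e2, e3⟩ := hd
  dsimp only at hr ha hb e1 e2 e3
  set p := rPlus M e
  set m := rMinus M e
  have hm : 0 < m := h.rMinus_pos
  have hm0 := hm.ne'
  obtain ⟨f', hf'⟩ := hasFDerivAt_penroseMap hm h.rMinus_lt_rPlus (x := (r, Real.log a)) hr
  have hC : ContDiffAt ℝ ∞ (penroseMap p m) (r, Real.log a) := (contDiff_penroseMap p m).contDiffAt
  have hlB : logB p m (r, Real.log a) = Real.log b := by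
    simp only [logB]
    field_simp
    linear_combination e3
  have hval : penroseMap p m (r, Real.log a) = (sinProd q.1 q.2, cosProd q.1 q.2) := by
    simp only [penroseMap, hlB, Real.exp_neg, Real.exp_log ha, Real.exp_log hb, e1, e2]
    rw [mul_assoc, mul_assoc, mul_comm (sinProd _ _), mul_comm (cosProd _ _), ← mul_assoc,
      ← mul_assoc, mul_inv_cancel₀ ha.ne', mul_inv_cancel₀ hb.ne', one_mul, one_mul]
  have hn : (∞ : WithTop ℕ∞) ≠ 0 := by simp
  set G := hC.localInverse hf' hn with hG
  have hGsm : ContDiffAt ℝ ∞ G (penroseMap p m (r, Real.log a)) := hC.to_localInverse hf' hn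
  have hG0 : G (penroseMap p m (r, Real.log a)) = (r, Real.log a) :=
    hC.localInverse_apply_image hf' hn
  have hGr : ∀ᶠ y in 𝓝 (penroseMap p m (r, Real.log a)), penroseMap p m (G y) = y :=
    (hC.hasStrictFDerivAt' hf' hn).eventually_right_inverse
  rw [hval] at hGsm hG0 hGr
  have hsc : ContDiff ℝ ∞ fun x : ℝ × ℝ => (sinProd x.1 x.2, cosProd x.1 x.2) := by
    unfold sinProd cosProd
    fun_prop
  have hGq : ContDiffAt ℝ ∞ (fun x : ℝ × ℝ => G (sinProd x.1 x.2, cosProd x.1 x.2)) q :=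
    ContDiffAt.comp q hGsm hsc.contDiffAt
  refine ⟨fun x => ((G (sinProd x.1 x.2, cosProd x.1 x.2)).1,
    Real.exp (G (sinProd x.1 x.2, cosProd x.1 x.2)).2,
    Real.exp (logB p m (G (sinProd x.1 x.2, cosProd x.1 x.2)))), ?_, ?_⟩
  · unfold logB
    fun_prop
  · have hpos : ∀ᶠ x in 𝓝 q, 0 < (G (sinProd x.1 x.2, cosProd x.1 x.2)).1 := by
      have : ContinuousAt (fun x : ℝ × ℝ => (G (sinProd x.1 x.2, cosProd x.1 x.2)).1) q :=
        hGq.continuousAt.fst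
      exact this.eventually (lt_mem_nhds (by simpa [hG0] using hr))
    have hev := hsc.continuous.continuousAt.eventually hGr
    filter_upwards [hpos, hev] with x hx1 hx2
    obtain ⟨k1, k2⟩ := Prod.mk_inj.1 hx2
    generalize G (sinProd x.1 x.2, cosProd x.1 x.2) = y at hx1 k1 k2 ⊢
    refine ⟨hx1, Real.exp_pos _, Real.exp_pos _, ?_, ?_, ?_⟩
    · dsimp only
      rw [← k1, mul_left_comm, ← Real.exp_add]
      simp [p]
    · dsimp only
      rw [← k2, mul_left_comm, ← Real.exp_add]
      simp [m]
    · simp only [Real.log_exp, logB]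
      field_simp
      ring

theorem eventually_mem_penroseDiagram {M e : ℝ} (h : Subextremal M e) {q : ℝ × ℝ}
    (hq : q ∈ penroseDiagram M e) : ∀ᶠ x in 𝓝 q, x ∈ penroseDiagram M e := by
  obtain ⟨g, -, hg⟩ := (isPenroseData_penroseData hq).exists_contDiffAt h
  have : ∀ᶠ x : ℝ × ℝ in 𝓝 q, |x.2| < 1 :=
    (continuous_abs.comp continuous_snd).continuousAt.eventually (gt_mem_nhds hq.1)
  filter_upwards [hg, this] with x h1 h2
  exact ⟨h2, _, h1⟩

theorem isOpen_penroseDiagram {M e : ℝ} (h : Subextremal M e) : IsOpen (penroseDiagram M e) :=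
  isOpen_iff_mem_nhds.2 fun _ hq => eventually_mem_penroseDiagram h hq

/-- `penroseData` is a pointwise choice, but by uniqueness of the solution it coincides near `q`
with the smooth branch given by the inverse function theorem. -/
theorem contDiffAt_penroseData {M e : ℝ} (h : Subextremal M e) {q : ℝ × ℝ}
    (hq : q ∈ penroseDiagram M e) :
    ContDiffAt ℝ ∞ (fun x : ℝ × ℝ => penroseData M e x.1 x.2) q := by
  obtain ⟨g, hgs, hg⟩ := (isPenroseData_penroseData hq).exists_contDiffAt h
  refine hgs.congr_of_eventuallyEq ?_
  filter_upwards [hg] with x hx using penroseData_eq h hx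

end ReissnerNordstrom

/-! ### Null derivatives, the reflection symmetry and the gradient of the radius -/

namespace ReissnerNordstrom

/-- The null derivative `∂_U = (∂_T - ∂_X) / 2`. -/
noncomputable def dU (φ : ℝ × ℝ → ℝ) (q : ℝ × ℝ) : ℝ := fderiv ℝ φ q (1 / 2, -(1 / 2))

/-- The null derivative `∂_V = (∂_T + ∂_X) / 2`. -/
noncomputable def dV (φ : ℝ × ℝ → ℝ) (q : ℝ × ℝ) : ℝ := fderiv ℝ φ q (1 / 2, 1 / 2)

section NullDerivatives

variable {φ ψ : ℝ × ℝ → ℝ} {q : ℝ × ℝ}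

theorem _root_.ContDiffAt.dU (h : ContDiffAt ℝ ∞ φ q) : ContDiffAt ℝ ∞ (dU φ) q :=
  (h.fderiv_right (m := ∞) (by simp)).clm_apply contDiffAt_const

theorem _root_.ContDiffAt.dV (h : ContDiffAt ℝ ∞ φ q) : ContDiffAt ℝ ∞ (dV φ) q :=
  (h.fderiv_right (m := ∞) (by simp)).clm_apply contDiffAt_const

theorem dU_comm_dV (h : ContDiffAt ℝ ∞ φ q) : dU (dV φ) q = dV (dU φ) q := by
  have hs : IsSymmSndFDerivAt ℝ φ q := h.isSymmSndFDerivAt (by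
    rw [minSmoothness_of_isRCLikeNormedField]
    exact ENat.LEInfty.out)
  have hd : DifferentiableAt ℝ (fderiv ℝ φ) q :=
    (h.fderiv_right (m := 1) (by
      rw [one_add_one_eq_two]
      exact ENat.LEInfty.out)).differentiableAt (by simp)
  have key : ∀ v w : ℝ × ℝ, fderiv ℝ (fun x => fderiv ℝ φ x v) q w =
      fderiv ℝ (fderiv ℝ φ) q w v := fun v w => by
    rw [fderiv_clm_apply hd (differentiableAt_const _)]
    simp
  unfold dU dV
  rw [key, key, hs.eq]

theorem hasDerivAt_dU (h : DifferentiableAt ℝ φ q) :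
    HasDerivAt (fun t : ℝ => φ (q.1 + t / 2, q.2 - t / 2)) (dU φ q) 0 := by
  have hl : HasDerivAt (fun t : ℝ => (q.1 + t / 2, q.2 - t / 2)) ((1 / 2 : ℝ), -(1 / 2 : ℝ)) 0 :=
    (((hasDerivAt_id (0 : ℝ)).div_const 2).const_add q.1).prodMk
      (((hasDerivAt_id (0 : ℝ)).div_const 2).const_sub q.2)
  have h' : HasFDerivAt φ (fderiv ℝ φ q) ((fun t : ℝ => (q.1 + t / 2, q.2 - t / 2)) 0) := by
    simpa using h.hasFDerivAt
  exact h'.comp_hasDerivAt (0 : ℝ) hl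

theorem hasDerivAt_dV (h : DifferentiableAt ℝ φ q) :
    HasDerivAt (fun t : ℝ => φ (q.1 + t / 2, q.2 + t / 2)) (dV φ q) 0 := by
  have hl : HasDerivAt (fun t : ℝ => (q.1 + t / 2, q.2 + t / 2)) ((1 / 2 : ℝ), (1 / 2 : ℝ)) 0 :=
    (((hasDerivAt_id (0 : ℝ)).div_const 2).const_add q.1).prodMk
      (((hasDerivAt_id (0 : ℝ)).div_const 2).const_add q.2)
  have h' : HasFDerivAt φ (fderiv ℝ φ q) ((fun t : ℝ => (q.1 + t / 2, q.2 + t / 2)) 0) := by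
    simpa using h.hasFDerivAt
  exact h'.comp_hasDerivAt (0 : ℝ) hl

theorem tendsto_lineU (q : ℝ × ℝ) :
    Tendsto (fun t : ℝ => (q.1 + t / 2, q.2 - t / 2)) (𝓝 0) (𝓝 q) := by
  have : Continuous fun t : ℝ => (q.1 + t / 2, q.2 - t / 2) := by fun_prop
  simpa using this.tendsto 0

theorem tendsto_lineV (q : ℝ × ℝ) :
    Tendsto (fun t : ℝ => (q.1 + t / 2, q.2 + t / 2)) (𝓝 0) (𝓝 q) := by
  have : Continuous fun t : ℝ => (q.1 + t / 2, q.2 + t / 2) := by fun_prop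
  simpa using this.tendsto 0

/-- The reflection `X ↦ -X`. -/
def reflect : (ℝ × ℝ) ≃L[ℝ] (ℝ × ℝ) :=
  (ContinuousLinearEquiv.refl ℝ ℝ).prodCongr (ContinuousLinearEquiv.neg ℝ)

@[simp] theorem reflect_apply (q : ℝ × ℝ) : reflect q = (q.1, -q.2) := rfl

theorem dV_comp_reflect (φ : ℝ × ℝ → ℝ) (q : ℝ × ℝ) :
    dV (φ ∘ reflect) q = dU φ (reflect q) := by
  unfold dV dU
  rw [reflect.comp_right_fderiv]
  simp

theorem dU_comp_reflect (φ : ℝ × ℝ → ℝ) (q : ℝ × ℝ) :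
    dU (φ ∘ reflect) q = dV φ (reflect q) := by
  unfold dV dU
  rw [reflect.comp_right_fderiv]
  simp

/-- Chain rule along a graph `X ↦ (T(X), X)`. -/
theorem hasDerivAt_comp_graph {T : ℝ → ℝ} {X T' : ℝ} (hT : HasDerivAt T T' X)
    (h : DifferentiableAt ℝ φ (T X, X)) :
    HasDerivAt (fun x => φ (T x, x)) ((T' + 1) * dV φ (T X, X) + (T' - 1) * dU φ (T X, X)) X := by
  have := HasFDerivAt.comp_hasDerivAt (f := fun x => (T x, x)) X h.hasFDerivAt
    (hT.prodMk (hasDerivAt_id X))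
  convert! this using 1
  unfold dU dV
  rw [← smul_eq_mul, ← smul_eq_mul, ← map_smul, ← map_smul, ← map_add]
  congr 1
  ext <;> simp <;> ring

end NullDerivatives

/-- The area radius as a function on `ℝ²`. -/
noncomputable def rad (M e : ℝ) (q : ℝ × ℝ) : ℝ := radius M e q.1 q.2

/-- The conformal factor `Ω²` as a function on `ℝ²`. -/
noncomputable def cf (M e : ℝ) (q : ℝ × ℝ) : ℝ := conformalFactor M e q.1 q.2

/-- The logarithm of the conformal factor. -/
noncomputable def logCf (M e : ℝ) (q : ℝ × ℝ) : ℝ := Real.log (cf M e q)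

/-- The components of the Killing field `∂_t = k(V) ∂_V - k(U) ∂_U`. -/
noncomputable def killing (M e u : ℝ) : ℝ :=
  (rPlus M e - rMinus M e) / Real.pi *
    (Real.sin (Real.pi * u / 2) * Real.cos (Real.pi * u / 2)) / nullFactor M e u

section Background

variable {M e : ℝ} {q : ℝ × ℝ}

theorem nullFactor_pos (h : Subextremal M e) (u : ℝ) : 0 < nullFactor M e u := by
  have h1 := h.rMinus_pos
  have h2 := h.rMinus_lt_rPlus
  have h3 : Real.cos (Real.pi * u / 2) ^ 2 = 1 - Real.sin (Real.pi * u / 2) ^ 2 := by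
    linarith [Real.sin_sq_add_cos_sq (Real.pi * u / 2)]
  have h4 := Real.sin_sq_le_one (Real.pi * u / 2)
  unfold nullFactor
  rw [h3]
  have h5 : 0 < (rMinus M e) ^ 2 := by positivity
  have h6 : (rMinus M e) ^ 2 < (rPlus M e) ^ 2 := by nlinarith
  nlinarith

theorem rad_pos (hq : q ∈ penroseDiagram M e) : 0 < rad M e q :=
  (isPenroseData_penroseData hq).1

theorem cf_pos (h : Subextremal M e) (hq : q ∈ penroseDiagram M e) : 0 < cf M e q := by
  obtain ⟨h1, h2, h3, -⟩ := isPenroseData_penroseData hq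
  have := nullFactor_pos h (q.1 - q.2)
  have := nullFactor_pos h (q.1 + q.2)
  have h4 : 0 < radius M e q.1 q.2 := h1
  have h5 : 0 < rPlus M e - rMinus M e := by linarith [h.rMinus_lt_rPlus]
  have := Real.pi_pos
  unfold cf conformalFactor
  positivity

theorem contDiff_nullFactor : ContDiff ℝ ∞ (nullFactor M e) := by
  unfold nullFactor
  fun_prop

theorem contDiff_killing (h : Subextremal M e) : ContDiff ℝ ∞ (killing M e) := by
  unfold killing
  exact ContDiff.div (by fun_prop) contDiff_nullFactor fun u => (nullFactor_pos h u).ne'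

theorem contDiffAt_rad (h : Subextremal M e) (hq : q ∈ penroseDiagram M e) :
    ContDiffAt ℝ ∞ (rad M e) q :=
  (contDiffAt_penroseData h hq).fst

theorem contDiffAt_cf (h : Subextremal M e) (hq : q ∈ penroseDiagram M e) :
    ContDiffAt ℝ ∞ (cf M e) q := by
  have hd := contDiffAt_penroseData h hq
  have hr := contDiffAt_rad h hq
  have h0 : rad M e q ^ 2 ≠ 0 := pow_ne_zero 2 (rad_pos hq).ne'
  have hn : ∀ x, ContDiffAt ℝ ∞ (nullFactor M e) x := fun x => contDiff_nullFactor.contDiffAt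
  have h1 : ContDiffAt ℝ ∞ (fun x : ℝ × ℝ => nullFactor M e (x.1 - x.2)) q :=
    ContDiffAt.comp q (hn _) (by fun_prop)
  have h2 : ContDiffAt ℝ ∞ (fun x : ℝ × ℝ => nullFactor M e (x.1 + x.2)) q :=
    ContDiffAt.comp q (hn _) (by fun_prop)
  exact ((((contDiffAt_const.mul hd.snd.fst).mul hd.snd.snd).div (hr.pow 2) h0).mul h1).mul h2

theorem contDiffAt_logCf (h : Subextremal M e) (hq : q ∈ penroseDiagram M e) :
    ContDiffAt ℝ ∞ (logCf M e) q :=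
  (contDiffAt_cf h hq).log (cf_pos h hq).ne'

/-- The reflection exchanges `U` and `V`, and both products are symmetric in them. The form as an
equality of predicates allows rewriting inside the choice that defines `penroseData`. -/
theorem isPenroseData_neg (T X : ℝ) : IsPenroseData M e T (-X) = IsPenroseData M e T X := by
  have h1 : sinProd T (-X) = sinProd T X := by
    simp only [sinProd, sub_neg_eq_add, ← sub_eq_add_neg, mul_comm]
  have h2 : cosProd T (-X) = cosProd T X := by
    simp only [cosProd, sub_neg_eq_add, ← sub_eq_add_neg, mul_comm]
  funext d
  simp only [IsPenroseData, h1, h2]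

theorem reflect_mem_penroseDiagram :
    reflect q ∈ penroseDiagram M e ↔ q ∈ penroseDiagram M e := by
  simp [penroseDiagram, isPenroseData_neg]

theorem rad_comp_reflect : rad M e ∘ reflect = rad M e := by
  funext q
  simp [rad, radius, penroseData, isPenroseData_neg]

theorem cf_comp_reflect : cf M e ∘ reflect = cf M e := by
  funext q
  simp only [cf, conformalFactor, radius, penroseData, isPenroseData_neg, Function.comp,
    reflect_apply, sub_neg_eq_add, ← sub_eq_add_neg]
  ring

theorem logCf_comp_reflect : logCf M e ∘ reflect = logCf M e := by
  funext q
  have := congrFun (cf_comp_reflect (M := M) (e := e)) q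
  simp only [Function.comp] at this
  simp only [logCf, Function.comp, this]

theorem dV_eq_of_comp_reflect {φ : ℝ × ℝ → ℝ} (hφ : φ ∘ reflect = φ) (q : ℝ × ℝ) :
    dV φ q = dU φ (reflect q) := by
  rw [← dV_comp_reflect, hφ]

theorem dV_dV_eq_of_comp_reflect {φ : ℝ × ℝ → ℝ} (hφ : φ ∘ reflect = φ) (q : ℝ × ℝ) :
    dV (dV φ) q = dU (dU φ) (reflect q) := by
  rw [← dV_comp_reflect, show dV φ = dU φ ∘ reflect from funext (dV_eq_of_comp_reflect hφ)]

/-- `h(r) = -Ω² k(U) k(V)`. -/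
theorem lapse_eq (h : Subextremal M e) (hq : q ∈ penroseDiagram M e) :
    1 - 2 * M / rad M e q + e ^ 2 / rad M e q ^ 2 =
      -(cf M e q * killing M e (q.1 - q.2) * killing M e (q.1 + q.2)) := by
  obtain ⟨h1, h2, h3, e1, e2, -⟩ := isPenroseData_penroseData hq
  have hr : (penroseData M e q.1 q.2).1 ≠ 0 := h1.ne'
  have := (nullFactor_pos h (q.1 - q.2)).ne'
  have := (nullFactor_pos h (q.1 + q.2)).ne'
  have h5 : rPlus M e - rMinus M e ≠ 0 := by linarith [h.rMinus_lt_rPlus]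
  have := Real.pi_pos.ne'
  rw [← h.rPlus_mul_rMinus, ← h.rPlus_add_rMinus]
  simp only [cf, conformalFactor, rad, radius, killing]
  unfold sinProd at e1
  unfold cosProd at e2
  field_simp
  linear_combination -((penroseData M e q.1 q.2).1 - rMinus M e) * e1 -
    ((penroseData M e q.1 q.2).2.1 * (Real.sin (Real.pi * (q.1 - q.2) / 2) *
      Real.sin (Real.pi * (q.1 + q.2) / 2))) * e2

/-- Implicit differentiation of the relation between `r` and the Penrose coordinates. -/
theorem deriv_radius_aux {p m r a b s c r' a' b' s' c' : ℝ} (ha : a ≠ 0) (hb : b ≠ 0)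
    (e1 : p - r = a * s) (e2 : r - m = b * c)
    (k1 : -r' = a' * s + a * s') (k2 : r' = b' * c + b * c')
    (k3 : p ^ 2 * (a' / a) + (p - m) * r' = m ^ 2 * (b' / b)) :
    (p - m) * r ^ 2 * r' = -(a * b * (p ^ 2 * c * s' - m ^ 2 * s * c')) := by
  have j1 : -r' = (p - r) * (a' / a) + a * s' := by
    rw [k1, e1]
    field_simp
  have j2 : r' = (r - m) * (b' / b) + b * c' := by
    rw [e2]
    field_simp
    linear_combination k2
  generalize a' / a = α at *
  generalize b' / b = β at *
  linear_combination -(p - r) * (r - m) * k3 - p ^ 2 * (r - m) * j1 + m ^ 2 * (p - r) * j2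
    - p ^ 2 * a * s' * e2 + m ^ 2 * b * c' * e1

/-- The three defining relations are differentiated along the null line through `q` and the
derivatives of `a` and `b` are eliminated by `deriv_radius_aux`. No division by `sinProd` or
`cosProd` occurs, so the formula holds on the horizons. -/
theorem dU_rad (h : Subextremal M e) (hq : q ∈ penroseDiagram M e) :
    dU (rad M e) q = -(1 / 2) * cf M e q * killing M e (q.1 + q.2) := by
  obtain ⟨h1, h2, h3, e1, e2, -⟩ := isPenroseData_penroseData hq
  have hd := contDiffAt_penroseData h hq
  have dR := hasDerivAt_dU ((contDiffAt_rad h hq).differentiableAt (by simp))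
  have dA := hasDerivAt_dU (hd.snd.fst.differentiableAt (by simp))
  have dB := hasDerivAt_dU (hd.snd.snd.differentiableAt (by simp))
  have hlin : HasDerivAt (fun t : ℝ => Real.pi * ((q.1 + t / 2) - (q.2 - t / 2)) / 2)
      (Real.pi / 2) 0 := by
    have := (((((hasDerivAt_id (0 : ℝ)).div_const 2).const_add q.1).sub
      (((hasDerivAt_id (0 : ℝ)).div_const 2).const_sub q.2)).const_mul Real.pi).div_const 2
    convert! this using 1
    ring
  have dS : HasDerivAt (fun t : ℝ => sinProd (q.1 + t / 2) (q.2 - t / 2))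
      (Real.cos (Real.pi * (q.1 - q.2) / 2) * (Real.pi / 2) *
        Real.sin (Real.pi * (q.1 + q.2) / 2)) 0 := by
    have := hlin.sin.mul_const (Real.sin (Real.pi * (q.1 + q.2) / 2))
    convert! this using 1
    · funext t
      simp only [sinProd]
      ring_nf
    · simp
  have dC : HasDerivAt (fun t : ℝ => cosProd (q.1 + t / 2) (q.2 - t / 2))
      (-Real.sin (Real.pi * (q.1 - q.2) / 2) * (Real.pi / 2) *
        Real.cos (Real.pi * (q.1 + q.2) / 2)) 0 := by
    have := hlin.cos.mul_const (Real.cos (Real.pi * (q.1 + q.2) / 2))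
    convert! this using 1
    · funext t
      simp only [cosProd]
      ring_nf
    · simp
  have hev := (tendsto_lineU q).eventually (eventually_mem_penroseDiagram h hq)
  set A : ℝ × ℝ → ℝ := fun x => (penroseData M e x.1 x.2).2.1
  set B : ℝ × ℝ → ℝ := fun x => (penroseData M e x.1 x.2).2.2
  have E1 := (dR.const_sub (rPlus M e)).unique ((dA.mul dS).congr_of_eventuallyEq
    (hev.mono fun t ht => (isPenroseData_penroseData ht).2.2.2.1))
  have E2 := (dR.sub_const (rMinus M e)).unique ((dB.mul dC).congr_of_eventuallyEq
    (hev.mono fun t ht => (isPenroseData_penroseData ht).2.2.2.2.1))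
  have hA0 : A (q.1 + 0 / 2, q.2 - 0 / 2) ≠ 0 := by simpa using h2.ne'
  have hB0 : B (q.1 + 0 / 2, q.2 - 0 / 2) ≠ 0 := by simpa using h3.ne'
  have E3 := (((dA.log hA0).const_mul (rPlus M e ^ 2)).add
    (dR.const_mul (rPlus M e - rMinus M e))).unique
      (((dB.log hB0).const_mul (rMinus M e ^ 2)).congr_of_eventuallyEq
    (hev.mono fun t ht => (isPenroseData_penroseData ht).2.2.2.2.2))
  simp only [zero_div, add_zero, sub_zero] at E1 E2 E3
  have key := deriv_radius_aux h2.ne' h3.ne' e1 e2 E1 E2 E3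
  have hr : (penroseData M e q.1 q.2).1 ≠ 0 := h1.ne'
  have := (nullFactor_pos h (q.1 + q.2)).ne'
  have h5 : rPlus M e - rMinus M e ≠ 0 := by linarith [h.rMinus_lt_rPlus]
  have := Real.pi_pos.ne'
  simp only [cf, conformalFactor, radius, killing]
  unfold sinProd cosProd at key
  have hN : nullFactor M e (q.1 - q.2) = (rPlus M e) ^ 2 * Real.cos (Real.pi * (q.1 - q.2) / 2) ^ 2 +
    (rMinus M e) ^ 2 * Real.sin (Real.pi * (q.1 - q.2) / 2) ^ 2 := rfl
  field_simp
  rw [hN]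
  linear_combination 2 * key

theorem dV_rad (h : Subextremal M e) (hq : q ∈ penroseDiagram M e) :
    dV (rad M e) q = -(1 / 2) * cf M e q * killing M e (q.1 - q.2) := by
  rw [dV_eq_of_comp_reflect rad_comp_reflect, dU_rad h (reflect_mem_penroseDiagram.2 hq)]
  have := congrFun (cf_comp_reflect (M := M) (e := e)) q
  simp only [Function.comp] at this
  rw [this]
  simp [sub_eq_add_neg]

end Background

end ReissnerNordstrom

/-! ### Second derivatives of the radius and of the conformal factor -/

namespace ReissnerNordstrom

section Curvature

variable {M e : ℝ} {q : ℝ × ℝ}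

theorem dU_cf (h : Subextremal M e) (hq : q ∈ penroseDiagram M e) :
    dU (cf M e) q = cf M e q * dU (logCf M e) q := by
  have h0 := (cf_pos h hq).ne'
  have h1 := hasDerivAt_dU ((contDiffAt_cf h hq).differentiableAt (by simp))
  have h2 := hasDerivAt_dU ((contDiffAt_logCf h hq).differentiableAt (by simp))
  have h3 := h2.unique (h1.log (by simpa using h0))
  simp only [zero_div, add_zero, sub_zero] at h3
  rw [h3]
  field_simp

theorem dV_cf (h : Subextremal M e) (hq : q ∈ penroseDiagram M e) :
    dV (cf M e) q = cf M e q * dV (logCf M e) q := by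
  rw [dV_eq_of_comp_reflect cf_comp_reflect, dV_eq_of_comp_reflect logCf_comp_reflect,
    dU_cf h (reflect_mem_penroseDiagram.2 hq)]
  congr 1
  exact congrFun (cf_comp_reflect (M := M) (e := e)) q

theorem hasDerivAt_killing (h : Subextremal M e) (u : ℝ) :
    HasDerivAt (killing M e) (deriv (killing M e) u) u :=
  ((contDiff_killing h).differentiable (by simp) u).hasDerivAt

/-- In `∂_U r = -Ω² k(V) / 2` the factor `k(V)` is constant along the `U`-lines, so only the
logarithmic derivative of `Ω²` appears. -/
theorem dU_dU_rad (h : Subextremal M e) (hq : q ∈ penroseDiagram M e) :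
    dU (dU (rad M e)) q = dU (logCf M e) q * dU (rad M e) q := by
  have h1 := hasDerivAt_dU ((contDiffAt_rad h hq).dU.differentiableAt (by simp))
  have h2 := hasDerivAt_dU ((contDiffAt_cf h hq).differentiableAt (by simp))
  have hev := (tendsto_lineU q).eventually (eventually_mem_penroseDiagram h hq)
  have h3 := h1.unique (((h2.const_mul (-(1 / 2))).mul_const
    (killing M e (q.1 + q.2))).congr_of_eventuallyEq (hev.mono fun t ht => by
      beta_reduce
      rw [dU_rad h ht]
      ring_nf))
  rw [h3, dU_rad h hq, dU_cf h hq]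
  ring

theorem dV_dV_rad (h : Subextremal M e) (hq : q ∈ penroseDiagram M e) :
    dV (dV (rad M e)) q = dV (logCf M e) q * dV (rad M e) q := by
  rw [dV_dV_eq_of_comp_reflect rad_comp_reflect, dV_eq_of_comp_reflect rad_comp_reflect,
    dV_eq_of_comp_reflect logCf_comp_reflect, dU_dU_rad h (reflect_mem_penroseDiagram.2 hq)]

theorem hasDerivAt_lapse {r : ℝ → ℝ} {r' t : ℝ} (hr : HasDerivAt r r' t) (h0 : r t ≠ 0) :
    HasDerivAt (fun t => 1 - 2 * M / r t + e ^ 2 / r t ^ 2)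
      (2 * (M / r t ^ 2 - e ^ 2 / r t ^ 3) * r') t := by
  have := (((hasDerivAt_const t (2 * M)).div hr h0).const_sub 1).add
    ((hasDerivAt_const t (e ^ 2)).div (hr.pow 2) (pow_ne_zero 2 h0))
  convert! this using 1
  field_simp
  simp
  ring

/-- This is the `U`-derivative of `h(r) = -Ω² k(U) k(V)`. The common factor `k(V)` vanishes on
horizons and is kept here; `dU_logCf_mul_killing` removes it by continuity. -/
theorem killing_surface_gravity_aux (h : Subextremal M e) (hq : q ∈ penroseDiagram M e) :
    killing M e (q.1 + q.2) * (dU (logCf M e) q * killing M e (q.1 - q.2) +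
      deriv (killing M e) (q.1 - q.2) - (M / rad M e q ^ 2 - e ^ 2 / rad M e q ^ 3)) = 0 := by
  have h1 := hasDerivAt_dU ((contDiffAt_rad h hq).differentiableAt (by simp))
  have h2 := hasDerivAt_dU ((contDiffAt_cf h hq).differentiableAt (by simp))
  have hev := (tendsto_lineU q).eventually (eventually_mem_penroseDiagram h hq)
  have h0 := (rad_pos hq).ne'
  have hk : HasDerivAt (fun t : ℝ => killing M e (q.1 - q.2 + t))
      (deriv (killing M e) (q.1 - q.2)) 0 := by
    have := (hasDerivAt_killing h (q.1 - q.2 + 0)).comp_const_add (q.1 - q.2) 0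
    simpa using this
  have h3 := (hasDerivAt_lapse (M := M) (e := e) h1 (by simpa using h0)).unique
    (((h2.mul hk).mul_const (killing M e (q.1 + q.2))).neg.congr_of_eventuallyEq
      (hev.mono fun t ht => by
        beta_reduce
        rw [lapse_eq h ht]
        simp only [Pi.neg_apply, Pi.mul_apply]
        ring_nf))
  simp only [zero_div, add_zero, sub_zero] at h3
  rw [dU_rad h hq, dU_cf h hq] at h3
  apply mul_left_cancel₀ (cf_pos h hq).ne'
  linear_combination h3

theorem killing_eq_zero (h : Subextremal M e) {u : ℝ} (hu : killing M e u = 0) :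
    Real.sin (Real.pi * u) = 0 := by
  have h1 := (nullFactor_pos h u).ne'
  have h5 : rPlus M e - rMinus M e ≠ 0 := by linarith [h.rMinus_lt_rPlus]
  have h2 := Real.pi_pos.ne'
  have : Real.sin (Real.pi * u / 2) * Real.cos (Real.pi * u / 2) = 0 := by
    unfold killing at hu
    simpa [h1, h5, h2] using hu
  rw [show Real.pi * u = 2 * (Real.pi * u / 2) by ring, Real.sin_two_mul]
  linear_combination 2 * this

/-- `k(U) ∂_U log Ω² + k'(U) = h'(r) / 2`. -/
theorem dU_logCf_mul_killing (h : Subextremal M e) (hq : q ∈ penroseDiagram M e) :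
    dU (logCf M e) q * killing M e (q.1 - q.2) + deriv (killing M e) (q.1 - q.2) =
      M / rad M e q ^ 2 - e ^ 2 / rad M e q ^ 3 := by
  -- If the identity failed at `q`, it would fail nearby, and `k(V)`, hence `sin (πV)`, would vanish
  -- on an open set. Differentiating along the `V`-line makes `cos (πV)` vanish as well, which is
  -- impossible.
  by_contra hne
  set g : ℝ × ℝ → ℝ := fun q => dU (logCf M e) q * killing M e (q.1 - q.2) +
    deriv (killing M e) (q.1 - q.2) - (M / rad M e q ^ 2 - e ^ 2 / rad M e q ^ 3) with hg
  have hg0 : g q ≠ 0 := sub_ne_zero.2 hne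
  have h0 := (rad_pos hq).ne'
  have c1 : ContinuousAt (dU (logCf M e)) q := (contDiffAt_logCf h hq).dU.continuousAt
  have c2 : Continuous (killing M e) := (contDiff_killing h).continuous
  have c3 : Continuous (deriv (killing M e)) := (contDiff_killing h).continuous_deriv (by simp)
  have c4 : ContinuousAt (rad M e) q := (contDiffAt_rad h hq).continuousAt
  have hgc : ContinuousAt g q := by
    have k2 : ContinuousAt (fun q : ℝ × ℝ => killing M e (q.1 - q.2)) q := by fun_prop
    have k3 : ContinuousAt (fun q : ℝ × ℝ => deriv (killing M e) (q.1 - q.2)) q := by fun_prop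
    exact ((c1.mul k2).add k3).sub ((continuousAt_const.div (c4.pow 2) (pow_ne_zero 2 h0)).sub
      (continuousAt_const.div (c4.pow 3) (pow_ne_zero 3 h0)))
  have hev : ∀ᶠ x in 𝓝 q, Real.sin (Real.pi * (x.1 + x.2)) = 0 := by
    filter_upwards [hgc.eventually_ne hg0, eventually_mem_penroseDiagram h hq] with x hx hxD
    exact killing_eq_zero h
      ((mul_eq_zero.1 (killing_surface_gravity_aux h hxD)).resolve_right hx)
  have hev' := (tendsto_lineV q).eventually hev
  have hlin : HasDerivAt (fun t : ℝ => Real.pi * ((q.1 + t / 2) + (q.2 + t / 2)))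
      Real.pi 0 := by
    have := ((((hasDerivAt_id (0 : ℝ)).div_const 2).const_add q.1).add
      (((hasDerivAt_id (0 : ℝ)).div_const 2).const_add q.2)).const_mul Real.pi
    convert! this using 1
    ring
  have hz := hlin.sin.unique ((hasDerivAt_const (0 : ℝ) (0 : ℝ)).congr_of_eventuallyEq hev')
  have hs := hev.self_of_nhds
  have hc : Real.cos (Real.pi * (q.1 + q.2)) = 0 := by simpa [Real.pi_pos.ne'] using hz
  have := Real.sin_sq_add_cos_sq (Real.pi * (q.1 + q.2))
  rw [hs, hc] at this
  norm_num at this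

/-- The `U`-derivative of `-Ω² k(U) / 2` is `-Ω² / 2` times the left side of `dU_logCf_mul_killing`,
that is, `-Ω² h'(r) / 4`. -/
theorem dU_dV_rad (h : Subextremal M e) (hq : q ∈ penroseDiagram M e) :
    dU (dV (rad M e)) q =
      -(1 / 2) * cf M e q * (M / rad M e q ^ 2 - e ^ 2 / rad M e q ^ 3) := by
  have h1 := hasDerivAt_dU ((contDiffAt_rad h hq).dV.differentiableAt (by simp))
  have h2 := hasDerivAt_dU ((contDiffAt_cf h hq).differentiableAt (by simp))
  have hev := (tendsto_lineU q).eventually (eventually_mem_penroseDiagram h hq)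
  have hk : HasDerivAt (fun t : ℝ => killing M e (q.1 - q.2 + t))
      (deriv (killing M e) (q.1 - q.2)) 0 := by
    have := (hasDerivAt_killing h (q.1 - q.2 + 0)).comp_const_add (q.1 - q.2) 0
    simpa using this
  have h3 := h1.unique (((h2.const_mul (-(1 / 2))).mul hk).congr_of_eventuallyEq
    (hev.mono fun t ht => by
      simp only [Pi.mul_apply]
      rw [dV_rad h ht]
      ring_nf))
  simp only [zero_div, add_zero, sub_zero] at h3
  rw [h3, dU_cf h hq, ← dU_logCf_mul_killing h hq]
  ring

theorem dV_dU_rad (h : Subextremal M e) (hq : q ∈ penroseDiagram M e) :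
    dV (dU (rad M e)) q =
      -(1 / 2) * cf M e q * (M / rad M e q ^ 2 - e ^ 2 / rad M e q ^ 3) := by
  rw [← dU_comm_dV (contDiffAt_rad h hq), dU_dV_rad h hq]

/-- The identity `k(U) ∂_U log Ω² + k'(U) = h'(r) / 2` is differentiated along `V`, where functions
of `U` are constant; `∂_V r` contributes the common factor `k(U)`. -/
theorem killing_mul_dV_dU_logCf (h : Subextremal M e) (hq : q ∈ penroseDiagram M e) :
    killing M e (q.1 - q.2) * (dV (dU (logCf M e)) q -
      cf M e q * (M / rad M e q ^ 3 - 3 / 2 * e ^ 2 / rad M e q ^ 4)) = 0 := by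
  have h1 := hasDerivAt_dV ((contDiffAt_rad h hq).differentiableAt (by simp))
  have h2 := hasDerivAt_dV ((contDiffAt_logCf h hq).dU.differentiableAt (by simp))
  have hev := (tendsto_lineV q).eventually (eventually_mem_penroseDiagram h hq)
  have h0 : rad M e (q.1 + 0 / 2, q.2 + 0 / 2) ≠ 0 := by simpa using (rad_pos hq).ne'
  have h3 := ((h2.mul_const (killing M e (q.1 - q.2))).add_const
    (deriv (killing M e) (q.1 - q.2))).unique
    ((((hasDerivAt_const (0 : ℝ) M).div (h1.pow 2) (pow_ne_zero 2 h0)).sub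
      ((hasDerivAt_const (0 : ℝ) (e ^ 2)).div (h1.pow 3)
        (pow_ne_zero 3 h0))).congr_of_eventuallyEq
    (hev.mono fun t ht => by
      have := dU_logCf_mul_killing h ht
      simp only [Pi.sub_apply, Pi.div_apply, Pi.pow_apply]
      rw [← this]
      ring_nf))
  simp only [zero_div, add_zero] at h3
  rw [dV_rad h hq] at h3
  have hr := (rad_pos hq).ne'
  rw [mul_sub, mul_comm, h3]
  field_simp
  simp
  ring

/-- If both components of the Killing field vanish, `U` and `V` are integers; `0 < |X| < 1` forces
them to differ by `1`, hence to have opposite parity. Then `sinProd` and `cosProd` both vanish, so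
`r` would equal `r₊` and `r₋` at once. On the axis itself common zeros do occur, at the bifurcation
spheres, which is why `X ≠ 0` is required. -/
theorem killing_ne_zero_of_mem (h : Subextremal M e) (hq : q ∈ penroseDiagram M e)
    (hX : q.2 ≠ 0) : killing M e (q.1 - q.2) ≠ 0 ∨ killing M e (q.1 + q.2) ≠ 0 := by
  by_contra! hk
  obtain ⟨m, hm⟩ := Real.sin_eq_zero_iff.1 (killing_eq_zero h hk.1)
  obtain ⟨n, hn⟩ := Real.sin_eq_zero_iff.1 (killing_eq_zero h hk.2)
  have hpi := Real.pi_pos.ne'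
  have hm' : (m : ℝ) = q.1 - q.2 := by
    apply mul_left_cancel₀ hpi
    linear_combination hm
  have hn' : (n : ℝ) = q.1 + q.2 := by
    apply mul_left_cancel₀ hpi
    linear_combination hn
  have hlt := abs_lt.1 hq.1
  have l1 : n - m < 2 := by
    have : ((n - m : ℤ) : ℝ) < 2 := by push_cast; linarith
    exact_mod_cast this
  have l2 : -2 < n - m := by
    have : (-2 : ℝ) < ((n - m : ℤ) : ℝ) := by push_cast; linarith
    exact_mod_cast this
  have l3 : n - m ≠ 0 := by
    intro h0
    apply hX
    have : ((n - m : ℤ) : ℝ) = 0 := by rw [h0]; simp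
    push_cast at this
    linarith
  obtain ⟨h1, h2, h3, e1, e2, -⟩ := isPenroseData_penroseData hq
  have hodd : Odd (n - m) := by
    have : n - m = 1 ∨ n - m = -1 := by omega
    rcases this with h' | h' <;> rw [h'] <;> decide
  have hs : sinProd q.1 q.2 = 0 ∧ cosProd q.1 q.2 = 0 := by
    unfold sinProd cosProd
    rw [← hm', ← hn']
    have hsin : ∀ j : ℤ, Even j → Real.sin (Real.pi * (j : ℝ) / 2) = 0 := by
      rintro j ⟨i, rfl⟩
      rw [Real.sin_eq_zero_iff]
      exact ⟨i, by push_cast; ring⟩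
    have hcos : ∀ j : ℤ, Odd j → Real.cos (Real.pi * (j : ℝ) / 2) = 0 := by
      rintro j ⟨i, rfl⟩
      rw [Real.cos_eq_zero_iff]
      exact ⟨i, by push_cast; ring⟩
    rcases Int.even_or_odd m with he | ho
    · have ho' : Odd n := by
        have := hodd.add_even he
        simpa using this
      rw [hsin m he, hcos n ho']
      simp
    · have he' : Even n := by
        have := hodd.add_odd ho
        simpa using this
      rw [hsin n he', hcos m ho]
      simp
  rw [hs.1, mul_zero] at e1
  rw [hs.2, mul_zero] at e2
  linarith [h.rMinus_lt_rPlus]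

/-- `∂_U ∂_V log Ω² = -Ω² h''(r) / 4` off the axis `X = 0`. -/
theorem dV_dU_logCf (h : Subextremal M e) (hq : q ∈ penroseDiagram M e) (hX : q.2 ≠ 0) :
    dV (dU (logCf M e)) q =
      cf M e q * (M / rad M e q ^ 3 - 3 / 2 * e ^ 2 / rad M e q ^ 4) := by
  rcases killing_ne_zero_of_mem h hq hX with hk | hk
  · exact sub_eq_zero.1 ((mul_eq_zero.1 (killing_mul_dV_dU_logCf h hq)).resolve_left hk)
  -- When only `k(V)` is known to be nonzero, the reflected point is used: there the roles of `U`
  -- and `V` are exchanged.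
  · have key := killing_mul_dV_dU_logCf h (reflect_mem_penroseDiagram.2 hq)
    have e1 := congrFun (cf_comp_reflect (M := M) (e := e)) q
    have e2 := congrFun (rad_comp_reflect (M := M) (e := e)) q
    simp only [Function.comp] at e1 e2
    have e3 : dV (dU (logCf M e)) (reflect q) = dV (dU (logCf M e)) q := by
      rw [← dU_comm_dV (contDiffAt_logCf h hq), ← dU_comp_reflect]
      congr 1
      rw [show dV (logCf M e) = dU (logCf M e) ∘ reflect from
        funext (dV_eq_of_comp_reflect logCf_comp_reflect)]
    rw [e1, e2, e3] at key
    refine sub_eq_zero.1 ((mul_eq_zero.1 key).resolve_left ?_)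
    simpa using hk

theorem dU_dV_logCf (h : Subextremal M e) (hq : q ∈ penroseDiagram M e) (hX : q.2 ≠ 0) :
    dU (dV (logCf M e)) q =
      cf M e q * (M / rad M e q ^ 3 - 3 / 2 * e ^ 2 / rad M e q ^ 4) := by
  rw [dU_comm_dV (contDiffAt_logCf h hq), dV_dU_logCf h hq hX]

end Curvature

end ReissnerNordstrom

/-! ### Christoffel symbols of diagonal metrics and the geometry of graphs -/

namespace LorentzGeometry

theorem pd_eq {n : ℕ} {f : (Fin n → ℝ) → ℝ} {f' : (Fin n → ℝ) →L[ℝ] ℝ} {x : Fin n → ℝ}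
    (h : HasFDerivAt f f' x) (i : Fin n) : pd i f x = f' (Pi.single i 1) := by
  rw [pd, h.fderiv]

theorem pd_const {n : ℕ} (c : ℝ) (x : Fin n → ℝ) (i : Fin n) : pd i (fun _ => c) x = 0 := by
  simp [pd]

theorem pd_coord {n : ℕ} (j : Fin n) (x : Fin n → ℝ) (i : Fin n) :
    pd i (fun y => y j) x = (Pi.single i 1 : Fin n → ℝ) j := by
  have h : HasFDerivAt (fun y : Fin n → ℝ => y j) (ContinuousLinearMap.proj j) x :=
    (ContinuousLinearMap.proj (R := ℝ) (φ := fun _ : Fin n => ℝ) j).hasFDerivAt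
  rw [pd_eq h]
  simp

theorem pd_comp_coord {n : ℕ} {T : ℝ → ℝ} {T' : ℝ} (j : Fin n) (x : Fin n → ℝ)
    (hT : HasDerivAt T T' (x j)) (i : Fin n) :
    pd i (fun y => T (y j)) x = T' * (Pi.single i 1 : Fin n → ℝ) j := by
  have h : HasFDerivAt (fun y : Fin n → ℝ => y j) (ContinuousLinearMap.proj j) x :=
    (ContinuousLinearMap.proj (R := ℝ) (φ := fun _ : Fin n => ℝ) j).hasFDerivAt
  have h' : HasFDerivAt (fun y : Fin n → ℝ => T (y j)) _ x := hT.comp_hasFDerivAt x h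
  rw [pd_eq h']
  simp

theorem pd_congr {n : ℕ} {f g : (Fin n → ℝ) → ℝ} {x : Fin n → ℝ} (h : f =ᶠ[𝓝 x] g) (i : Fin n) :
    pd i f x = pd i g x := by
  rw [pd, pd, h.fderiv_eq]

/-- Christoffel symbols of a diagonal metric, lowered with the metric. -/
theorem mul_christoffel_diagonal {n : ℕ} (d : (Fin n → ℝ) → Fin n → ℝ) (x : Fin n → ℝ)
    (hd : ∀ i, d x i ≠ 0) (k i j : Fin n) :
    d x k * christoffel (fun y => Matrix.diagonal (d y)) k i j x =
      (1 / 2) * ((if j = k then pd i (fun y => d y j) x else 0) +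
        (if i = k then pd j (fun y => d y i) x else 0) -
        (if i = j then pd k (fun y => d y i) x else 0)) := by
  have hinv : (Matrix.diagonal (d x))⁻¹ = Matrix.diagonal fun i => (d x i)⁻¹ := by
    apply Matrix.inv_eq_right_inv
    rw [Matrix.diagonal_mul_diagonal, ← Matrix.diagonal_one]
    congr 1
    funext i
    exact mul_inv_cancel₀ (hd i)
  have hpd : ∀ a b c : Fin n, pd c (fun y => Matrix.diagonal (d y) a b) x =
      if a = b then pd c (fun y => d y a) x else 0 := by
    intro a b c
    split_ifs with hab
    · subst hab
      simp
    · simp only [Matrix.diagonal_apply_ne _ hab, pd_const]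
  unfold christoffel
  simp only [hinv]
  rw [Finset.sum_eq_single k]
  · simp only [hpd, Matrix.diagonal_apply_eq]
    have := hd k
    field_simp
  · intro l _ hl
    rw [Matrix.diagonal_apply_ne _ hl.symm, zero_mul]
  · simp

end LorentzGeometry

namespace ReissnerNordstrom

section Graph

variable {T : ℝ → ℝ} {X θ φ : ℝ}

theorem _root_.ContDiffAt.deriv_infty (hT : ContDiffAt ℝ ∞ T X) : ContDiffAt ℝ ∞ (deriv T) X :=
  (hT.fderiv_right (m := ∞) (by simp)).clm_apply contDiffAt_const

theorem tangent_graphMap {y : Fin 3 → ℝ} (hT : DifferentiableAt ℝ T (y 0)) (a : Fin 3) :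
    tangent (graphMap T) a y = ![deriv T (y 0) * (Pi.single a 1 : Fin 3 → ℝ) 0,
      (Pi.single a 1 : Fin 3 → ℝ) 0, (Pi.single a 1 : Fin 3 → ℝ) 1,
      (Pi.single a 1 : Fin 3 → ℝ) 2] := by
  funext k
  fin_cases k
  · exact pd_comp_coord 0 y hT.hasDerivAt a
  · exact pd_coord 0 y a
  · exact pd_coord 1 y a
  · exact pd_coord 2 y a

theorem pd_tangent_graphMap (hT : ContDiffAt ℝ ∞ T X) (a b : Fin 3) :
    (fun k => pd a (fun z => tangent (graphMap T) b z k) ![X, θ, φ]) =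
      ![deriv (deriv T) X * (Pi.single a 1 : Fin 3 → ℝ) 0 * (Pi.single b 1 : Fin 3 → ℝ) 0,
        0, 0, 0] := by
  have hd : ∀ᶠ x in 𝓝 X, DifferentiableAt ℝ T x :=
    ((hT.of_le (m := 1) (by exact_mod_cast le_top)).eventually (by simp)).mono
      fun x hx => hx.differentiableAt (by simp)
  have hc : Tendsto (fun z : Fin 3 → ℝ => z 0) (𝓝 ![X, θ, φ]) (𝓝 X) := by
    have := (continuous_apply (0 : Fin 3)).tendsto (![X, θ, φ] : Fin 3 → ℝ)
    simpa using this
  have hev : ∀ᶠ z : Fin 3 → ℝ in 𝓝 ![X, θ, φ], tangent (graphMap T) b z = _ :=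
    (hc.eventually hd).mono fun z hz => tangent_graphMap hz b
  have hdd : HasDerivAt (deriv T) (deriv (deriv T) X) X :=
    (hT.deriv_infty.differentiableAt (by simp)).hasDerivAt
  have hdd' : HasDerivAt (fun x => deriv T x * (Pi.single b 1 : Fin 3 → ℝ) 0)
      (deriv (deriv T) X * (Pi.single b 1 : Fin 3 → ℝ) 0) X := hdd.mul_const _
  funext k
  rw [pd_congr (hev.mono fun z hz => congrFun hz k) a]
  fin_cases k
  · refine (pd_comp_coord 0 ![X, θ, φ] (by simpa using hdd') a).trans ?_
    simp only [Fin.zero_eta, Matrix.cons_val_zero]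
    ring
  · exact pd_const _ _ _
  · exact pd_const _ _ _
  · exact pd_const _ _ _

/-- The diagonal entries of the metric. -/
noncomputable def metricDiag (M e : ℝ) (x : Fin 4 → ℝ) : Fin 4 → ℝ :=
  ![-cf M e (x 0, x 1), cf M e (x 0, x 1), rad M e (x 0, x 1) ^ 2,
    rad M e (x 0, x 1) ^ 2 * Real.sin (x 2) ^ 2]

variable {M e : ℝ}

theorem metric_eq (x : Fin 4 → ℝ) : metric M e x = Matrix.diagonal (metricDiag M e x) := rfl

theorem fderiv_pair (ψ : ℝ × ℝ → ℝ) (q : ℝ × ℝ) (a b : ℝ) :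
    fderiv ℝ ψ q (a, b) = (a - b) * dU ψ q + (a + b) * dV ψ q := by
  unfold dU dV
  rw [← smul_eq_mul, ← smul_eq_mul, ← map_smul, ← map_smul, ← map_add]
  congr 1
  ext <;> simp <;> ring

theorem hasFDerivAt_pair (x : Fin 4 → ℝ) : HasFDerivAt (fun y : Fin 4 → ℝ => (y 0, y 1))
    ((ContinuousLinearMap.proj (R := ℝ) (φ := fun _ : Fin 4 => ℝ) 0).prod
      (ContinuousLinearMap.proj (R := ℝ) (φ := fun _ : Fin 4 => ℝ) 1)) x :=
  (ContinuousLinearMap.proj (R := ℝ) (φ := fun _ : Fin 4 => ℝ) 0).hasFDerivAt.prodMk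
    (ContinuousLinearMap.proj (R := ℝ) (φ := fun _ : Fin 4 => ℝ) 1).hasFDerivAt

theorem pd_comp_pair {ψ : ℝ × ℝ → ℝ} {x : Fin 4 → ℝ} (hψ : DifferentiableAt ℝ ψ (x 0, x 1))
    (i : Fin 4) :
    pd i (fun y => ψ (y 0, y 1)) x =
      ((Pi.single i 1 : Fin 4 → ℝ) 0 - (Pi.single i 1 : Fin 4 → ℝ) 1) * dU ψ (x 0, x 1) +
      ((Pi.single i 1 : Fin 4 → ℝ) 0 + (Pi.single i 1 : Fin 4 → ℝ) 1) * dV ψ (x 0, x 1) := by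
  have h' : HasFDerivAt (fun y : Fin 4 → ℝ => ψ (y 0, y 1)) _ x :=
    HasFDerivAt.comp x hψ.hasFDerivAt (hasFDerivAt_pair x)
  rw [pd_eq h', ContinuousLinearMap.comp_apply, ContinuousLinearMap.prod_apply, fderiv_pair]
  rfl

theorem pd_mul_sin_sq {ψ : ℝ × ℝ → ℝ} {x : Fin 4 → ℝ} (hψ : DifferentiableAt ℝ ψ (x 0, x 1))
    {i : Fin 4} (hi : i = 0 ∨ i = 1) :
    pd i (fun y => ψ (y 0, y 1) * Real.sin (y 2) ^ 2) x =
      pd i (fun y => ψ (y 0, y 1)) x * Real.sin (x 2) ^ 2 := by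
  have h' : HasFDerivAt (fun y : Fin 4 → ℝ => ψ (y 0, y 1)) _ x :=
    HasFDerivAt.comp x hψ.hasFDerivAt (hasFDerivAt_pair x)
  have hp : HasFDerivAt (fun y : Fin 4 → ℝ => y 2) (ContinuousLinearMap.proj 2) x :=
    (ContinuousLinearMap.proj (R := ℝ) (φ := fun _ : Fin 4 => ℝ) 2).hasFDerivAt
  have hs : HasFDerivAt (fun y : Fin 4 → ℝ => Real.sin (y 2) ^ 2) _ x := hp.sin.pow 2
  have hm : HasFDerivAt (fun y : Fin 4 → ℝ => ψ (y 0, y 1) * Real.sin (y 2) ^ 2) _ x := h'.mul hs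
  rw [pd_eq hm, pd_eq h']
  rcases hi with rfl | rfl <;> simp [mul_comm]

/-- The second fundamental form on the diagonal, for a normal vector in the `(T, X)`-plane. -/
theorem secondForm_apply_self {Φ : (Fin 3 → ℝ) → (Fin 4 → ℝ)} {y : Fin 3 → ℝ}
    (hd : ∀ i, metricDiag M e (Φ y) i ≠ 0) (ν : Fin 4 → ℝ) (a : Fin 3) :
    secondForm (metric M e) Φ y ν a a = -∑ k, ν k * (metricDiag M e (Φ y) k *
      pd a (fun z => tangent Φ a z k) y +
      ∑ i, (pd i (fun z => metricDiag M e z k) (Φ y) * tangent Φ a y i * tangent Φ a y k -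
        (1 / 2) * pd k (fun z => metricDiag M e z i) (Φ y) * tangent Φ a y i ^ 2)) := by
  have hg : metric M e = fun x => Matrix.diagonal (metricDiag M e x) := rfl
  have key := mul_christoffel_diagonal (metricDiag M e) (Φ y) hd
  simp only [secondForm, Matrix.of_apply, covDeriv, dotProduct, hg, Matrix.mulVec_diagonal,
    add_mul]
  congr 1
  refine Finset.sum_congr rfl fun k _ => ?_
  have h2 : ∑ i, ∑ j, metricDiag M e (Φ y) k *
      christoffel (fun x => Matrix.diagonal (metricDiag M e x)) k i j (Φ y) *
        tangent Φ a y i * tangent Φ a y j =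
      ∑ i, (pd i (fun z => metricDiag M e z k) (Φ y) * tangent Φ a y i * tangent Φ a y k -
        (1 / 2) * pd k (fun z => metricDiag M e z i) (Φ y) * tangent Φ a y i ^ 2) := by
    simp only [key]
    fin_cases k <;> simp [Fin.sum_univ_four] <;> ring
  rw [← h2]
  simp only [Finset.sum_mul, mul_add, Finset.mul_sum]
  congr 1
  · ring
  · refine Finset.sum_congr rfl fun i _ => Finset.sum_congr rfl fun j _ => ?_
    ring

end Graph

end ReissnerNordstrom

/-! ### The mean curvature of a spherically symmetric graph -/

namespace ReissnerNordstrom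

section MeanCurvature

variable {M e H : ℝ} {T : ℝ → ℝ} {X θ φ : ℝ}

/-- The derivative of `log (Ω r²)` along `(p, 1)`. -/
noncomputable def slopeTerm (M e : ℝ) (q : ℝ × ℝ) (p : ℝ) : ℝ :=
  (1 + p) * (dV (logCf M e) q / 2 + 2 * dV (rad M e) q / rad M e q) +
    (1 - p) * (dU (logCf M e) q / 2 + 2 * dU (rad M e) q / rad M e q)

theorem metricDiag_graphMap : metricDiag M e (graphMap T ![X, θ, φ]) =
    ![-cf M e (T X, X), cf M e (T X, X), rad M e (T X, X) ^ 2,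
      rad M e (T X, X) ^ 2 * Real.sin θ ^ 2] := rfl

theorem metricDiag_ne_zero (h : Subextremal M e) (hD : (T X, X) ∈ penroseDiagram M e)
    (hθ : θ ∈ Ioo 0 Real.pi) (i : Fin 4) : metricDiag M e (graphMap T ![X, θ, φ]) i ≠ 0 := by
  have h1 := (cf_pos h hD).ne'
  have h2 := (rad_pos hD).ne'
  have h3 := (Real.sin_pos_of_mem_Ioo hθ).ne'
  rw [metricDiag_graphMap]
  fin_cases i <;> simp [h1, h2, h3]

theorem tangent_graphMap_of_differentiableAt (hT : DifferentiableAt ℝ T X) (a : Fin 3) :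
    tangent (graphMap T) a ![X, θ, φ] = ![deriv T X * (Pi.single a 1 : Fin 3 → ℝ) 0,
      (Pi.single a 1 : Fin 3 → ℝ) 0, (Pi.single a 1 : Fin 3 → ℝ) 1,
      (Pi.single a 1 : Fin 3 → ℝ) 2] :=
  tangent_graphMap (y := ![X, θ, φ]) hT a

theorem firstForm_graphMap (hT : DifferentiableAt ℝ T X) :
    firstForm (metric M e) (graphMap T) ![X, θ, φ] = Matrix.diagonal
      ![cf M e (T X, X) * (1 - deriv T X ^ 2), rad M e (T X, X) ^ 2,
        rad M e (T X, X) ^ 2 * Real.sin θ ^ 2] := by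
  ext a b
  simp only [firstForm, Matrix.of_apply, metric_eq, metricDiag_graphMap,
    tangent_graphMap_of_differentiableAt hT, dotProduct, Matrix.mulVec_diagonal,
    Fin.sum_univ_four]
  fin_cases a <;> fin_cases b <;> simp
  ring

theorem isSpacelikeAt_iff (h : Subextremal M e) (hT : DifferentiableAt ℝ T X)
    (hD : (T X, X) ∈ penroseDiagram M e) (hθ : θ ∈ Ioo 0 Real.pi) :
    IsSpacelikeAt (metric M e) (graphMap T) ![X, θ, φ] ↔ deriv T X ^ 2 < 1 := by
  have h1 := cf_pos h hD
  have h2 := rad_pos hD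
  have h3 := Real.sin_pos_of_mem_Ioo hθ
  rw [IsSpacelikeAt, firstForm_graphMap hT, Matrix.posDef_diagonal_iff]
  constructor
  · intro hp
    have := hp 0
    simp only [Matrix.cons_val_zero] at this
    have := pos_of_mul_pos_right this h1.le
    linarith
  · intro hp i
    have : 0 < 1 - deriv T X ^ 2 := by linarith
    fin_cases i <;> simp <;> positivity

theorem pd_metricDiag (h : Subextremal M e) {x : Fin 4 → ℝ}
    (hD : (x 0, x 1) ∈ penroseDiagram M e) {i : Fin 4} (hi : i = 0 ∨ i = 1) (k : Fin 4) :
    pd i (fun z => metricDiag M e z k) x =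
      ![-fderiv ℝ (cf M e) (x 0, x 1) ((Pi.single i 1 : Fin 4 → ℝ) 0, (Pi.single i 1 : Fin 4 → ℝ) 1),
        fderiv ℝ (cf M e) (x 0, x 1) ((Pi.single i 1 : Fin 4 → ℝ) 0, (Pi.single i 1 : Fin 4 → ℝ) 1),
        2 * rad M e (x 0, x 1) * fderiv ℝ (rad M e) (x 0, x 1)
          ((Pi.single i 1 : Fin 4 → ℝ) 0, (Pi.single i 1 : Fin 4 → ℝ) 1),
        2 * rad M e (x 0, x 1) * fderiv ℝ (rad M e) (x 0, x 1)
          ((Pi.single i 1 : Fin 4 → ℝ) 0, (Pi.single i 1 : Fin 4 → ℝ) 1) *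
          Real.sin (x 2) ^ 2] k := by
  have hc := (contDiffAt_cf h hD).differentiableAt (by simp)
  have hr := (contDiffAt_rad h hD).differentiableAt (by simp)
  have hr2 : DifferentiableAt ℝ (fun q => rad M e q ^ 2) (x 0, x 1) := hr.pow 2
  have key : pd i (fun z => rad M e (z 0, z 1) ^ 2) x = 2 * rad M e (x 0, x 1) *
      fderiv ℝ (rad M e) (x 0, x 1)
        ((Pi.single i 1 : Fin 4 → ℝ) 0, (Pi.single i 1 : Fin 4 → ℝ) 1) := by
    have h' : HasFDerivAt (fun y : Fin 4 → ℝ => rad M e (y 0, y 1)) _ x :=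
      HasFDerivAt.comp (g := rad M e) x hr.hasFDerivAt (hasFDerivAt_pair x)
    have h'' : HasFDerivAt (fun y : Fin 4 → ℝ => rad M e (y 0, y 1) ^ 2) _ x := h'.pow 2
    rw [pd_eq h'']
    simp
  have hcpd : pd i (fun z => cf M e (z 0, z 1)) x = fderiv ℝ (cf M e) (x 0, x 1)
      ((Pi.single i 1 : Fin 4 → ℝ) 0, (Pi.single i 1 : Fin 4 → ℝ) 1) := by
    rw [pd_comp_pair hc, fderiv_pair]
  fin_cases k
  · simp only [metricDiag]
    refine Eq.trans ?_ (congrArg Neg.neg hcpd)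
    simp [pd, fderiv_fun_neg]
  · exact hcpd
  · exact key
  · exact (pd_mul_sin_sq hr2 hi).trans (by rw [key]; rfl)

/-- The components `k = 2, 3` are not needed, because the normal has no angular components; in
particular the `θ`-derivative of `sin² θ` never enters. -/
theorem pd_metricDiag_angle (h : Subextremal M e) {x : Fin 4 → ℝ}
    (hD : (x 0, x 1) ∈ penroseDiagram M e) {i k : Fin 4} (hi : i = 2 ∨ i = 3)
    (hk : k = 0 ∨ k = 1) :
    pd i (fun z => metricDiag M e z k) x = 0 := by
  have hc := (contDiffAt_cf h hD).differentiableAt (by simp)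
  have hcpd : pd i (fun z => cf M e (z 0, z 1)) x = 0 := by
    rw [pd_comp_pair hc]
    rcases hi with rfl | rfl <;> simp
  rcases hk with rfl | rfl
  · simp only [metricDiag]
    refine Eq.trans ?_ ((congrArg Neg.neg hcpd).trans neg_zero)
    simp [pd, fderiv_fun_neg]
  · exact hcpd

/-- The vector `(n, T' n, 0, 0)` is normal for every `n`, and the trace is linear in it, so the
normalization can be postponed. The term in `T''` and the derivative of `log Ω` come from the radial
direction; each of the two angular directions contributes a derivative of `log r`. -/
theorem trace_secondForm (h : Subextremal M e) (hT : ContDiffAt ℝ ∞ T X)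
    (hD : (T X, X) ∈ penroseDiagram M e) (hθ : θ ∈ Ioo 0 Real.pi) (hp : deriv T X ^ 2 < 1)
    (n : ℝ) :
    ((firstForm (metric M e) (graphMap T) ![X, θ, φ])⁻¹ *
      secondForm (metric M e) (graphMap T) ![X, θ, φ] ![n, deriv T X * n, 0, 0]).trace =
      n * (deriv (deriv T) X / (1 - deriv T X ^ 2) + slopeTerm M e (T X, X) (deriv T X)) := by
  have h1 := (cf_pos h hD).ne'
  have h2 := (rad_pos hD).ne'
  have h3 := (Real.sin_pos_of_mem_Ioo hθ).ne'
  have h4 : 1 - deriv T X ^ 2 ≠ 0 := by linarith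
  have hTd := hT.differentiableAt (by simp)
  have hinv : (firstForm (metric M e) (graphMap T) ![X, θ, φ])⁻¹ = Matrix.diagonal
      ![(cf M e (T X, X) * (1 - deriv T X ^ 2))⁻¹, (rad M e (T X, X) ^ 2)⁻¹,
        (rad M e (T X, X) ^ 2 * Real.sin θ ^ 2)⁻¹] := by
    rw [firstForm_graphMap hTd]
    apply Matrix.inv_eq_right_inv
    rw [Matrix.diagonal_mul_diagonal, ← Matrix.diagonal_one]
    congr 1
    funext i
    fin_cases i <;> simp <;> field_simp
  have hpd : ∀ a k, pd a (fun z => tangent (graphMap T) a z k) ![X, θ, φ] = _ := fun a k =>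
    congrFun (pd_tangent_graphMap (θ := θ) (φ := φ) hT a a) k
  have hD' : (graphMap T ![X, θ, φ] 0, graphMap T ![X, θ, φ] 1) ∈ penroseDiagram M e := hD
  have p0 := pd_metricDiag h hD' (Or.inl rfl)
  have p1 := pd_metricDiag h hD' (Or.inr rfl)
  have p2 := fun k hk => pd_metricDiag_angle h hD' (i := 2) (k := k) (Or.inl rfl) hk
  have p3 := fun k hk => pd_metricDiag_angle h hD' (i := 3) (k := k) (Or.inr rfl) hk
  have p20 := p2 0 (Or.inl rfl)
  have p21 := p2 1 (Or.inr rfl)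
  have p30 := p3 0 (Or.inl rfl)
  have p31 := p3 1 (Or.inr rfl)
  have hg0 : (graphMap T ![X, θ, φ] 0, graphMap T ![X, θ, φ] 1) = (T X, X) := rfl
  have hg2 : graphMap T ![X, θ, φ] 2 = θ := rfl
  simp only [hg0, hg2, fderiv_pair] at p0 p1
  rw [hinv, Matrix.trace]
  simp only [Matrix.diag_apply, Matrix.diagonal_mul,
    secondForm_apply_self (metricDiag_ne_zero h hD hθ), hpd,
    tangent_graphMap_of_differentiableAt hTd, metricDiag_graphMap, Fin.sum_univ_three,
    Fin.sum_univ_four, p0, p1, p20, p21, p30, p31]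
  simp
  rw [dU_cf h hD, dV_cf h hD]
  unfold slopeTerm
  field_simp
  ring

/-- Orthogonality to the three tangent vectors determines the normal up to a scalar, and the unit
and future conditions fix the scalar. This eliminates the existential quantifier in
`HasMeanCurvatureAt`. -/
theorem isFutureUnitNormal_graphMap_iff (h : Subextremal M e) (hT : DifferentiableAt ℝ T X)
    (hD : (T X, X) ∈ penroseDiagram M e) (hθ : θ ∈ Ioo 0 Real.pi) (hp : deriv T X ^ 2 < 1)
    (ν : Fin 4 → ℝ) :
    IsFutureUnitNormal (metric M e) (graphMap T) ![X, θ, φ] ν ↔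
      ν = ![(√(cf M e (T X, X) * (1 - deriv T X ^ 2)))⁻¹,
        deriv T X * (√(cf M e (T X, X) * (1 - deriv T X ^ 2)))⁻¹, 0, 0] := by
  have h1 := cf_pos h hD
  have h2 := rad_pos hD
  have h3 := Real.sin_pos_of_mem_Ioo hθ
  have h4 : 0 < 1 - deriv T X ^ 2 := by linarith
  have hs : 0 < √(cf M e (T X, X) * (1 - deriv T X ^ 2)) := Real.sqrt_pos.2 (mul_pos h1 h4)
  have hs2 := Real.sq_sqrt (mul_pos h1 h4).le
  set s := √(cf M e (T X, X) * (1 - deriv T X ^ 2))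
  simp only [IsFutureUnitNormal, Fin.forall_fin_succ, metric_eq, metricDiag_graphMap, dotProduct,
    Matrix.mulVec_diagonal, tangent_graphMap_of_differentiableAt hT, Fin.sum_univ_four]
  simp
  constructor
  · rintro ⟨⟨e0, e1, e2⟩, e3, e4⟩
    have n1 : ν 1 = deriv T X * ν 0 := by
      apply mul_left_cancel₀ h1.ne'
      linear_combination e0
    have n2 : ν 2 = 0 := by simpa [h2.ne'] using e1
    have n3 : ν 3 = 0 := by simpa [h2.ne', h3.ne'] using e2
    have n0 : 0 < ν 0 := by
      by_contra hle
      nlinarith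
    rw [n1, n2, n3] at e3
    have hν : ν 0 = s⁻¹ := by
      apply eq_inv_of_mul_eq_one_left
      have : (ν 0 * s) ^ 2 = 1 := by
        rw [mul_pow, hs2]
        linear_combination -e3
      nlinarith [mul_pos n0 hs]
    funext k
    fin_cases k
    · exact hν
    · simpa [hν] using n1
    · exact n2
    · exact n3
  · rintro rfl
    simp
    refine ⟨by ring, ?_, by positivity⟩
    have : s⁻¹ ^ 2 * s ^ 2 = 1 := by
      rw [← mul_pow, inv_mul_cancel₀ hs.ne', one_pow]
    rw [hs2] at this
    linear_combination -this

/-- The constant mean curvature equation for a spacelike graph. -/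
theorem hasMeanCurvatureAt_iff (h : Subextremal M e) (hT : ContDiffAt ℝ ∞ T X)
    (hD : (T X, X) ∈ penroseDiagram M e) (hθ : θ ∈ Ioo 0 Real.pi) (hp : deriv T X ^ 2 < 1) :
    HasMeanCurvatureAt (metric M e) (graphMap T) ![X, θ, φ] H ↔
      deriv (deriv T) X = (1 - deriv T X ^ 2) *
        (3 * H * √(cf M e (T X, X) * (1 - deriv T X ^ 2)) -
          slopeTerm M e (T X, X) (deriv T X)) := by
  have h1 := cf_pos h hD
  have h4 : 0 < 1 - deriv T X ^ 2 := by linarith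
  have hs : 0 < √(cf M e (T X, X) * (1 - deriv T X ^ 2)) := Real.sqrt_pos.2 (mul_pos h1 h4)
  simp only [HasMeanCurvatureAt,
    isFutureUnitNormal_graphMap_iff h (hT.differentiableAt (by simp)) hD hθ hp,
    exists_eq_left, trace_secondForm h hT hD hθ hp]
  set s := √(cf M e (T X, X) * (1 - deriv T X ^ 2))
  have hs0 := hs.ne'
  have h40 := h4.ne'
  constructor
  · intro heq
    rw [← heq]
    field_simp
    ring
  · intro heq
    rw [heq]
    field_simp
    ring

end MeanCurvature

end ReissnerNordstrom

/-! ### The first order system for the height and the rapidity -/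

namespace ReissnerNordstrom

theorem hasDerivAt_tanh (x : ℝ) : HasDerivAt Real.tanh (1 - Real.tanh x ^ 2) x := by
  have h := (Real.hasDerivAt_sinh x).div (Real.hasDerivAt_cosh x) (Real.cosh_pos x).ne'
  have hf : Real.tanh = Real.sinh / Real.cosh := funext Real.tanh_eq_sinh_div_cosh
  rw [hf]
  convert! h using 1
  have := (Real.cosh_pos x).ne'
  simp only [Pi.div_apply]
  field_simp

theorem contDiff_tanh : ContDiff ℝ ∞ Real.tanh := by
  rw [show Real.tanh = fun x => Real.sinh x / Real.cosh x from
    funext Real.tanh_eq_sinh_div_cosh]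
  exact Real.contDiff_sinh.div Real.contDiff_cosh fun x => (Real.cosh_pos x).ne'

theorem one_sub_tanh_sq (x : ℝ) : 1 - Real.tanh x ^ 2 = (Real.cosh x ^ 2)⁻¹ := by
  have := (Real.cosh_pos x).ne'
  rw [Real.tanh_eq_sinh_div_cosh]
  field_simp
  linear_combination Real.cosh_sq x

theorem hasDerivAt_artanh {x : ℝ} (hx : x ^ 2 < 1) :
    HasDerivAt Real.artanh (1 - x ^ 2)⁻¹ x := by
  obtain ⟨h1, h2⟩ := abs_lt.1 ((sq_lt_one_iff_abs_lt_one x).1 hx)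
  have ha : 0 < 1 + x := by linarith
  have hb : 0 < 1 - x := by linarith
  have hd : HasDerivAt (fun y : ℝ => 1 / 2 * Real.log ((1 + y) / (1 - y))) _ x :=
    ((((hasDerivAt_id x).const_add 1).div ((hasDerivAt_id x).const_sub 1) hb.ne').log
      (div_pos ha hb).ne').const_mul (1 / 2)
  have hev : Real.artanh =ᶠ[𝓝 x] fun y => 1 / 2 * Real.log ((1 + y) / (1 - y)) := by
    filter_upwards [Ioo_mem_nhds h1 h2] with y hy
    exact Real.artanh_eq_half_log ⟨hy.1.le, hy.2.le⟩
  convert! hd.congr_of_eventuallyEq hev using 1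
  have h3 : 1 - x ^ 2 ≠ 0 := by linarith
  simp only [id, Pi.div_apply]
  field_simp
  ring

section Equation

variable {M e H : ℝ}

/-- The factor `Ω`. -/
noncomputable def omega (M e : ℝ) (q : ℝ × ℝ) : ℝ := Real.exp (logCf M e q / 2)

theorem omega_pos (M e : ℝ) (q : ℝ × ℝ) : 0 < omega M e q := Real.exp_pos _

theorem omega_sq (h : Subextremal M e) {q : ℝ × ℝ} (hq : q ∈ penroseDiagram M e) :
    omega M e q ^ 2 = cf M e q := by
  rw [omega, sq, ← Real.exp_add, add_halves, logCf, Real.exp_log (cf_pos h hq)]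

/-- The right hand side of the constant mean curvature equation `ψ' = rhs` for the rapidity
`ψ = artanh T'`. -/
noncomputable def rhs (M e H : ℝ) (q : ℝ × ℝ) (ψ : ℝ) : ℝ :=
  3 * H * omega M e q / Real.cosh ψ - slopeTerm M e q (Real.tanh ψ)

/-- `(T, ψ)` solves the constant mean curvature equation at `X`. -/
def IsSolAt (M e H : ℝ) (T ψ : ℝ → ℝ) (X : ℝ) : Prop :=
  (T X, X) ∈ penroseDiagram M e ∧ HasDerivAt T (Real.tanh (ψ X)) X ∧
    HasDerivAt ψ (rhs M e H (T X, X) (ψ X)) X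

/-- The coefficient of `∂_V` in the slope term. -/
noncomputable def slopeV (M e : ℝ) (q : ℝ × ℝ) : ℝ :=
  dV (logCf M e) q / 2 + 2 * dV (rad M e) q / rad M e q

/-- The coefficient of `∂_U` in the slope term. -/
noncomputable def slopeU (M e : ℝ) (q : ℝ × ℝ) : ℝ :=
  dU (logCf M e) q / 2 + 2 * dU (rad M e) q / rad M e q

theorem slopeTerm_eq (q : ℝ × ℝ) (p : ℝ) :
    slopeTerm M e q p = (1 + p) * slopeV M e q + (1 - p) * slopeU M e q := rfl

theorem contDiffAt_omega (h : Subextremal M e) {q : ℝ × ℝ} (hq : q ∈ penroseDiagram M e) :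
    ContDiffAt ℝ ∞ (omega M e) q :=
  ((contDiffAt_logCf h hq).div_const 2).exp

theorem contDiffAt_slopeV (h : Subextremal M e) {q : ℝ × ℝ} (hq : q ∈ penroseDiagram M e) :
    ContDiffAt ℝ ∞ (slopeV M e) q :=
  ((contDiffAt_logCf h hq).dV.div_const 2).add
    ((contDiffAt_const.mul (contDiffAt_rad h hq).dV).div (contDiffAt_rad h hq) (rad_pos hq).ne')

theorem contDiffAt_slopeU (h : Subextremal M e) {q : ℝ × ℝ} (hq : q ∈ penroseDiagram M e) :
    ContDiffAt ℝ ∞ (slopeU M e) q :=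
  ((contDiffAt_logCf h hq).dU.div_const 2).add
    ((contDiffAt_const.mul (contDiffAt_rad h hq).dU).div (contDiffAt_rad h hq) (rad_pos hq).ne')

theorem contDiffAt_rhs (h : Subextremal M e) {y : (ℝ × ℝ) × ℝ} (hy : y.1 ∈ penroseDiagram M e) :
    ContDiffAt ℝ ∞ (fun y : (ℝ × ℝ) × ℝ => rhs M e H y.1 y.2) y := by
  have h1 : ContDiffAt ℝ ∞ (fun y : (ℝ × ℝ) × ℝ => omega M e y.1) y :=
    ContDiffAt.comp (g := omega M e) y (contDiffAt_omega h hy) contDiffAt_fst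
  have h2 : ContDiffAt ℝ ∞ (fun y : (ℝ × ℝ) × ℝ => slopeV M e y.1) y :=
    ContDiffAt.comp y (contDiffAt_slopeV h hy) contDiffAt_fst
  have h3 : ContDiffAt ℝ ∞ (fun y : (ℝ × ℝ) × ℝ => slopeU M e y.1) y :=
    ContDiffAt.comp y (contDiffAt_slopeU h hy) contDiffAt_fst
  have h4 : ContDiffAt ℝ ∞ (fun y : (ℝ × ℝ) × ℝ => Real.tanh y.2) y :=
    contDiff_tanh.contDiffAt.comp y contDiffAt_snd
  have h5 : ContDiffAt ℝ ∞ (fun y : (ℝ × ℝ) × ℝ => Real.cosh y.2) y :=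
    Real.contDiff_cosh.contDiffAt.comp y contDiffAt_snd
  exact ((contDiffAt_const.mul h1).div h5 (Real.cosh_pos _).ne').sub
    (((contDiffAt_const.add h4).mul h2).add ((contDiffAt_const.sub h4).mul h3))

theorem sqrt_cf_mul (h : Subextremal M e) {q : ℝ × ℝ} (hq : q ∈ penroseDiagram M e) (ψ : ℝ) :
    √(cf M e q * (1 - Real.tanh ψ ^ 2)) = omega M e q / Real.cosh ψ := by
  have h1 := omega_pos M e q
  have h2 := Real.cosh_pos ψ
  rw [← omega_sq h hq, one_sub_tanh_sq, ← inv_pow, ← mul_pow,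
    Real.sqrt_sq (by positivity), div_eq_mul_inv]

/-- A graph of constant mean curvature solves the first order system. -/
theorem IsSSCMC.isSolAt (h : Subextremal M e) {I : Set ℝ} {T : ℝ → ℝ} (hT : IsSSCMC M e H I T)
    {X : ℝ} (hX : X ∈ I) : IsSolAt M e H T (fun x => Real.artanh (deriv T x)) X := by
  obtain ⟨hI, -, -, hsm, hD, hH⟩ := hT
  have hc : ContDiffAt ℝ ∞ T X := (hsm X hX).contDiffAt (hI.mem_nhds hX)
  -- By spherical symmetry one point of the sphere carries the whole equation; the equator is used.
  have hθ : (Real.pi / 2) ∈ Ioo 0 Real.pi := ⟨by positivity, by linarith [Real.pi_pos]⟩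
  obtain ⟨h1, h2⟩ := hH X hX (Real.pi / 2) hθ 0
  have hTd := hc.differentiableAt (by simp)
  rw [isSpacelikeAt_iff h hTd (hD X hX) hθ] at h1
  rw [hasMeanCurvatureAt_iff h hc (hD X hX) hθ h1] at h2
  have hp : deriv T X ∈ Ioo (-1) 1 := abs_lt.1 ((sq_lt_one_iff_abs_lt_one _).1 h1)
  have htanh : Real.tanh (Real.artanh (deriv T X)) = deriv T X := Real.tanh_artanh hp
  refine ⟨hD X hX, ?_, ?_⟩
  · rw [htanh]
    exact hTd.hasDerivAt
  · have hd := (hasDerivAt_artanh h1).comp X (hc.deriv_infty.differentiableAt (by simp)).hasDerivAt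
    convert! hd using 1
    have h3 : 1 - deriv T X ^ 2 ≠ 0 := by linarith
    have h4 := sqrt_cf_mul h (hD X hX) (Real.artanh (deriv T X))
    rw [htanh] at h4
    rw [h2, h4, rhs, htanh]
    field_simp

/-- Bootstrap: if `(T, ψ)` is `Cⁿ`, the right hand side of the system is `Cⁿ`, so the solution is
`Cⁿ⁺¹`. -/
theorem contDiffOn_of_isSolAt (h : Subextremal M e) {I : Set ℝ} (hI : IsOpen I) {T ψ : ℝ → ℝ}
    (hs : ∀ X ∈ I, IsSolAt M e H T ψ X) : ContDiffOn ℝ ∞ (fun X => (T X, ψ X)) I := by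
  rw [contDiffOn_infty]
  intro n
  induction n with
  | zero =>
    simp only [Nat.cast_zero, contDiffOn_zero]
    exact fun X hX =>
      ((hs X hX).2.1.continuousAt.prodMk (hs X hX).2.2.continuousAt).continuousWithinAt
  | succ n ih =>
    rw [Nat.cast_add, Nat.cast_one, contDiffOn_succ_iff_deriv_of_isOpen hI]
    refine ⟨fun X hX => ((hs X hX).2.1.prodMk
      (hs X hX).2.2).differentiableAt.differentiableWithinAt, by simp, ?_⟩
    have heq : EqOn (deriv fun X => (T X, ψ X))
        (fun X => (Real.tanh (ψ X), rhs M e H (T X, X) (ψ X))) I :=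
      fun X hX => ((hs X hX).2.1.prodMk (hs X hX).2.2).deriv
    refine ContDiffOn.congr ?_ heq
    intro X hX
    have hT : ContDiffWithinAt ℝ n T I X := (ih X hX).fst
    have hψ : ContDiffWithinAt ℝ n ψ I X := (ih X hX).snd
    have hle : (n : WithTop ℕ∞) ≤ ∞ := by exact_mod_cast le_top
    refine ContDiffWithinAt.prodMk ?_ ?_
    · exact ((contDiff_tanh.contDiffAt (x := ψ X)).of_le hle).comp_contDiffWithinAt X hψ
    · have hR := (contDiffAt_rhs (H := H) h (y := ((T X, X), ψ X)) (hs X hX).1).of_le hle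
      exact hR.comp_contDiffWithinAt X ((hT.prodMk contDiffWithinAt_id).prodMk hψ)

/-- Solutions of the first order system are graphs of constant mean curvature. -/
theorem isSSCMC_of_isSolAt (h : Subextremal M e) {I : Set ℝ} (hI : IsOpen I)
    (hconn : I.OrdConnected) (hne : I.Nonempty) {T ψ : ℝ → ℝ}
    (hs : ∀ X ∈ I, IsSolAt M e H T ψ X) : IsSSCMC M e H I T := by
  have hsm := contDiffOn_of_isSolAt h hI hs
  have hTsm : ContDiffOn ℝ ∞ T I := hsm.fst
  refine ⟨hI, hconn, hne, hTsm, fun X hX => (hs X hX).1, fun X hX θ hθ φ => ?_⟩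
  obtain ⟨hD, h1, h2⟩ := hs X hX
  have hc : ContDiffAt ℝ ∞ T X := (hTsm X hX).contDiffAt (hI.mem_nhds hX)
  have hp : deriv T X ^ 2 < 1 := by
    rw [h1.deriv]
    exact Real.tanh_sq_lt_one _
  rw [isSpacelikeAt_iff h h1.differentiableAt hD hθ, hasMeanCurvatureAt_iff h hc hD hθ hp]
  refine ⟨hp, ?_⟩
  have hev : deriv T =ᶠ[𝓝 X] fun x => Real.tanh (ψ x) := by
    filter_upwards [hI.mem_nhds hX] with x hx using (hs x hx).2.1.deriv
  have hdd : deriv (deriv T) X = (1 - Real.tanh (ψ X) ^ 2) * rhs M e H (T X, X) (ψ X) := by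
    rw [hev.deriv_eq]
    exact ((hasDerivAt_tanh (ψ X)).comp X h2).deriv
  rw [hdd, h1.deriv, sqrt_cf_mul h hD, rhs]
  ring

end Equation

/-! ### The Jacobi operator of the mean curvature equation -/

section Jacobi

variable {M e H : ℝ}

/-- `Ω` times the normal derivative of `log r`. -/
noncomputable def expansion (M e : ℝ) (q : ℝ × ℝ) (ψ : ℝ) : ℝ :=
  ((Real.cosh ψ + Real.sinh ψ) * dV (rad M e) q +
    (Real.cosh ψ - Real.sinh ψ) * dU (rad M e) q) / rad M e q

/-- The coefficient relating variations `(δT, δψ)` to the derivative of the Jacobi field. -/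
noncomputable def jacobiCoeff (M e H : ℝ) (q : ℝ × ℝ) (ψ : ℝ) : ℝ :=
  (dV (logCf M e) q - dU (logCf M e) q) / 2 +
    Real.sinh ψ * (3 * H * omega M e q - 2 * expansion M e q ψ)

/-- The potential `Ω² (|K|² + Ric(ν, ν))` of the Jacobi operator. -/
noncomputable def jacobiPotential (M e H : ℝ) (q : ℝ × ℝ) (ψ : ℝ) : ℝ :=
  (3 * H * omega M e q - 2 * expansion M e q ψ) ^ 2 + 2 * expansion M e q ψ ^ 2 +
    cf M e q * e ^ 2 / rad M e q ^ 4

/-- The partial derivative of `rhs` in `T`. -/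
noncomputable def rhsDT (M e H : ℝ) (q : ℝ × ℝ) (ψ : ℝ) : ℝ :=
  3 * H * (omega M e q * (dU (logCf M e) q + dV (logCf M e) q) / 2) / Real.cosh ψ -
    ((1 + Real.tanh ψ) * (dU (slopeV M e) q + dV (slopeV M e) q) +
      (1 - Real.tanh ψ) * (dU (slopeU M e) q + dV (slopeU M e) q))

/-- The partial derivative of `rhs` in `ψ`. -/
noncomputable def rhsDψ (M e H : ℝ) (q : ℝ × ℝ) (ψ : ℝ) : ℝ :=
  -(3 * H * omega M e q * Real.sinh ψ) / Real.cosh ψ ^ 2 -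
    (1 - Real.tanh ψ ^ 2) * (slopeV M e q - slopeU M e q)

/-- The first two terms are squares (the principal curvatures, scaled by `Ω`), and the last is `Ω²`
times `Ric(ν, ν) = e² / r⁴`. This sign is the geometric source of uniqueness. -/
theorem jacobiPotential_nonneg (h : Subextremal M e) {q : ℝ × ℝ} (hq : q ∈ penroseDiagram M e)
    (ψ : ℝ) : 0 ≤ jacobiPotential M e H q ψ := by
  have := cf_pos h hq
  have := rad_pos hq
  unfold jacobiPotential
  positivity

/-- Chain rule along a vertical line. -/
theorem hasDerivAt_vertical {φ : ℝ × ℝ → ℝ} {q : ℝ × ℝ} (hφ : DifferentiableAt ℝ φ q) :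
    HasDerivAt (fun t => φ (t, q.2)) (dU φ q + dV φ q) q.1 := by
  have h := HasFDerivAt.comp_hasDerivAt (f := fun t => (t, q.2)) (l := φ) q.1 hφ.hasFDerivAt
    ((hasDerivAt_id q.1).prodMk (hasDerivAt_const q.1 q.2))
  have := fderiv_pair φ q 1 0
  simp only [sub_zero, one_mul, add_zero] at this
  rw [← this]
  exact h

theorem dU_add_dV_omega (h : Subextremal M e) {q : ℝ × ℝ} (hq : q ∈ penroseDiagram M e) :
    dU (omega M e) q + dV (omega M e) q =
      omega M e q * (dU (logCf M e) q + dV (logCf M e) q) / 2 := by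
  have h1 := hasDerivAt_vertical ((contDiffAt_omega h hq).differentiableAt (by simp))
  have h2 := hasDerivAt_vertical ((contDiffAt_logCf h hq).differentiableAt (by simp))
  rw [h1.unique (h2.div_const 2).exp, omega]
  ring

theorem hasDerivAt_rhs_T (h : Subextremal M e) {q : ℝ × ℝ} (hq : q ∈ penroseDiagram M e) (ψ : ℝ) :
    HasDerivAt (fun t => rhs M e H (t, q.2) ψ) (rhsDT M e H q ψ) q.1 := by
  have h1 := hasDerivAt_vertical ((contDiffAt_omega h hq).differentiableAt (by simp))
  have h2 := hasDerivAt_vertical ((contDiffAt_slopeV h hq).differentiableAt (by simp))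
  have h3 := hasDerivAt_vertical ((contDiffAt_slopeU h hq).differentiableAt (by simp))
  rw [dU_add_dV_omega h hq] at h1
  exact ((h1.const_mul (3 * H)).div_const (Real.cosh ψ)).sub
    ((h2.const_mul (1 + Real.tanh ψ)).add (h3.const_mul (1 - Real.tanh ψ)))

theorem hasDerivAt_rhs_ψ (q : ℝ × ℝ) (ψ : ℝ) :
    HasDerivAt (fun t => rhs M e H q t) (rhsDψ M e H q ψ) ψ := by
  have h1 := (hasDerivAt_const ψ (3 * H * omega M e q)).div (Real.hasDerivAt_cosh ψ)
    (Real.cosh_pos ψ).ne'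
  have h2 := (((hasDerivAt_tanh ψ).const_add 1).mul_const (slopeV M e q)).add
    (((hasDerivAt_tanh ψ).const_sub 1).mul_const (slopeU M e q))
  have h3 : HasDerivAt (fun t => rhs M e H q t) _ ψ := h1.sub h2
  convert! h3 using 1
  unfold rhsDψ
  ring

/-- First structure identity of the linearized equation. -/
theorem two_mul_dlog_rad_add_rhsDψ (q : ℝ × ℝ) (ψ : ℝ) (hr : rad M e q ≠ 0) :
    2 * ((Real.tanh ψ + 1) * dV (rad M e) q + (Real.tanh ψ - 1) * dU (rad M e) q) / rad M e q +
      rhsDψ M e H q ψ + jacobiCoeff M e H q ψ * (1 - Real.tanh ψ ^ 2) = 0 := by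
  have hC := (Real.cosh_pos ψ).ne'
  have hCS := Real.cosh_sq ψ
  unfold rhsDψ jacobiCoeff expansion slopeV slopeU
  rw [one_sub_tanh_sq, Real.tanh_eq_sinh_div_cosh]
  field_simp
  generalize Real.cosh ψ = C at *
  generalize Real.sinh ψ = S at *
  linear_combination (4 * (dV (rad M e) q - dU (rad M e) q)) * hCS

theorem dT_slopeV (h : Subextremal M e) {q : ℝ × ℝ} (hq : q ∈ penroseDiagram M e) :
    dU (slopeV M e) q + dV (slopeV M e) q =
      (dU (dV (logCf M e)) q + dV (dV (logCf M e)) q) / 2 +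
      2 * (dU (dV (rad M e)) q + dV (dV (rad M e)) q) / rad M e q -
      2 * dV (rad M e) q * (dU (rad M e) q + dV (rad M e) q) / rad M e q ^ 2 := by
  have h0 := (rad_pos hq).ne'
  have h1 := hasDerivAt_vertical ((contDiffAt_slopeV h hq).differentiableAt (by simp))
  have h2 := hasDerivAt_vertical ((contDiffAt_logCf h hq).dV.differentiableAt (by simp))
  have h3 := hasDerivAt_vertical ((contDiffAt_rad h hq).dV.differentiableAt (by simp))
  have h4 := hasDerivAt_vertical ((contDiffAt_rad h hq).differentiableAt (by simp))
  rw [h1.unique ((h2.div_const 2).add ((h3.const_mul 2).div h4 h0))]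
  field_simp
  ring

theorem dT_slopeU (h : Subextremal M e) {q : ℝ × ℝ} (hq : q ∈ penroseDiagram M e) :
    dU (slopeU M e) q + dV (slopeU M e) q =
      (dU (dU (logCf M e)) q + dV (dU (logCf M e)) q) / 2 +
      2 * (dU (dU (rad M e)) q + dV (dU (rad M e)) q) / rad M e q -
      2 * dU (rad M e) q * (dU (rad M e) q + dV (rad M e) q) / rad M e q ^ 2 := by
  have h0 := (rad_pos hq).ne'
  have h1 := hasDerivAt_vertical ((contDiffAt_slopeU h hq).differentiableAt (by simp))
  have h2 := hasDerivAt_vertical ((contDiffAt_logCf h hq).dU.differentiableAt (by simp))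
  have h3 := hasDerivAt_vertical ((contDiffAt_rad h hq).dU.differentiableAt (by simp))
  have h4 := hasDerivAt_vertical ((contDiffAt_rad h hq).differentiableAt (by simp))
  rw [h1.unique ((h2.div_const 2).add ((h3.const_mul 2).div h4 h0))]
  field_simp
  ring

/-- Second structure identity of the linearized equation: the Jacobi operator has the potential
`jacobiPotential`. -/
theorem hasDerivAt_jacobiCoeff (h : Subextremal M e) {T ψ : ℝ → ℝ} {X : ℝ}
    (hs : IsSolAt M e H T ψ X) (hX : X ≠ 0) :
    HasDerivAt (fun x => jacobiCoeff M e H (T x, x) (ψ x))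
      (jacobiPotential M e H (T X, X) (ψ X) - rhsDT M e H (T X, X) (ψ X) -
        2 * ((Real.tanh (ψ X) + 1) * dV (rad M e) (T X, X) +
          (Real.tanh (ψ X) - 1) * dU (rad M e) (T X, X)) / rad M e (T X, X) *
          jacobiCoeff M e H (T X, X) (ψ X)) X := by
  obtain ⟨hD, hT, hψ⟩ := hs
  have h0 := (rad_pos hD).ne'
  have chain : ∀ {f : ℝ × ℝ → ℝ}, ContDiffAt ℝ ∞ f (T X, X) → HasDerivAt (fun x => f (T x, x))
      ((Real.tanh (ψ X) + 1) * dV f (T X, X) + (Real.tanh (ψ X) - 1) * dU f (T X, X)) X :=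
    fun hf => hasDerivAt_comp_graph hT (hf.differentiableAt (by simp))
  have k1 := chain (contDiffAt_logCf h hD)
  have k2 := chain (contDiffAt_logCf h hD).dU
  have k3 := chain (contDiffAt_logCf h hD).dV
  have k4 := chain (contDiffAt_rad h hD)
  have k5 := chain (contDiffAt_rad h hD).dU
  have k6 := chain (contDiffAt_rad h hD).dV
  have kO := (k1.div_const 2).exp
  have kC := hψ.cosh
  have kS := hψ.sinh
  have kE := (((kC.add kS).mul k6).add ((kC.sub kS).mul k5)).div k4 h0
  have kJ : HasDerivAt (fun x => jacobiCoeff M e H (T x, x) (ψ x)) _ X :=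
    ((k3.sub k2).div_const 2).add (kS.mul ((kO.const_mul (3 * H)).sub (kE.const_mul 2)))
  convert! kJ using 1
  have hfold : Real.exp (logCf M e (T X, X) / 2) = omega M e (T X, X) := rfl
  simp only [Pi.add_apply, Pi.sub_apply, Pi.mul_apply, hfold]
  unfold jacobiPotential rhsDT
  -- The background identities replace all second derivatives except `∂_U² log Ω²` and `∂_V² log
  -- Ω²`; these two cancel between the sides.
  rw [dT_slopeV h hD, dT_slopeU h hD, dU_dU_rad h hD, dV_dV_rad h hD, dU_dV_rad h hD,
    dV_dU_rad h hD, dU_dV_logCf h hD hX, dV_dU_logCf h hD hX, ← omega_sq h hD]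
  unfold jacobiCoeff expansion rhs slopeTerm
  rw [Real.tanh_eq_sinh_div_cosh]
  -- In the variable `E = exp ψ` the hyperbolic functions become rational, and the claim is an
  -- identity of rational functions.
  have hE : 0 < Real.exp (ψ X) := Real.exp_pos _
  have hCE : Real.cosh (ψ X) = (Real.exp (ψ X) ^ 2 + 1) / (2 * Real.exp (ψ X)) := by
    rw [Real.cosh_eq, Real.exp_neg]
    field_simp
  have hSE : Real.sinh (ψ X) = (Real.exp (ψ X) ^ 2 - 1) / (2 * Real.exp (ψ X)) := by
    rw [Real.sinh_eq, Real.exp_neg]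
    field_simp
  rw [hCE, hSE]
  generalize Real.exp (ψ X) = E at *
  have hE2 : E ^ 2 + 1 ≠ 0 := by positivity
  have hE0 := hE.ne'
  generalize omega M e (T X, X) = Om at *
  generalize dV (rad M e) (T X, X) = rV at *
  generalize dU (rad M e) (T X, X) = rU at *
  generalize dV (logCf M e) (T X, X) = wV at *
  generalize dU (logCf M e) (T X, X) = wU at *
  generalize dV (dV (logCf M e)) (T X, X) = wVV at *
  generalize dU (dU (logCf M e)) (T X, X) = wUU at *
  generalize rad M e (T X, X) = r at *
  clear kJ kE kC kS kO k1 k2 k3 k4 k5 k6 chain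
  field_simp
  ring

end Jacobi

end ReissnerNordstrom

/-! ### Differences of two solutions, the cone lemma and global flows -/

namespace ReissnerNordstrom

section Linearized

variable {M e H : ℝ} {T ψ T₁ ψ₁ : ℝ → ℝ} {X f₁ : ℝ}

/-- The Jacobi field of the difference of two curves. -/
noncomputable def jacobiField (M e : ℝ) (T ψ T₁ : ℝ → ℝ) (x : ℝ) : ℝ :=
  omega M e (T x, x) * Real.cosh (ψ x) * (T₁ x - T x)

/-- The normalized derivative of the Jacobi field of the difference of two curves. -/
noncomputable def jacobiMomentum (M e H : ℝ) (T ψ T₁ ψ₁ : ℝ → ℝ) (x : ℝ) : ℝ :=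
  rad M e (T x, x) ^ 2 *
    ((ψ₁ x - ψ x) + jacobiCoeff M e H (T x, x) (ψ x) * (T₁ x - T x))

/-- The factor `Ω cosh ψ` and the coefficient in the momentum are chosen so that no multiple of `T₁
- T` remains outside the momentum. The last summand is the exact second order remainder of `tanh`,
so nothing has been linearized away. -/
theorem hasDerivAt_jacobiField (h : Subextremal M e) (hs : IsSolAt M e H T ψ X)
    (hT₁ : HasDerivAt T₁ (Real.tanh (ψ₁ X)) X) :
    HasDerivAt (jacobiField M e T ψ T₁)
      (omega M e (T X, X) / (Real.cosh (ψ X) * rad M e (T X, X) ^ 2) *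
        jacobiMomentum M e H T ψ T₁ ψ₁ X +
        omega M e (T X, X) * Real.cosh (ψ X) * (Real.tanh (ψ₁ X) - Real.tanh (ψ X) -
          (1 - Real.tanh (ψ X) ^ 2) * (ψ₁ X - ψ X))) X := by
  obtain ⟨hD, hT, hψ⟩ := hs
  have hr := (rad_pos hD).ne'
  have k1 := hasDerivAt_comp_graph hT ((contDiffAt_logCf h hD).differentiableAt (by simp))
  have k2 : HasDerivAt (jacobiField M e T ψ T₁) _ X :=
    ((k1.div_const 2).exp.mul hψ.cosh).mul (hT₁.sub hT)
  convert! k2 using 1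
  have hfold : Real.exp (logCf M e (T X, X) / 2) = omega M e (T X, X) := rfl
  simp only [Pi.mul_apply, hfold]
  have hE : 0 < Real.exp (ψ X) := Real.exp_pos _
  have hCE : Real.cosh (ψ X) = (Real.exp (ψ X) ^ 2 + 1) / (2 * Real.exp (ψ X)) := by
    rw [Real.cosh_eq, Real.exp_neg]
    field_simp
  have hSE : Real.sinh (ψ X) = (Real.exp (ψ X) ^ 2 - 1) / (2 * Real.exp (ψ X)) := by
    rw [Real.sinh_eq, Real.exp_neg]
    field_simp
  unfold jacobiMomentum jacobiCoeff expansion rhs slopeTerm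
  rw [Real.tanh_eq_sinh_div_cosh (ψ X), hCE, hSE]
  generalize Real.exp (ψ X) = E at *
  have hE2 : E ^ 2 + 1 ≠ 0 := by positivity
  have hE0 := hE.ne'
  clear k1 k2
  field_simp
  ring

/-- The first structure identity makes the coefficient of `ψ₁ - ψ` cancel, and the second leaves the
Jacobi potential as the coefficient of the field. The slope `f₁` is arbitrary, so that the
comparison curve may solve the cut off equation; the remainders are again exact. -/
theorem hasDerivAt_jacobiMomentum (h : Subextremal M e) (hs : IsSolAt M e H T ψ X) (hX : X ≠ 0)
    (hT₁ : HasDerivAt T₁ (Real.tanh (ψ₁ X)) X) (hψ₁ : HasDerivAt ψ₁ f₁ X) :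
    HasDerivAt (jacobiMomentum M e H T ψ T₁ ψ₁)
      (rad M e (T X, X) ^ 2 * jacobiPotential M e H (T X, X) (ψ X) /
        (omega M e (T X, X) * Real.cosh (ψ X)) * jacobiField M e T ψ T₁ X +
        rad M e (T X, X) ^ 2 * ((f₁ - rhs M e H (T X, X) (ψ X) -
          (rhsDT M e H (T X, X) (ψ X) * (T₁ X - T X) +
            rhsDψ M e H (T X, X) (ψ X) * (ψ₁ X - ψ X))) +
          jacobiCoeff M e H (T X, X) (ψ X) * (Real.tanh (ψ₁ X) - Real.tanh (ψ X) -
          (1 - Real.tanh (ψ X) ^ 2) * (ψ₁ X - ψ X)))) X := by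
  have hJ := hasDerivAt_jacobiCoeff h hs hX
  obtain ⟨hD, hT, hψ⟩ := hs
  have hr := (rad_pos hD).ne'
  have k1 := hasDerivAt_comp_graph hT ((contDiffAt_rad h hD).differentiableAt (by simp))
  have k2 : HasDerivAt (jacobiMomentum M e H T ψ T₁ ψ₁) _ X :=
    (k1.pow 2).mul ((hψ₁.sub hψ).add (hJ.mul (hT₁.sub hT)))
  convert! k2 using 1
  have hC := (Real.cosh_pos (ψ X)).ne'
  have hO := (omega_pos M e (T X, X)).ne'
  have key := two_mul_dlog_rad_add_rhsDψ (H := H) (T X, X) (ψ X) hr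
  unfold jacobiField
  simp only [Pi.pow_apply]
  generalize jacobiCoeff M e H (T X, X) (ψ X) = J at *
  generalize rhsDψ M e H (T X, X) (ψ X) = R at *
  generalize jacobiPotential M e H (T X, X) (ψ X) = Q at *
  generalize (Real.tanh (ψ X) + 1) * dV (rad M e) (T X, X) +
    (Real.tanh (ψ X) - 1) * dU (rad M e) (T X, X) = r' at *
  clear k2 hJ
  have hR : R = -(J * (1 - Real.tanh (ψ X) ^ 2)) - 2 * r' / rad M e (T X, X) := by
    linear_combination key
  rw [hR]
  field_simp
  push_cast
  ring

end Linearized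

/-- Forward invariance of a cone for a perturbed linear system with nonnegative coefficients. -/
theorem pos_of_cone_system {η ζ A B e₁ e₂ : ℝ → ℝ} {a A₀ ζ₀ ε : ℝ} (ha : 0 ≤ a) (hA₀ : 0 < A₀)
    (hζ₀ : 0 < ζ₀) (hηc : ContinuousOn η (Icc 0 a)) (hζc : ContinuousOn ζ (Icc 0 a))
    (hη0 : η 0 = 0) (hζ0 : ζ 0 = ζ₀)
    (hη : ∀ s ∈ Ioo 0 a, HasDerivAt η (A s * ζ s + e₁ s) s)
    (hζ : ∀ s ∈ Ioo 0 a, HasDerivAt ζ (B s * η s + e₂ s) s)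
    (hA : ∀ s ∈ Ioo 0 a, A₀ ≤ A s) (hB : ∀ s ∈ Ioo 0 a, 0 ≤ B s)
    (he₁ : ∀ s ∈ Ioo 0 a, |e₁ s| ≤ ε) (he₂ : ∀ s ∈ Ioo 0 a, |e₂ s| ≤ ε)
    (hε : ε ≤ A₀ * (ζ₀ / 2)) (hεa : ε * a < ζ₀ / 2) (hε0 : 0 ≤ ε) : 0 < ζ a := by
  by_contra hneg
  -- Let `b` be the first time at which `ζ` has dropped to half its initial value. Before `b`, `A ζ
  -- ≥ A₀ ζ₀ / 2 ≥ ε` dominates the error, so `η` increases from `0`.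
  set S := {s ∈ Icc 0 a | ζ s ≤ ζ₀ / 2} with hS
  have hSc : IsClosed S := hζc.preimage_isClosed_of_isClosed isClosed_Icc isClosed_Iic
  have hSne : S.Nonempty := ⟨a, ⟨ha, le_rfl⟩, by linarith⟩
  have hSb : BddBelow S := ⟨0, fun s hs => hs.1.1⟩
  set b := sInf S with hb
  obtain ⟨⟨hb0, hba⟩, hbζ⟩ : b ∈ S := hSc.csInf_mem hSne hSb
  have hlt : ∀ s ∈ Ico 0 b, ζ₀ / 2 < ζ s := by
    intro s hs
    by_contra hle
    have : b ≤ s := csInf_le hSb ⟨⟨hs.1, hs.2.le.trans hba⟩, not_lt.1 hle⟩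
    exact absurd hs.2 (not_lt.2 this)
  have hsub : Icc 0 b ⊆ Icc 0 a := Icc_subset_Icc_right hba
  have hsub' : Ioo 0 b ⊆ Ioo 0 a := Ioo_subset_Ioo_right hba
  have hmono : MonotoneOn η (Icc 0 b) := by
    refine monotoneOn_of_deriv_nonneg (convex_Icc 0 b) (hηc.mono hsub) ?_ ?_
    · rw [interior_Icc]
      exact fun s hs => (hη s (hsub' hs)).differentiableAt.differentiableWithinAt
    · rw [interior_Icc]
      intro s hs
      rw [(hη s (hsub' hs)).deriv]
      have h1 := hlt s ⟨hs.1.le, hs.2⟩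
      have h2 := hA s (hsub' hs)
      have h3 := (abs_le.1 (he₁ s (hsub' hs))).1
      nlinarith
  have hηn : ∀ s ∈ Icc 0 b, 0 ≤ η s := fun s hs => by
    rw [← hη0]
    exact hmono ⟨le_rfl, hb0⟩ hs hs.1
  -- Since `B η ≥ 0`, `ζ` loses at most `ε b ≤ ε a < ζ₀ / 2` up to time `b`, contradicting the
  -- choice of `b`.
  have hmono2 : MonotoneOn (fun s => ζ s + ε * s) (Icc 0 b) := by
    have hd : ∀ s ∈ Ioo 0 b, HasDerivAt (fun s => ζ s + ε * s) (B s * η s + e₂ s + ε * 1) s :=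
      fun s hs => (hζ s (hsub' hs)).add ((hasDerivAt_id s).const_mul ε)
    refine monotoneOn_of_deriv_nonneg (convex_Icc 0 b)
      ((hζc.mono hsub).add (by fun_prop)) ?_ ?_
    · rw [interior_Icc]
      exact fun s hs => (hd s hs).differentiableAt.differentiableWithinAt
    · rw [interior_Icc]
      intro s hs
      rw [(hd s hs).deriv]
      have h1 := mul_nonneg (hB s (hsub' hs)) (hηn s ⟨hs.1.le, hs.2.le⟩)
      have h3 := (abs_le.1 (he₂ s (hsub' hs))).1
      linarith
  have := hmono2 ⟨le_rfl, hb0⟩ ⟨hb0, le_rfl⟩ hb0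
  simp only [hζ0, mul_zero, add_zero] at this
  have h4 : ε * b ≤ ε * a := mul_le_mul_of_nonneg_left hba hε0
  linarith

/-- Quadratic remainder estimate on a compact convex set. -/
theorem exists_quadratic_remainder {E : Type*} [NormedAddCommGroup E] [NormedSpace ℝ E]
    {f : E → ℝ} (hf : ContDiff ℝ ∞ f) {S : Set E} (hSc : IsCompact S) (hSx : Convex ℝ S) :
    ∃ C : ℝ, 0 ≤ C ∧ ∀ x ∈ S, ∀ y ∈ S, |f y - f x - fderiv ℝ f x (y - x)| ≤ C * ‖y - x‖ ^ 2 := by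
  have hd : ContDiff ℝ ∞ (fderiv ℝ f) := hf.fderiv_right (by simp)
  obtain ⟨K, hK⟩ := hd.contDiffOn.exists_lipschitzOnWith (by simp) hSx hSc
  refine ⟨K, K.2, fun x hx y hy => ?_⟩
  have hseg : segment ℝ x y ⊆ S := hSx.segment_subset hx hy
  have := (convex_segment x y).norm_image_sub_le_of_norm_hasFDerivWithin_le' (𝕜 := ℝ) (f := f)
    (f' := fderiv ℝ f) (φ := fderiv ℝ f x) (C := K * ‖y - x‖)
    (fun z _ => (hf.differentiable (by simp) z).hasFDerivAt.hasFDerivWithinAt)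
    (fun z hz => by
      refine (hK.norm_sub_le (hseg hz) hx).trans ?_
      gcongr
      obtain ⟨t, ht, rfl⟩ := (segment_eq_image' ℝ x y ▸ hz)
      simp only [add_sub_cancel_left, norm_smul, Real.norm_eq_abs, abs_of_nonneg ht.1]
      exact mul_le_of_le_one_left (norm_nonneg _) ht.2)
    (left_mem_segment ℝ x y) (right_mem_segment ℝ x y)
  rw [Real.norm_eq_abs] at this
  linarith [this, mul_assoc (K : ℝ) ‖y - x‖ ‖y - x‖, sq ‖y - x‖,
    congrArg (fun z => (K : ℝ) * z) (sq ‖y - x‖)]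

section Flow

/-- The vector field of the first order system `T' = tanh ψ`, `ψ' = Φ((T, X), ψ)`. -/
noncomputable def graphField (Φ : (ℝ × ℝ) × ℝ → ℝ) (X : ℝ) (y : ℝ × ℝ) : ℝ × ℝ :=
  (Real.tanh y.2, Φ ((y.1, X), y.2))

variable {Φ : (ℝ × ℝ) × ℝ → ℝ}

theorem exists_lipschitzOnWith_graphField (hΦ : ContDiff ℝ ∞ Φ) (c : ℝ × ℝ) (R : ℝ) :
    ∃ K, ∀ X ∈ Icc (-1 : ℝ) 1, LipschitzOnWith K (graphField Φ X) (Metric.closedBall c R) := by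
  have hsm : ContDiff ℝ ∞ fun z : ℝ × (ℝ × ℝ) => graphField Φ z.1 z.2 := by
    unfold graphField
    exact (contDiff_tanh.comp (by fun_prop)).prodMk (hΦ.comp (by fun_prop))
  obtain ⟨K, hK⟩ := hsm.contDiffOn.exists_lipschitzOnWith (by simp)
    ((convex_Icc (-1 : ℝ) 1).prod (convex_closedBall c R))
    (isCompact_Icc.prod (isCompact_closedBall c R))
  refine ⟨K, fun X hX => LipschitzOnWith.of_dist_le_mul fun y hy z hz => ?_⟩
  have := hK.dist_le_mul (X, y) ⟨hX, hy⟩ (X, z) ⟨hX, hz⟩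
  simpa [Prod.dist_eq] using this

/-- The field is globally bounded, since `|tanh| < 1` and `|Φ| ≤ C`. A single application of
Picard–Lindelöf therefore covers all of `[-1, 1]` and a whole ball of initial data, and yields
Lipschitz dependence on the data. -/
theorem exists_flow_graphField (hΦ : ContDiff ℝ ∞ Φ) {C : ℝ} (hC : ∀ z, |Φ z| ≤ C)
    (c : ℝ × ℝ) {X₀ : ℝ} (hX₀ : X₀ ∈ Icc (-1 : ℝ) 1) {B : ℝ} (hB : 0 ≤ B) :
    ∃ α : ℝ × ℝ → ℝ → ℝ × ℝ, (∀ x ∈ Metric.closedBall c B, α x X₀ = x ∧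
      ∀ t ∈ Icc (-1 : ℝ) 1, HasDerivWithinAt (α x) (graphField Φ t (α x t)) (Icc (-1) 1) t) ∧
      ∃ L : NNReal, ∀ t ∈ Icc (-1 : ℝ) 1, LipschitzOnWith L (α · t) (Metric.closedBall c B) := by
  have hC0 : 0 ≤ C := (abs_nonneg _).trans (hC 0)
  lift B to NNReal using hB
  lift C to NNReal using hC0
  obtain ⟨K, hK⟩ := exists_lipschitzOnWith_graphField hΦ c ((B + 2 * (C + 1) : NNReal) : ℝ)
  -- With speed at most `C + 1` and elapsed time at most `2`, a solution starting in the ball of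
  -- radius `B` stays in the ball of radius `B + 2 (C + 1)`.
  have hpl : IsPicardLindelof (graphField Φ) (⟨X₀, hX₀⟩ : Icc (-1 : ℝ) 1) c
      (B + 2 * (C + 1)) B (C + 1) K := by
    refine ⟨hK, fun x _ => ?_, fun t _ x _ => ?_, ?_⟩
    · have := hΦ.continuous
      unfold graphField
      fun_prop
    · simp only [graphField, Prod.norm_def, Real.norm_eq_abs]
      push_cast
      exact max_le ((Real.abs_tanh_lt_one _).le.trans (by simp))
        ((hC _).trans (by simp))
    · push_cast
      have : max (1 - X₀) (X₀ - -1) ≤ 2 := max_le (by linarith [hX₀.1]) (by linarith [hX₀.2])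
      have hC' : (0 : ℝ) ≤ C + 1 := by positivity
      nlinarith
  exact hpl.exists_forall_mem_closedBall_eq_hasDerivWithinAt_lipschitzOnWith

end Flow

end ReissnerNordstrom

/-! ### Solvability of the radius relation and causal diamonds -/

namespace ReissnerNordstrom

section Existence

variable {p m s c : ℝ}

/-- Solvability of the relation defining the area radius. -/
theorem exists_radius_of_cond (hm : 0 < m) (hpm : m < p)
    (hcond : 0 < c ∨ (0 < s ∧ 0 ≤ c) ∨
      (0 < s ∧ c < 0 ∧ p ^ 2 * Real.log p + m ^ 2 * Real.log (-c) <
        m ^ 2 * Real.log m + p ^ 2 * Real.log s)) :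
    ∃ d : ℝ × ℝ × ℝ, 0 < d.1 ∧ 0 < d.2.1 ∧ 0 < d.2.2 ∧ p - d.1 = d.2.1 * s ∧
      d.1 - m = d.2.2 * c ∧
      p ^ 2 * Real.log d.2.1 + (p - m) * d.1 = m ^ 2 * Real.log d.2.2 := by
  have hp : 0 < p := hm.trans hpm
  -- With `r = p - a s`, the logarithmic relation forces `b = E a`; a zero of `φ` is then the
  -- remaining equation `r - m = b c`. As `a → 0⁺`, `φ` tends to `p - m > 0`, so it suffices to find
  -- a point where `φ ≤ 0` before `r` stops being positive.
  set E : ℝ → ℝ := fun a => Real.exp ((m ^ 2)⁻¹ * (p ^ 2 * Real.log a + (p - m) * (p - a * s)))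
    with hE
  set φ : ℝ → ℝ := fun a => p - a * s - m - c * E a with hφ
  have hcont : ContinuousOn φ (Ioi 0) := by
    have hl : ContinuousOn Real.log (Ioi 0) :=
      Real.continuousOn_log.mono fun x hx => (ne_of_gt hx : x ≠ 0)
    simp only [hφ, hE]
    fun_prop
  have hlim : Tendsto φ (𝓝[>] 0) (𝓝 (p - m)) := by
    have h0 : Tendsto (fun a : ℝ => p - a * s) (𝓝[>] 0) (𝓝 p) := by
      have : Continuous fun a : ℝ => p - a * s := by fun_prop
      simpa using (this.tendsto 0).mono_left nhdsWithin_le_nhds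
    have h1 : Tendsto (fun a : ℝ => (m ^ 2)⁻¹ * (p ^ 2 * Real.log a + (p - m) * (p - a * s)))
        (𝓝[>] 0) atBot := by
      refine Tendsto.const_mul_atBot (by positivity) ?_
      exact (Tendsto.const_mul_atBot (by positivity) Real.tendsto_log_nhdsGT_zero).atBot_add
        (h0.const_mul (p - m))
    have h2 : Tendsto E (𝓝[>] 0) (𝓝 0) := Real.tendsto_exp_atBot.comp h1
    have h3 := (h0.sub_const m).sub (h2.const_mul c)
    simpa [hφ] using h3
  have hpos : ∀ᶠ a in 𝓝[>] (0 : ℝ), 0 < φ a := hlim.eventually (lt_mem_nhds (by linarith))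
  suffices hA : ∃ A, 0 < A ∧ φ A ≤ 0 ∧ ∀ a ∈ Ioc 0 A, φ a = 0 → 0 < p - a * s by
    obtain ⟨A, hA0, hφA, hA⟩ := hA
    obtain ⟨a₁, ha₁, ha₁'⟩ : ∃ a, 0 < φ a ∧ a ∈ Ioo 0 A :=
      (hpos.and (Ioo_mem_nhdsGT hA0)).exists
    obtain ⟨a, ha, ha0⟩ : (0 : ℝ) ∈ φ '' Icc a₁ A :=
      intermediate_value_Icc' ha₁'.2.le
        (hcont.mono fun x hx => ha₁'.1.trans_le hx.1) ⟨hφA, ha₁.le⟩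
    have hapos : 0 < a := ha₁'.1.trans_le ha.1
    refine ⟨(p - a * s, a, E a), hA a ⟨hapos, ha.2⟩ ha0, hapos, Real.exp_pos _, ?_, ?_, ?_⟩
    · dsimp only
      ring
    · have : p - a * s - m - c * E a = 0 := ha0
      dsimp only
      linear_combination this
    · simp only [hE, Real.log_exp]
      field_simp
  rcases hcond with hc | ⟨hs, hc⟩ | ⟨hs, hc, hlt⟩
  · rcases lt_or_ge 0 s with hs | hs
    -- The endpoint is the value of `a` at which `r = m`.
    · have h1 : p - (p - m) / s * s = m := by field_simp; ring
      refine ⟨(p - m) / s, div_pos (by linarith) hs, ?_, ?_⟩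
      · simp only [hφ, h1, sub_self, zero_sub]
        exact neg_nonpos.2 (mul_pos hc (Real.exp_pos _)).le
      · rintro a ⟨-, ha⟩ -
        have := mul_le_mul_of_nonneg_right ha hs.le
        linarith
    -- For `s ≤ 0` the radius is automatically positive. `A` is chosen to give `c E(A) = m² / (p -
    -- m) · exp y` with `y = (p - m)(p - A s) / m²`; then `exp y ≥ y` yields `φ A ≤ -m`.
    · set A := Real.exp (m ^ 2 / p ^ 2 * Real.log (m ^ 2 / ((p - m) * c))) with hA
      have hpm' : 0 < p - m := by linarith
      refine ⟨A, Real.exp_pos _, ?_, ?_⟩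
      · have hq : 0 < m ^ 2 / ((p - m) * c) := by positivity
        have hEA : E A = m ^ 2 / ((p - m) * c) * Real.exp ((p - m) * (p - A * s) / m ^ 2) := by
          nth_rewrite 1 [← Real.exp_log hq]
          rw [← Real.exp_add]
          simp only [hE]
          rw [show Real.log A = m ^ 2 / p ^ 2 * Real.log (m ^ 2 / ((p - m) * c)) by
            rw [hA, Real.log_exp]]
          congr 1
          field_simp
        have hx := Real.add_one_le_exp ((p - m) * (p - A * s) / m ^ 2)
        have h2 : (m ^ 2 / (p - m)) * ((p - m) * (p - A * s) / m ^ 2) ≤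
            (m ^ 2 / (p - m)) * Real.exp ((p - m) * (p - A * s) / m ^ 2) :=
          mul_le_mul_of_nonneg_left (by linarith) (by positivity)
        have h3 : (m ^ 2 / (p - m)) * ((p - m) * (p - A * s) / m ^ 2) = p - A * s := by
          field_simp
        have h4 : c * E A = (m ^ 2 / (p - m)) * Real.exp ((p - m) * (p - A * s) / m ^ 2) := by
          rw [hEA]
          field_simp
        simp only [hφ]
        rw [h4]
        linarith
      · rintro a ⟨ha, -⟩ -
        nlinarith
  · have h1 : p - (p - m) / s * s = m := by field_simp; ring
    refine ⟨(p - m) / s, div_pos (by linarith) hs, ?_, ?_⟩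
    · simp only [hφ, h1, sub_self, zero_sub]
      exact neg_nonpos.2 (mul_nonneg hc (Real.exp_pos _).le)
    · rintro a ⟨-, ha⟩ -
      have := mul_le_mul_of_nonneg_right ha hs.le
      rw [div_mul_cancel₀ _ hs.ne'] at this
      linarith
  -- The endpoint corresponds to `r = 0`, the singularity. The logarithmic inequality says exactly
  -- that `φ` is negative there, so the zero found occurs strictly earlier, at positive radius.
  · have h1 : p - p / s * s = 0 := by field_simp; ring
    have hneg : φ (p / s) < 0 := by
      have h2 : -c * E (p / s) < m := by
        rw [← Real.log_lt_log_iff (mul_pos (by linarith) (Real.exp_pos _)) hm,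
          Real.log_mul (by linarith) (Real.exp_pos _).ne']
        simp only [Real.log_exp, h1, mul_zero, add_zero, Real.log_div hp.ne' hs.ne']
        have hm2 : 0 < m ^ 2 := by positivity
        rw [← mul_lt_mul_iff_right₀ hm2, mul_add, mul_inv_cancel_left₀ hm2.ne']
        linarith
      simp only [hφ, h1]
      linarith
    refine ⟨p / s, div_pos hp hs, hneg.le, ?_⟩
    rintro a ⟨-, ha⟩ ha0
    have hne : a ≠ p / s := by
      rintro rfl
      linarith
    have := mul_lt_mul_of_pos_right (lt_of_le_of_ne ha hne) hs
    rw [div_mul_cancel₀ _ hs.ne'] at this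
    linarith

/-- Inside the inner horizon the positivity of the radius is a condition on the Penrose
coordinates. -/
theorem cond_of_radius_pos {r a b : ℝ} (hpm : m < p) (hr : 0 < r) (ha : 0 < a)
    (hb : 0 < b) (hs : 0 < s) (hc : c < 0) (e1 : p - r = a * s) (e2 : r - m = b * c)
    (e3 : p ^ 2 * Real.log a + (p - m) * r = m ^ 2 * Real.log b) :
    p ^ 2 * Real.log p + m ^ 2 * Real.log (-c) < m ^ 2 * Real.log m + p ^ 2 * Real.log s := by
  have hrm : r < m := by nlinarith
  -- On the solution, `g r = p² log s - m² log (-c)`, because `a` and `b` drop out by the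
  -- logarithmic relation. The claim is therefore `g 0 < g r`.
  set g : ℝ → ℝ := fun x => p ^ 2 * Real.log (p - x) + (p - m) * x - m ^ 2 * Real.log (m - x)
    with hg
  have hd : ∀ x ∈ Ico 0 m, HasDerivAt g ((p - m) * x ^ 2 / ((p - x) * (m - x))) x := by
    intro x hx
    have h1 : p - x ≠ 0 := by linarith [hx.2]
    have h2 : m - x ≠ 0 := by linarith [hx.2]
    have := (((((hasDerivAt_id x).const_sub p).log h1).const_mul (p ^ 2)).add
      ((hasDerivAt_id x).const_mul (p - m))).sub
      ((((hasDerivAt_id x).const_sub m).log h2).const_mul (m ^ 2))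
    convert! this using 1
    simp only [id]
    field_simp
    ring
  have hmono : StrictMonoOn g (Icc 0 r) := by
    refine strictMonoOn_of_deriv_pos (convex_Icc 0 r)
      (fun x hx => (hd x ⟨hx.1, hx.2.trans_lt hrm⟩).continuousAt.continuousWithinAt) ?_
    intro x hx
    rw [interior_Icc] at hx
    rw [(hd x ⟨hx.1.le, hx.2.trans hrm⟩).deriv]
    have h0 := hx.1
    have h1 : 0 < p - x := by linarith [hx.2]
    have h2 : 0 < m - x := by linarith [hx.2]
    have h3 : 0 < p - m := by linarith
    positivity
  have hlt := hmono ⟨le_rfl, hr.le⟩ ⟨hr.le, le_rfl⟩ hr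
  have e2' : m - r = b * -c := by linarith
  simp only [hg, sub_zero, mul_zero, add_zero] at hlt
  rw [e1, e2', Real.log_mul ha.ne' hs.ne', Real.log_mul hb.ne' (by linarith)] at hlt
  nlinarith

end Existence

section Diamond

variable {M e : ℝ}

theorem sinProd_eq (T X : ℝ) :
    sinProd T X = (Real.cos (Real.pi * X) - Real.cos (Real.pi * T)) / 2 := by
  unfold sinProd
  rw [show Real.pi * X = Real.pi * (T + X) / 2 - Real.pi * (T - X) / 2 by ring,
    show Real.pi * T = Real.pi * (T + X) / 2 + Real.pi * (T - X) / 2 by ring, Real.cos_sub,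
    Real.cos_add]
  ring

theorem cosProd_eq (T X : ℝ) :
    cosProd T X = (Real.cos (Real.pi * X) + Real.cos (Real.pi * T)) / 2 := by
  unfold cosProd
  rw [show Real.pi * X = Real.pi * (T + X) / 2 - Real.pi * (T - X) / 2 by ring,
    show Real.pi * T = Real.pi * (T + X) / 2 + Real.pi * (T - X) / 2 by ring, Real.cos_sub,
    Real.cos_add]
  ring

theorem cos_add_cos_eq (x t : ℝ) :
    (Real.cos (Real.pi * x) + Real.cos (Real.pi * t)) / 2 =
      Real.cos (Real.pi / 2 * (|x| - |t|)) * Real.cos (Real.pi / 2 * (|x| + |t|)) := by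
  have h : ∀ y : ℝ, Real.cos (Real.pi * y) = Real.cos (Real.pi * |y|) := fun y => by
    rw [← Real.cos_abs (Real.pi * y), abs_mul, abs_of_pos Real.pi_pos]
  rw [h x, h t, show Real.pi * |x| = Real.pi / 2 * (|x| - |t|) + Real.pi / 2 * (|x| + |t|) by ring,
    show Real.pi * |t| = Real.pi / 2 * (|x| + |t|) - Real.pi / 2 * (|x| - |t|) by ring,
    Real.cos_sub, Real.cos_add]
  ring

theorem cos_sub_cos_eq (x t : ℝ) :
    (Real.cos (Real.pi * x) - Real.cos (Real.pi * t)) / 2 =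
      -(Real.sin (Real.pi / 2 * (|x| - |t|)) * Real.sin (Real.pi / 2 * (|x| + |t|))) := by
  have h : ∀ y : ℝ, Real.cos (Real.pi * y) = Real.cos (Real.pi * |y|) := fun y => by
    rw [← Real.cos_abs (Real.pi * y), abs_mul, abs_of_pos Real.pi_pos]
  rw [h x, h t, show Real.pi * |x| = Real.pi / 2 * (|x| - |t|) + Real.pi / 2 * (|x| + |t|) by ring,
    show Real.pi * |t| = Real.pi / 2 * (|x| + |t|) - Real.pi / 2 * (|x| - |t|) by ring,
    Real.cos_sub, Real.cos_add]
  ring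

theorem cos_half_pi_mul_pos {y : ℝ} (hy : |y| < 1) : 0 < Real.cos (Real.pi / 2 * y) := by
  obtain ⟨h1, h2⟩ := abs_lt.1 hy
  have := Real.pi_pos
  exact Real.cos_pos_of_mem_Ioo ⟨by nlinarith, by nlinarith⟩

/-- If `cos (πx) + cos (πt) > 0` with `|x| < 1`, `|t| ≤ 1`, then `|x| + |t| < 1`. -/
theorem abs_add_abs_lt_one {x t : ℝ} (hx : |x| < 1) (ht : |t| ≤ 1)
    (h : 0 < (Real.cos (Real.pi * x) + Real.cos (Real.pi * t)) / 2) : |x| + |t| < 1 := by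
  rw [cos_add_cos_eq] at h
  by_contra! hge
  have := Real.pi_pos
  have h1 : Real.cos (Real.pi / 2 * (|x| + |t|)) ≤ 0 :=
    Real.cos_nonpos_of_pi_div_two_le_of_le (by nlinarith) (by nlinarith)
  have h2 : 0 ≤ Real.cos (Real.pi / 2 * (|x| - |t|)) :=
    Real.cos_nonneg_of_mem_Icc ⟨by nlinarith [abs_nonneg x], by nlinarith [abs_nonneg t]⟩
  nlinarith

theorem exists_even_shift (T : ℝ) : ∃ n : ℤ, |T - 2 * n| ≤ 1 := by
  refine ⟨round (T / 2), ?_⟩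
  have := abs_sub_round (T / 2)
  rw [abs_le] at this ⊢
  constructor <;> linarith [this.1, this.2]

theorem cos_pi_mul_sub_even (T : ℝ) (n : ℤ) :
    Real.cos (Real.pi * (T - 2 * n)) = Real.cos (Real.pi * T) := by
  rw [show Real.pi * (T - 2 * n) = Real.pi * T - n * (2 * Real.pi) by ring,
    Real.cos_sub_int_mul_two_pi]

theorem cos_pi_mul_sub_one (T : ℝ) :
    Real.cos (Real.pi * (T - 1)) = -Real.cos (Real.pi * T) := by
  rw [show Real.pi * (T - 1) = Real.pi * T - Real.pi by ring, Real.cos_sub_pi]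

/-- Monotonicity of the null trigonometric products on the causal diamond. -/
theorem trig_le_of_abs_le {P Q P₀ Q₀ : ℝ} (hP : 0 < P) (hPP : P ≤ P₀) (hPQ : P ≤ Q) (hQQ : Q ≤ Q₀)
    (hPQ₀ : P₀ ≤ Q₀) (hQ₀ : Q₀ < 1) :
    Real.cos (Real.pi / 2 * P₀) * Real.cos (Real.pi / 2 * Q₀) ≤
      Real.cos (Real.pi / 2 * P) * Real.cos (Real.pi / 2 * Q) ∧
    0 < Real.sin (Real.pi / 2 * P) * Real.sin (Real.pi / 2 * Q) ∧
    Real.sin (Real.pi / 2 * P) * Real.sin (Real.pi / 2 * Q) ≤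
      Real.sin (Real.pi / 2 * P₀) * Real.sin (Real.pi / 2 * Q₀) := by
  have hpi := Real.pi_pos
  have hh : 0 < Real.pi / 2 := by positivity
  have aP : 0 < Real.pi / 2 * P := mul_pos hh hP
  have aPP : Real.pi / 2 * P ≤ Real.pi / 2 * P₀ := mul_le_mul_of_nonneg_left hPP hh.le
  have aPQ : Real.pi / 2 * P ≤ Real.pi / 2 * Q := mul_le_mul_of_nonneg_left hPQ hh.le
  have aQQ : Real.pi / 2 * Q ≤ Real.pi / 2 * Q₀ := mul_le_mul_of_nonneg_left hQQ hh.le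
  have aPQ₀ : Real.pi / 2 * P₀ ≤ Real.pi / 2 * Q₀ := mul_le_mul_of_nonneg_left hPQ₀ hh.le
  have aQ₀ : Real.pi / 2 * Q₀ < Real.pi / 2 := by
    have := mul_lt_mul_of_pos_left hQ₀ hh
    linarith
  have sP := Real.sin_pos_of_pos_of_lt_pi aP (by linarith)
  have sQ := Real.sin_pos_of_pos_of_lt_pi (aP.trans_le aPQ) (by linarith)
  have sPP := Real.sin_le_sin_of_le_of_le_pi_div_two (by linarith) (by linarith) aPP
  have sQQ := Real.sin_le_sin_of_le_of_le_pi_div_two (by linarith) (by linarith) aQQ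
  have cPP := Real.cos_le_cos_of_nonneg_of_le_pi aP.le (by linarith) aPP
  have cQQ := Real.cos_le_cos_of_nonneg_of_le_pi (aP.trans_le aPQ).le (by linarith) aQQ
  have cQ₀ := Real.cos_nonneg_of_mem_Icc (x := Real.pi / 2 * Q₀) ⟨by linarith, by linarith⟩
  have cP := Real.cos_nonneg_of_mem_Icc (x := Real.pi / 2 * P) ⟨by linarith, by linarith⟩
  exact ⟨mul_le_mul cPP cQQ cQ₀ cP, mul_pos sP sQ, mul_le_mul sPP sQQ sQ.le (sP.le.trans sPP)⟩

/-- The domain of influence of the axis: the causal diamond with corners `(T₀, ± X₀)` is contained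
in the Penrose diagram. -/
theorem diamond_subset (h : Subextremal M e) {T₀ X₀ T X : ℝ}
    (h0 : (T₀, X₀) ∈ penroseDiagram M e) (hX : |T - T₀| + |X| ≤ |X₀|) :
    (T, X) ∈ penroseDiagram M e := by
  have hm := h.rMinus_pos
  have hpm := h.rMinus_lt_rPlus
  have hX₀1 : |X₀| < 1 := h0.1
  have hX1 : |X| < 1 := by linarith [abs_nonneg (T - T₀)]
  refine ⟨hX1, exists_radius_of_cond (s := sinProd T X) (c := cosProd T X) hm hpm ?_⟩
  obtain ⟨⟨r, a, b⟩, hr, ha, hb, e1, e2, e3⟩ := h0.2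
  dsimp only at hr ha hb e1 e2 e3
  rcases lt_or_ge 0 (cosProd T₀ X₀) with hc₀ | hc₀
  -- Where `cosProd > 0` the relation is solvable without further condition. After an even shift of
  -- `T` this region is `|X| + |T - 2n| < 1`, and passing to the diamond does not increase `|X| + |T
  -- - 2n|`.
  · left
    obtain ⟨n, hn⟩ := exists_even_shift T₀
    rw [cosProd_eq, ← cos_pi_mul_sub_even T₀ n] at hc₀
    rw [cosProd_eq, ← cos_pi_mul_sub_even T n]
    have h1 := abs_add_abs_lt_one hX₀1 hn hc₀
    have h2 : |X| + |T - 2 * n| < 1 := by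
      have : |T - 2 * n| ≤ |T - T₀| + |T₀ - 2 * n| := abs_sub_le _ _ _
      linarith
    rw [cos_add_cos_eq]
    refine mul_pos (cos_half_pi_mul_pos ?_) (cos_half_pi_mul_pos ?_)
    · rw [abs_lt]
      constructor <;> linarith [abs_nonneg X, abs_nonneg (T - 2 * n)]
    · rw [abs_of_nonneg (by positivity)]
      exact h2
  -- Otherwise `r ≤ r₋`, which forces `sinProd > 0`. An odd shift of `T` exchanges sine and cosine,
  -- and the point lies in `|X| + |T - 1 - 2n| < 1`.
  · right
    have hs₀ : 0 < sinProd T₀ X₀ := by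
      have : r - rMinus M e ≤ 0 := by
        rw [e2]
        exact mul_nonpos_of_nonneg_of_nonpos hb.le hc₀
      have : 0 < a * sinProd T₀ X₀ := by linarith
      exact pos_of_mul_pos_right this ha.le
    have hcond := cond_of_radius_pos (s := sinProd T₀ X₀) (c := cosProd T₀ X₀) hpm hr ha hb hs₀
    obtain ⟨n, hn⟩ := exists_even_shift (T₀ - 1)
    have hshift : ∀ T : ℝ, Real.cos (Real.pi * T) = -Real.cos (Real.pi * (T - 1 - 2 * n)) :=
      fun T => by rw [cos_pi_mul_sub_even, cos_pi_mul_sub_one, neg_neg]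
    have hsP : ∀ T X : ℝ, sinProd T X = Real.cos (Real.pi / 2 * (|X| - |T - 1 - 2 * n|)) *
        Real.cos (Real.pi / 2 * (|X| + |T - 1 - 2 * n|)) := fun T X => by
      rw [sinProd_eq, hshift T, sub_neg_eq_add, cos_add_cos_eq]
    have hcP : ∀ T X : ℝ, cosProd T X = -(Real.sin (Real.pi / 2 * (|X| - |T - 1 - 2 * n|)) *
        Real.sin (Real.pi / 2 * (|X| + |T - 1 - 2 * n|))) := fun T X => by
      rw [cosProd_eq, hshift T, ← sub_eq_add_neg, cos_sub_cos_eq]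
    have hQ₀ : |X₀| + |T₀ - 1 - 2 * n| < 1 := by
      refine abs_add_abs_lt_one hX₀1 hn ?_
      rwa [sinProd_eq, hshift T₀, sub_neg_eq_add] at hs₀
    have htri : |T - 1 - 2 * n| ≤ |T - T₀| + |T₀ - 1 - 2 * n| := by
      have := abs_add_le (T - T₀) (T₀ - 1 - 2 * n)
      rwa [show T - T₀ + (T₀ - 1 - 2 * n) = T - 1 - 2 * n by ring] at this
    have htri' : |T₀ - 1 - 2 * n| ≤ |T - T₀| + |T - 1 - 2 * n| := by
      have := abs_add_le (T₀ - T) (T - 1 - 2 * n)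
      rwa [show T₀ - T + (T - 1 - 2 * n) = T₀ - 1 - 2 * n by ring, abs_sub_comm T₀ T] at this
    have hsT := hsP T X
    have hcT := hcP T X
    have hsT₀ := hsP T₀ X₀
    have hcT₀ := hcP T₀ X₀
    have a1 := abs_nonneg X
    have a2 := abs_nonneg (T - 1 - 2 * n)
    have a4 := abs_nonneg (T₀ - 1 - 2 * n)
    have hsT_pos : 0 < sinProd T X := by
      rw [hsT]
      refine mul_pos (cos_half_pi_mul_pos (abs_lt.2 ⟨?_, ?_⟩))
        (cos_half_pi_mul_pos (abs_lt.2 ⟨?_, ?_⟩)) <;> linarith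
    -- The sign of `|X| - |T - 1 - 2n|` separates the points with `cosProd ≥ 0` from those beyond
    -- the inner horizon.
    rcases le_or_gt (|X| - |T - 1 - 2 * n|) 0 with hP0 | hP0
    · left
      refine ⟨hsT_pos, ?_⟩
      rw [hcT, neg_nonneg]
      have hpi := Real.pi_pos
      refine mul_nonpos_of_nonpos_of_nonneg (Real.sin_nonpos_of_nonpos_of_neg_pi_le ?_ ?_)
        (Real.sin_nonneg_of_nonneg_of_le_pi (by positivity) ?_)
      · exact mul_nonpos_of_nonneg_of_nonpos (by positivity) hP0
      · have := mul_le_mul_of_nonneg_left (show -2 ≤ |X| - |T - 1 - 2 * n| by linarith)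
          (show 0 ≤ Real.pi / 2 by positivity)
        linarith
      · have := mul_le_mul_of_nonneg_left (show |X| + |T - 1 - 2 * n| ≤ 2 by linarith)
          (show 0 ≤ Real.pi / 2 by positivity)
        linarith
    · right
      -- Beyond the inner horizon, passing from the corner into the diamond does not decrease
      -- `sinProd` and does not increase `-cosProd`, so the inequality that keeps the radius
      -- positive at the corner is inherited.
      obtain ⟨t1, t2, t3⟩ := trig_le_of_abs_le hP0
        (show |X| - |T - 1 - 2 * n| ≤ |X₀| - |T₀ - 1 - 2 * n| by linarith)
        (show |X| - |T - 1 - 2 * n| ≤ |X| + |T - 1 - 2 * n| by linarith)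
        (show |X| + |T - 1 - 2 * n| ≤ |X₀| + |T₀ - 1 - 2 * n| by linarith) (by linarith) hQ₀
      rw [← hsT, ← hsT₀] at t1
      have hcneg : cosProd T X < 0 := by rw [hcT]; linarith
      have hcc : -cosProd T X ≤ -cosProd T₀ X₀ := by
        rw [hcT, hcT₀]
        linarith
      refine ⟨hsT_pos, hcneg, ?_⟩
      have hlt := hcond (by linarith) e1 e2 e3
      have l1 := mul_le_mul_of_nonneg_left (Real.log_le_log hs₀ t1) (sq_nonneg (rPlus M e))
      have l2 := mul_le_mul_of_nonneg_left (Real.log_le_log (by linarith) hcc)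
        (sq_nonneg (rMinus M e))
      linarith

end Diamond

end ReissnerNordstrom

/-! ### Cutoff of the equation, confinement and a zero counting lemma -/

namespace ReissnerNordstrom

variable {M e H T₀ a : ℝ}

/-- The causal diamond with corners `(T₀, ± a)`. -/
def diamond (T₀ a : ℝ) : Set (ℝ × ℝ) := {q | |q.1 - T₀| + |q.2| ≤ a}

theorem isCompact_diamond : IsCompact (diamond T₀ a) := by
  refine (isCompact_closedBall ((T₀, 0) : ℝ × ℝ) a).of_isClosed_subset ?_ ?_
  · exact isClosed_le (by fun_prop) continuous_const
  · rintro ⟨t, x⟩ hq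
    have hq' : |t - T₀| + |x| ≤ a := hq
    have h1 := abs_nonneg (t - T₀)
    have h2 := abs_nonneg x
    simp only [Metric.mem_closedBall, Prod.dist_eq, Real.dist_eq, sub_zero]
    exact max_le (by linarith) (by linarith)

/-- The rapidity enters only through `tanh ψ` and `1 / cosh ψ`, so the bound does not depend on `ψ`.
The rapidity therefore cannot blow up over a compact part of the diagram. -/
theorem abs_rhs_le (q : ℝ × ℝ) (ψ : ℝ) :
    |rhs M e H q ψ| ≤ 3 * |H| * omega M e q + 2 * |slopeV M e q| + 2 * |slopeU M e q| := by
  have hc := Real.one_le_cosh ψ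
  have ht := abs_lt.1 (Real.abs_tanh_lt_one ψ)
  have hO := omega_pos M e q
  have h1 : |3 * H * omega M e q / Real.cosh ψ| ≤ 3 * |H| * omega M e q := by
    rw [abs_div, abs_of_pos (by linarith : 0 < Real.cosh ψ), abs_mul, abs_mul, abs_of_pos hO,
      abs_of_pos (by norm_num : (0 : ℝ) < 3)]
    exact div_le_self (by positivity) hc
  have h2 : |(1 + Real.tanh ψ) * slopeV M e q| ≤ 2 * |slopeV M e q| := by
    rw [abs_mul]
    exact mul_le_mul_of_nonneg_right (abs_le.2 ⟨by linarith, by linarith⟩) (abs_nonneg _)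
  have h3 : |(1 - Real.tanh ψ) * slopeU M e q| ≤ 2 * |slopeU M e q| := by
    rw [abs_mul]
    exact mul_le_mul_of_nonneg_right (abs_le.2 ⟨by linarith, by linarith⟩) (abs_nonneg _)
  unfold rhs
  rw [slopeTerm_eq]
  have h4 := abs_sub (3 * H * omega M e q / Real.cosh ψ)
    ((1 + Real.tanh ψ) * slopeV M e q + (1 - Real.tanh ψ) * slopeU M e q)
  have h5 := abs_add_le ((1 + Real.tanh ψ) * slopeV M e q) ((1 - Real.tanh ψ) * slopeU M e q)
  linarith

/-- The right hand side of the mean curvature equation can be cut off outside a compact subset of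
the Penrose diagram. -/
theorem exists_cutoff_rhs (h : Subextremal M e) (H : ℝ) {K : Set (ℝ × ℝ)} (hK : IsCompact K)
    (hKD : K ⊆ penroseDiagram M e) :
    ∃ Φ : (ℝ × ℝ) × ℝ → ℝ, ContDiff ℝ ∞ Φ ∧ (∃ C, ∀ z, |Φ z| ≤ C) ∧
      ∃ U, IsOpen U ∧ K ⊆ U ∧ U ⊆ penroseDiagram M e ∧
        ∀ q ∈ U, ∀ ψ, Φ (q, ψ) = rhs M e H q ψ := by
  obtain ⟨L, hL, hKL, hLD⟩ := exists_compact_between hK (isOpen_penroseDiagram h) hKD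
  obtain ⟨χ, h1, h0, hχ⟩ := exists_contMDiffMap_one_nhds_of_subset_interior
    (modelWithCornersSelf ℝ (ℝ × ℝ)) (n := (⊤ : ℕ∞)) hK.isClosed hKL
  obtain ⟨U, hU, hKU, hU1⟩ := mem_nhdsSet_iff_exists.1 h1
  have hχs : ContDiff ℝ ∞ χ := χ.contMDiff.contDiff
  refine ⟨fun z => χ z.1 * rhs M e H z.1 z.2, ?_, ?_, U, hU, hKU, ?_, ?_⟩
  · rw [contDiff_iff_contDiffAt]
    intro z
    by_cases hz : z.1 ∈ penroseDiagram M e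
    · exact (hχs.contDiffAt.comp z contDiffAt_fst).mul (contDiffAt_rhs h hz)
    · have hev : ∀ᶠ w in 𝓝 z, w.1 ∉ L :=
        continuous_fst.continuousAt.eventually
          (hL.isClosed.isOpen_compl.mem_nhds fun hzL => hz (hLD hzL))
      refine (contDiffAt_const : ContDiffAt ℝ ∞ (fun _ => (0 : ℝ)) z).congr_of_eventuallyEq ?_
      filter_upwards [hev] with w hw
      rw [h0 _ hw, zero_mul]
  · have hc : ContinuousOn (fun q => 3 * |H| * omega M e q + 2 * |slopeV M e q| +
        2 * |slopeU M e q|) L := by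
      intro q hq
      have c1 := (contDiffAt_omega h (hLD hq)).continuousAt
      have c2 := (contDiffAt_slopeV h (hLD hq)).continuousAt
      have c3 := (contDiffAt_slopeU h (hLD hq)).continuousAt
      exact (((continuousAt_const.mul c1).add (continuousAt_const.mul c2.abs)).add
        (continuousAt_const.mul c3.abs)).continuousWithinAt
    obtain ⟨C, hC⟩ := hL.exists_bound_of_continuousOn hc
    refine ⟨max C 0, fun z => ?_⟩
    by_cases hz : z.1 ∈ L
    · have hb := hC _ hz
      rw [Real.norm_eq_abs] at hb
      have hx := hχ z.1
      rw [abs_mul, abs_of_nonneg hx.1]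
      have := (abs_rhs_le (M := M) (e := e) (H := H) z.1 z.2).trans ((le_abs_self _).trans hb)
      calc χ z.1 * |rhs M e H z.1 z.2| ≤ 1 * C :=
            mul_le_mul hx.2 this (abs_nonneg _) zero_le_one
        _ ≤ max C 0 := by rw [one_mul]; exact le_max_left _ _
    · simp [h0 _ hz]
  · intro q hq
    by_contra hqD
    have e1 := hU1 hq
    have e0 := h0 q fun hqL => hqD (hLD hqL)
    simp only [mem_ofPred_eq] at e1
    linarith
  · intro q hq ψ
    have e1 := hU1 hq
    simp only [mem_ofPred_eq] at e1
    dsimp only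
    rw [e1, one_mul]

/-- Spacelike graphs through `(T₀, a)` stay in the causal diamond. -/
theorem mem_diamond_of_hasDerivWithinAt {T T' : ℝ → ℝ}
    (hT : ∀ x ∈ Icc 0 a, HasDerivWithinAt T (T' x) (Icc 0 a) x) (hT' : ∀ x ∈ Icc 0 a, |T' x| ≤ 1)
    (hTa : T a = T₀) {x : ℝ} (hx : x ∈ Icc 0 a) : (T x, x) ∈ diamond T₀ a := by
  have := (convex_Icc 0 a).norm_image_sub_le_of_norm_hasDerivWithin_le hT hT'
    (right_mem_Icc.2 (hx.1.trans hx.2)) hx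
  rw [hTa, Real.norm_eq_abs, Real.norm_eq_abs, one_mul, abs_sub_comm x a,
    abs_of_nonneg (by linarith [hx.2] : 0 ≤ a - x)] at this
  simp only [diamond, mem_ofPred_eq, abs_of_nonneg hx.1]
  linarith

/-- A continuous function which increases strictly through each of its zeros has at most one
zero. -/
theorem zero_unique_of_eventually {G : ℝ → ℝ} {b₁ b₂ : ℝ} (hG : ContinuousOn G (Icc b₁ b₂))
    (h1 : G b₁ = 0) (h2 : G b₂ = 0)
    (hz : ∀ b ∈ Icc b₁ b₂, G b = 0 → ∀ᶠ k in 𝓝[≠] (0 : ℝ), 0 < k * G (b + k)) : ¬ b₁ < b₂ := by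
  intro hlt
  have side : ∀ b ∈ Icc b₁ b₂, G b = 0 → ∃ δ > 0, ∀ x, |x - b| < δ → x ≠ b → 0 < (x - b) * G x := by
    intro b hb hb0
    obtain ⟨δ, hδ, hball⟩ := Metric.mem_nhdsWithin_iff.1 (hz b hb hb0)
    refine ⟨δ, hδ, fun x hx hne => ?_⟩
    have := hball (a := x - b) ⟨by simpa [Real.dist_eq] using hx, sub_ne_zero.2 hne⟩
    simpa using this
  -- The infimum `c` of `S` is the next zero after `b₁`: since `b₁` is an isolated zero, `S` is
  -- closed.
  set S := {x ∈ Icc b₁ b₂ | G x = 0 ∧ b₁ < x} with hS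
  obtain ⟨δ₁, hδ₁, hs₁⟩ := side b₁ ⟨le_rfl, hlt.le⟩ h1
  have hS' : S = Icc b₁ b₂ ∩ G ⁻¹' {0} ∩ Ici (b₁ + δ₁) := by
    ext x
    simp only [hS, mem_ofPred_eq, mem_inter_iff, mem_preimage, mem_singleton_iff, mem_Ici]
    constructor
    · rintro ⟨hx, hx0, hx1⟩
      refine ⟨⟨hx, hx0⟩, ?_⟩
      by_contra! hxs
      have := hs₁ x (by rw [abs_of_pos (by linarith)]; linarith) hx1.ne'
      rw [hx0, mul_zero] at this
      exact lt_irrefl _ this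
    · rintro ⟨⟨hx, hx0⟩, hx1⟩
      exact ⟨hx, hx0, by linarith⟩
  have hSc : IsClosed S := by
    rw [hS']
    exact (hG.preimage_isClosed_of_isClosed isClosed_Icc isClosed_singleton).inter isClosed_Ici
  have hSb : BddBelow S := ⟨b₁, fun x hx => hx.1.1⟩
  obtain ⟨hcI, hc0, hc1⟩ : sInf S ∈ S := hSc.csInf_mem ⟨b₂, ⟨hlt.le, le_rfl⟩, h2, hlt⟩ hSb
  set c := sInf S
  obtain ⟨δ₂, hδ₂, hs₂⟩ := side c hcI hc0
  -- At distance `t`, `G` is positive to the right of `b₁` and negative to the left of `c`, and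
  -- these two points are still ordered; a zero between them contradicts the choice of `c`.
  set t := min (min (δ₁ / 2) (δ₂ / 2)) ((c - b₁) / 3) with ht
  have ht0 : 0 < t := lt_min (lt_min (by linarith) (by linarith)) (by linarith)
  have ht1 : t ≤ δ₁ / 2 := (min_le_left _ _).trans (min_le_left _ _)
  have ht2 : t ≤ δ₂ / 2 := (min_le_left _ _).trans (min_le_right _ _)
  have ht3 : t ≤ (c - b₁) / 3 := min_le_right _ _
  have p1 := hs₁ (b₁ + t) (by rw [add_sub_cancel_left, abs_of_pos ht0]; linarith) (by linarith)
  have p2 := hs₂ (c - t) (by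
    rw [show c - t - c = -t by ring, abs_neg, abs_of_pos ht0]; linarith) (by linarith)
  have q1 : 0 < G (b₁ + t) := by
    rw [add_sub_cancel_left] at p1
    exact pos_of_mul_pos_right p1 ht0.le
  have q2 : G (c - t) < 0 := by
    rw [show c - t - c = -t by ring] at p2
    nlinarith
  obtain ⟨x, hx, hx0⟩ : (0 : ℝ) ∈ G '' Icc (b₁ + t) (c - t) :=
    intermediate_value_Icc' (by linarith)
      (hG.mono (Icc_subset_Icc (by linarith) (by linarith [hcI.2]))) ⟨q2.le, q1.le⟩
  have : c ≤ x := csInf_le hSb ⟨⟨by linarith [hx.1], by linarith [hx.2, hcI.2]⟩, hx0,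
    by linarith [hx.1]⟩
  linarith [hx.2]

end ReissnerNordstrom

/-! ### Uniqueness for the initial value problem and reflection of solutions -/

namespace ReissnerNordstrom

section LocalUniqueness

variable {M e H : ℝ} {T ψ S σ : ℝ → ℝ} {X : ℝ}

theorem IsSolAt.eventuallyEq (h : Subextremal M e) (hT : ∀ᶠ x in 𝓝 X, IsSolAt M e H T ψ x)
    (hS : ∀ᶠ x in 𝓝 X, IsSolAt M e H S σ x) (h1 : T X = S X) (h2 : ψ X = σ X) :
    (∀ᶠ x in 𝓝 X, T x = S x ∧ ψ x = σ x) := by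
  have hT0 := hT.self_of_nhds
  have hS0 := hS.self_of_nhds
  set F : ℝ × (ℝ × ℝ) → ℝ × ℝ :=
    fun z => (Real.tanh z.2.2, rhs M e H (z.2.1, z.1) z.2.2) with hF
  have hFs : ContDiffAt ℝ 1 F (X, (T X, ψ X)) := by
    refine ContDiffAt.prodMk ?_ ?_
    · exact (contDiff_tanh.of_le (by simp)).contDiffAt.comp _ (by fun_prop)
    · have := (contDiffAt_rhs (H := H) h (y := ((T X, X), ψ X)) hT0.1).of_le
        (show (1 : WithTop ℕ∞) ≤ ∞ by simp)
      exact ContDiffAt.comp (f := fun z : ℝ × (ℝ × ℝ) => ((z.2.1, z.1), z.2.2))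
        (X, (T X, ψ X)) this (by fun_prop)
  obtain ⟨K, t, ht, hK⟩ := hFs.exists_lipschitzOnWith
  have key := ODE_solution_unique_of_eventually (v := fun x y => F (x, y)) (K := K) (t₀ := X)
    (s := fun x => {y | (x, y) ∈ t}) (f := fun x => (T x, ψ x)) (g := fun x => (S x, σ x))
    (Eventually.of_forall fun x => LipschitzOnWith.of_dist_le_mul fun y hy z hz => by
      have := hK.dist_le_mul (x, y) hy (x, z) hz
      simpa [Prod.dist_eq] using this) ?_ ?_ (by simp [h1, h2])
  · filter_upwards [key] with x hx
    exact Prod.mk.inj hx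
  · have hc : ContinuousAt (fun x => (x, (T x, ψ x))) X :=
      continuousAt_id.prodMk (hT0.2.1.continuousAt.prodMk hT0.2.2.continuousAt)
    filter_upwards [hT, hc.eventually ht] with x hx hxt
    exact ⟨hx.2.1.prodMk hx.2.2, hxt⟩
  · have hc : ContinuousAt (fun x => (x, (S x, σ x))) X :=
      continuousAt_id.prodMk (hS0.2.1.continuousAt.prodMk hS0.2.2.continuousAt)
    rw [h1, h2] at ht
    filter_upwards [hS, hc.eventually ht] with x hx hxt
    exact ⟨hx.2.1.prodMk hx.2.2, hxt⟩

/-- Solutions of the mean curvature equation on an interval are determined by their initial data. -/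
theorem eqOn_of_isSolAt (h : Subextremal M e) {I : Set ℝ} (hI : IsOpen I) (hc : I.OrdConnected)
    (hT : ∀ x ∈ I, IsSolAt M e H T ψ x) (hS : ∀ x ∈ I, IsSolAt M e H S σ x) (hX : X ∈ I)
    (h1 : T X = S X) (h2 : ψ X = σ X) : ∀ x ∈ I, T x = S x ∧ ψ x = σ x := by
  have loc : ∀ x ∈ I, T x = S x → ψ x = σ x → ∀ᶠ y in 𝓝 x, T y = S y ∧ ψ y = σ y := by
    intro x hx e1 e2
    exact IsSolAt.eventuallyEq h (eventually_of_mem (hI.mem_nhds hx) hT)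
      (eventually_of_mem (hI.mem_nhds hx) hS) e1 e2
  set A := {x | ∀ᶠ y in 𝓝 x, T y = S y ∧ ψ y = σ y} with hA
  have hAo : IsOpen A := isOpen_setOfPred_eventually_nhds
  have hsub : I ⊆ A := by
    refine hc.isPreconnected.subset_of_closure_inter_subset hAo ⟨X, hX, loc X hX h1 h2⟩ ?_
    rintro x ⟨hxA, hxI⟩
    have hfr : ∃ᶠ y in 𝓝 x, T y = S y ∧ ψ y = σ y :=
      (mem_closure_iff_frequently.1 hxA).mono fun y hy => hy.self_of_nhds
    have hcl : IsClosed {p : (ℝ × ℝ) × (ℝ × ℝ) | p.1 = p.2} := isClosed_diagonal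
    have hc1 : ContinuousAt (fun y => ((T y, ψ y), (S y, σ y))) x :=
      ((hT x hxI).2.1.continuousAt.prodMk (hT x hxI).2.2.continuousAt).prodMk
        ((hS x hxI).2.1.continuousAt.prodMk (hS x hxI).2.2.continuousAt)
    have := hcl.mem_of_frequently_of_tendsto
      (hfr.mono fun y hy => show ((T y, ψ y), (S y, σ y)) ∈ _ from Prod.ext hy.1 hy.2) hc1
    exact loc x hxI (congrArg Prod.fst this) (congrArg Prod.snd this)
  exact fun x hx => (hsub hx).self_of_nhds

end LocalUniqueness

section Reflection

variable {M e H : ℝ}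

theorem omega_reflect (q : ℝ × ℝ) : omega M e (reflect q) = omega M e q := by
  have := congrFun (logCf_comp_reflect (M := M) (e := e)) q
  simp only [Function.comp] at this
  rw [omega, this, omega]

/-- The reflection exchanges `∂_U` with `∂_V`, and `ψ ↦ -ψ` exchanges their weights `1 - tanh ψ` and
`1 + tanh ψ`. -/
theorem rhs_reflect (q : ℝ × ℝ) (ψ : ℝ) : rhs M e H (reflect q) (-ψ) = rhs M e H q ψ := by
  have h1 := dV_eq_of_comp_reflect (logCf_comp_reflect (M := M) (e := e))
  have h2 := dV_eq_of_comp_reflect (rad_comp_reflect (M := M) (e := e))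
  have h3 := congrFun (rad_comp_reflect (M := M) (e := e)) q
  have hr : reflect (reflect q) = q := by simp
  simp only [Function.comp] at h3
  unfold rhs
  rw [slopeTerm_eq, slopeTerm_eq]
  unfold slopeV slopeU
  rw [omega_reflect, Real.cosh_neg, Real.tanh_neg, h1, h2, h3, h1 q, h2 q, hr]
  ring

theorem IsSolAt.reflect {T ψ : ℝ → ℝ} {X : ℝ} (hs : IsSolAt M e H T ψ (-X)) :
    IsSolAt M e H (fun x => T (-x)) (fun x => -ψ (-x)) X := by
  obtain ⟨hD, hT, hψ⟩ := hs
  refine ⟨?_, ?_, ?_⟩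
  · have := reflect_mem_penroseDiagram.2 hD
    simpa using this
  · have := hT.comp X (hasDerivAt_neg X)
    rw [mul_neg_one] at this
    rw [Real.tanh_neg]
    exact this
  · have := (hψ.comp X (hasDerivAt_neg X)).neg
    rw [mul_neg_one, neg_neg, ← rhs_reflect] at this
    convert! this using 2
    simp

/-- On the axis `∂_U log Ω² = ∂_V log Ω²` by symmetry, and `sinh 0 = 0`. For a solution orthogonal
to the axis, the momentum there is thus `r²` times the difference of rapidities. -/
theorem jacobiCoeff_axis (t : ℝ) : jacobiCoeff M e H (t, 0) 0 = 0 := by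
  have h1 := dV_eq_of_comp_reflect (logCf_comp_reflect (M := M) (e := e)) (t, 0)
  have hr : ReissnerNordstrom.reflect ((t, 0) : ℝ × ℝ) = (t, 0) := by simp
  rw [hr] at h1
  simp [jacobiCoeff, h1]

end Reflection

section Continuity

variable {M e H : ℝ} {T ψ : ℝ → ℝ} {X : ℝ}

/-- The derivative formula for this coefficient is available only for `X ≠ 0`; continuity is what
carries the comparison up to the axis. -/
theorem continuousAt_jacobiCoeff (h : Subextremal M e) (hs : IsSolAt M e H T ψ X) :
    ContinuousAt (fun x => jacobiCoeff M e H (T x, x) (ψ x)) X := by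
  obtain ⟨hD, hT, hψ⟩ := hs
  have hg : ContinuousAt (fun x => (T x, x)) X := hT.continuousAt.prodMk continuousAt_id
  have c : ∀ {f : ℝ × ℝ → ℝ}, ContDiffAt ℝ ∞ f (T X, X) → ContinuousAt (fun x => f (T x, x)) X :=
    fun hf => ContinuousAt.comp (f := fun x => (T x, x)) hf.continuousAt hg
  have c1 := c (contDiffAt_logCf h hD).dU
  have c2 := c (contDiffAt_logCf h hD).dV
  have c3 := c (contDiffAt_rad h hD)
  have c4 := c (contDiffAt_rad h hD).dU
  have c5 := c (contDiffAt_rad h hD).dV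
  have c6 := c (contDiffAt_omega h hD)
  have hC : ContinuousAt (fun x => Real.cosh (ψ x)) X :=
    Real.continuous_cosh.continuousAt.comp hψ.continuousAt
  have hS : ContinuousAt (fun x => Real.sinh (ψ x)) X :=
    Real.continuous_sinh.continuousAt.comp hψ.continuousAt
  exact ((c2.sub c1).div_const 2).add (hS.mul ((continuousAt_const.mul c6).sub
    (continuousAt_const.mul ((((hC.add hS).mul c5).add ((hC.sub hS).mul c4)).div c3
      (rad_pos hD).ne'))))

theorem continuousAt_rad_graph (h : Subextremal M e) (hs : IsSolAt M e H T ψ X) :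
    ContinuousAt (fun x => rad M e (T x, x)) X :=
  ContinuousAt.comp (f := fun x => (T x, x)) (contDiffAt_rad h hs.1).continuousAt
    (hs.2.1.continuousAt.prodMk continuousAt_id)

theorem continuousAt_omega_graph (h : Subextremal M e) (hs : IsSolAt M e H T ψ X) :
    ContinuousAt (fun x => omega M e (T x, x)) X :=
  ContinuousAt.comp (f := fun x => (T x, x)) (contDiffAt_omega h hs.1).continuousAt
    (hs.2.1.continuousAt.prodMk continuousAt_id)

end Continuity

end ReissnerNordstrom

/-! ### Strict monotonicity of the shooting map at its zeros -/

namespace ReissnerNordstrom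

variable {M e H : ℝ}

/-- Two curves are compared at the same `X`, so only displacements without `X`-component are needed.
The linear part in the Taylor remainder of `Φ` is thereby identified with the linearization of
`rhs`. -/
theorem fderiv_eq_of_eq_rhs (h : Subextremal M e) {Φ : (ℝ × ℝ) × ℝ → ℝ} (hΦ : ContDiff ℝ ∞ Φ)
    {U : Set (ℝ × ℝ)} (hU : IsOpen U) (hUD : U ⊆ penroseDiagram M e)
    (hΦU : ∀ q ∈ U, ∀ ψ, Φ (q, ψ) = rhs M e H q ψ) {q : ℝ × ℝ} (hq : q ∈ U) (ψ t s : ℝ) :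
    fderiv ℝ Φ (q, ψ) ((t, 0), s) = rhsDT M e H q ψ * t + rhsDψ M e H q ψ * s := by
  have hd : HasFDerivAt Φ (fderiv ℝ Φ (q, ψ)) (q, ψ) :=
    (hΦ.differentiable (by simp) _).hasFDerivAt
  have h1 : HasDerivAt (fun x => Φ ((x, q.2), ψ)) (fderiv ℝ Φ (q, ψ) ((1, 0), 0)) q.1 :=
    HasFDerivAt.comp_hasDerivAt (f := fun x => ((x, q.2), ψ)) q.1 hd
      (((hasDerivAt_id q.1).prodMk (hasDerivAt_const q.1 q.2)).prodMk (hasDerivAt_const q.1 ψ))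
  have h2 : HasDerivAt (fun x => Φ (q, x)) (fderiv ℝ Φ (q, ψ) (0, 1)) ψ :=
    HasFDerivAt.comp_hasDerivAt (f := fun x => (q, x)) ψ hd
      ((hasDerivAt_const ψ q).prodMk (hasDerivAt_id ψ))
  have h3 : (fun x => Φ ((x, q.2), ψ)) =ᶠ[𝓝 q.1] fun x => rhs M e H (x, q.2) ψ := by
    have hc : Continuous fun x : ℝ => (x, q.2) := by fun_prop
    filter_upwards [(hU.preimage hc).mem_nhds (x := q.1) hq] with x hx using hΦU _ hx ψ
  have h4 : (fun x => Φ (q, x)) = fun x => rhs M e H q x := funext fun x => hΦU q hq x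
  have e1 := h1.unique ((hasDerivAt_rhs_T h (hUD hq) ψ).congr_of_eventuallyEq h3)
  rw [h4] at h2
  have e2 := h2.unique (hasDerivAt_rhs_ψ q ψ)
  have : (((t, 0), s) : (ℝ × ℝ) × ℝ) = t • ((1, 0), 0) + s • (0, 1) := by
    ext <;> simp
  rw [this, map_add, map_smul, map_smul, e1, e2, smul_eq_mul, smul_eq_mul]
  ring

/-- The shooting map is strictly increasing through the solutions which are orthogonal to the
axis. -/
theorem eventually_pos_mul_of_axis (h : Subextremal M e) {Φ : (ℝ × ℝ) × ℝ → ℝ}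
    (hΦ : ContDiff ℝ ∞ Φ) {U : Set (ℝ × ℝ)} (hU : IsOpen U) (hUD : U ⊆ penroseDiagram M e)
    (hΦU : ∀ q ∈ U, ∀ ψ, Φ (q, ψ) = rhs M e H q ψ) {a : ℝ} (ha : 0 ≤ a) {T ψ : ℝ → ℝ}
    (hs : ∀ x ∈ Icc 0 a, IsSolAt M e H T ψ x) (hsU : ∀ x ∈ Icc 0 a, (T x, x) ∈ U) (hψ0 : ψ 0 = 0)
    {T₁ ψ₁ : ℝ → ℝ → ℝ} {δ L : ℝ} (hδ : 0 < δ) (hL : 0 ≤ L)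
    (hTa : ∀ k, |k| < δ → T₁ k a = T a) (hψa : ∀ k, |k| < δ → ψ₁ k a = ψ a + k)
    (hT₁ : ∀ k, |k| < δ → ∀ x ∈ Icc 0 a, HasDerivAt (T₁ k) (Real.tanh (ψ₁ k x)) x)
    (hψ₁ : ∀ k, |k| < δ → ∀ x ∈ Icc 0 a, HasDerivAt (ψ₁ k) (Φ ((T₁ k x, x), ψ₁ k x)) x)
    (hdT : ∀ k, |k| < δ → ∀ x ∈ Icc 0 a, |T₁ k x - T x| ≤ L * |k|)
    (hdψ : ∀ k, |k| < δ → ∀ x ∈ Icc 0 a, |ψ₁ k x - ψ x| ≤ L * |k|) :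
    ∀ᶠ k in 𝓝[≠] (0 : ℝ), 0 < k * ψ₁ k 0 := by
  have cψ : ContinuousOn ψ (Icc 0 a) := fun x hx => (hs x hx).2.2.continuousAt.continuousWithinAt
  have cT : ContinuousOn T (Icc 0 a) := fun x hx => (hs x hx).2.1.continuousAt.continuousWithinAt
  have cR : ContinuousOn (fun x => rad M e (T x, x)) (Icc 0 a) := fun x hx =>
    (continuousAt_rad_graph h (hs x hx)).continuousWithinAt
  have cO : ContinuousOn (fun x => omega M e (T x, x)) (Icc 0 a) := fun x hx =>
    (continuousAt_omega_graph h (hs x hx)).continuousWithinAt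
  have cJ : ContinuousOn (fun x => jacobiCoeff M e H (T x, x) (ψ x)) (Icc 0 a) := fun x hx =>
    (continuousAt_jacobiCoeff h (hs x hx)).continuousWithinAt
  have cC : ContinuousOn (fun x => Real.cosh (ψ x)) (Icc 0 a) :=
    Real.continuous_cosh.comp_continuousOn cψ
  have hrpos : ∀ x ∈ Icc 0 a, 0 < rad M e (T x, x) := fun x hx => rad_pos (hs x hx).1
  obtain ⟨R, hR⟩ := isCompact_Icc.exists_bound_of_continuousOn
    ((cT.prodMk (continuousOn_id' (Icc 0 a))).prodMk cψ)
  obtain ⟨W, hW⟩ := isCompact_Icc.exists_bound_of_continuousOn (cO.mul cC)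
  obtain ⟨P, hP⟩ := isCompact_Icc.exists_bound_of_continuousOn (cR.pow 2)
  obtain ⟨J, hJ⟩ := isCompact_Icc.exists_bound_of_continuousOn ((cR.pow 2).mul cJ)
  obtain ⟨x₀, hx₀, hmin⟩ := isCompact_Icc.exists_isMinOn (nonempty_Icc.2 ha)
    (cO.div (cC.mul (cR.pow 2)) fun x hx =>
      (mul_pos (Real.cosh_pos _) (pow_pos (hrpos x hx) 2)).ne')
  set A₀ := omega M e (T x₀, x₀) / (Real.cosh (ψ x₀) * rad M e (T x₀, x₀) ^ 2) with hA₀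
  have hA₀pos : 0 < A₀ :=
    div_pos (omega_pos _ _ _) (mul_pos (Real.cosh_pos _) (pow_pos (hrpos x₀ hx₀) 2))
  obtain ⟨C₁, hC₁, hC₁'⟩ := exists_quadratic_remainder contDiff_tanh
    (isCompact_closedBall (0 : ℝ) (R + L)) (convex_closedBall _ _)
  obtain ⟨C₂, hC₂, hC₂'⟩ := exists_quadratic_remainder hΦ
    (isCompact_closedBall (0 : (ℝ × ℝ) × ℝ) (R + L)) (convex_closedBall _ _)
  have h0I : (0 : ℝ) ∈ Icc 0 a := ⟨le_rfl, ha⟩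
  have haI : a ∈ Icc 0 a := ⟨ha, le_rfl⟩
  have hW0 : 0 ≤ W := (norm_nonneg _).trans (hW 0 h0I)
  have hP0 : 0 ≤ P := (norm_nonneg _).trans (hP 0 h0I)
  have hJ0 : 0 ≤ J := (norm_nonneg _).trans (hJ 0 h0I)
  -- The remainders are `O(k²)` by Lipschitz dependence, so after division by `k` both error terms
  -- are at most `D |k|`.
  set D := W * C₁ * L ^ 2 + P * C₂ * L ^ 2 + J * C₁ * L ^ 2 with hD
  have hD0 : 0 ≤ D := by positivity
  set ζ₀ := rad M e (T a, a) ^ 2 with hζ₀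
  have hζ₀pos : 0 < ζ₀ := pow_pos (hrpos a haI) 2
  have hlim : Tendsto (fun k : ℝ => D * |k|) (𝓝[≠] 0) (𝓝 0) := by
    have : Continuous fun k : ℝ => D * |k| := by fun_prop
    simpa using (this.tendsto 0).mono_left nhdsWithin_le_nhds
  have hlim' : Tendsto (fun k : ℝ => |k|) (𝓝[≠] 0) (𝓝 0) := by
    simpa using (continuous_abs.tendsto (0 : ℝ)).mono_left nhdsWithin_le_nhds
  have hlim'' : Tendsto (fun k : ℝ => D * |k| * a) (𝓝[≠] 0) (𝓝 0) := by
    simpa using hlim.mul_const a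
  filter_upwards [hlim.eventually (gt_mem_nhds (show 0 < A₀ * (ζ₀ / 2) by positivity)),
    hlim''.eventually (gt_mem_nhds (show 0 < ζ₀ / 2 by positivity)),
    hlim'.eventually (gt_mem_nhds hδ), hlim'.eventually (gt_mem_nhds one_pos),
    self_mem_nhdsWithin] with k hk1 hk2 hkδ hk3 hk0
  have hk0' : k ≠ 0 := hk0
  have hkpos : 0 < |k| := abs_pos.2 hk0'
  have hball : ∀ x ∈ Icc 0 a, ((T x, x), ψ x) ∈ Metric.closedBall (0 : (ℝ × ℝ) × ℝ) (R + L) ∧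
      ((T₁ k x, x), ψ₁ k x) ∈ Metric.closedBall (0 : (ℝ × ℝ) × ℝ) (R + L) ∧
      ‖(((T₁ k x, x), ψ₁ k x) - ((T x, x), ψ x) : (ℝ × ℝ) × ℝ)‖ ≤ L * |k| := by
    intro x hx
    have b1 := hR x hx
    have b2 : ‖(((T₁ k x, x), ψ₁ k x) - ((T x, x), ψ x) : (ℝ × ℝ) × ℝ)‖ ≤ L * |k| := by
      have := hdT k hkδ x hx
      have := hdψ k hkδ x hx
      simp only [Prod.mk_sub_mk, Prod.norm_def, Real.norm_eq_abs, sub_self, abs_zero]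
      refine max_le (max_le (by assumption) (by positivity)) (by assumption)
    have b3 : L * |k| ≤ L := mul_le_of_le_one_right hL hk3.le
    refine ⟨?_, ?_, b2⟩
    · rw [mem_closedBall_zero_iff]
      linarith
    · rw [mem_closedBall_zero_iff]
      have := norm_add_le ((T x, x), ψ x) (((T₁ k x, x), ψ₁ k x) - ((T x, x), ψ x))
      rw [add_sub_cancel] at this
      linarith
  set E₁ : ℝ → ℝ := fun x => Real.tanh (ψ₁ k x) - Real.tanh (ψ x) -
    (1 - Real.tanh (ψ x) ^ 2) * (ψ₁ k x - ψ x) with hE₁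
  set E₂ : ℝ → ℝ := fun x => Φ ((T₁ k x, x), ψ₁ k x) - rhs M e H (T x, x) (ψ x) -
    (rhsDT M e H (T x, x) (ψ x) * (T₁ k x - T x) +
      rhsDψ M e H (T x, x) (ψ x) * (ψ₁ k x - ψ x)) with hE₂
  have bE₁ : ∀ x ∈ Icc 0 a, |E₁ x| ≤ C₁ * (L * |k|) ^ 2 := by
    intro x hx
    obtain ⟨b1, b2, -⟩ := hball x hx
    have m : ∀ y : (ℝ × ℝ) × ℝ, y ∈ Metric.closedBall (0 : (ℝ × ℝ) × ℝ) (R + L) →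
        y.2 ∈ Metric.closedBall (0 : ℝ) (R + L) := fun y hy => by
      rw [mem_closedBall_zero_iff] at hy ⊢
      exact (norm_snd_le y).trans hy
    have := hC₁' _ (m _ b1) _ (m _ b2)
    dsimp only at this
    rw [(hasDerivAt_tanh (ψ x)).hasFDerivAt.fderiv] at this
    simp only [ContinuousLinearMap.toSpanSingleton_apply, smul_eq_mul, Real.norm_eq_abs] at this
    rw [mul_comm (ψ₁ k x - ψ x)] at this
    refine this.trans (mul_le_mul_of_nonneg_left ?_ hC₁)
    exact pow_le_pow_left₀ (abs_nonneg _) (hdψ k hkδ x hx) 2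
  have bE₂ : ∀ x ∈ Icc 0 a, |E₂ x| ≤ C₂ * (L * |k|) ^ 2 := by
    intro x hx
    obtain ⟨b1, b2, b3⟩ := hball x hx
    have := hC₂' _ b1 _ b2
    have hsub : (((T₁ k x, x), ψ₁ k x) - ((T x, x), ψ x) : (ℝ × ℝ) × ℝ) =
        ((T₁ k x - T x, 0), ψ₁ k x - ψ x) := by simp
    rw [hsub, fderiv_eq_of_eq_rhs h hΦ hU hUD hΦU (hsU x hx), hΦU _ (hsU x hx), ← hsub] at this
    refine this.trans (mul_le_mul_of_nonneg_left ?_ hC₂)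
    exact pow_le_pow_left₀ (norm_nonneg _) b3 2
  have hη : ∀ x ∈ Icc 0 a, HasDerivAt (jacobiField M e T ψ (T₁ k)) _ x := fun x hx =>
    hasDerivAt_jacobiField (H := H) h (hs x hx) (hT₁ k hkδ x hx)
  have hζ : ∀ x ∈ Ioo 0 a, HasDerivAt (jacobiMomentum M e H T ψ (T₁ k) (ψ₁ k)) _ x := fun x hx =>
    hasDerivAt_jacobiMomentum h (hs x ⟨hx.1.le, hx.2.le⟩) hx.1.ne'
      (hT₁ k hkδ x ⟨hx.1.le, hx.2.le⟩) (hψ₁ k hkδ x ⟨hx.1.le, hx.2.le⟩)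
  have hmaps : MapsTo (fun s => a - s) (Icc 0 a) (Icc 0 a) := fun s hs =>
    ⟨by linarith [hs.2], by linarith [hs.1]⟩
  have hmaps' : ∀ s ∈ Ioo 0 a, a - s ∈ Ioo 0 a := fun s hs =>
    ⟨by linarith [hs.2], by linarith [hs.1]⟩
  have cη : ContinuousOn (jacobiField M e T ψ (T₁ k)) (Icc 0 a) := fun x hx =>
    (hη x hx).continuousAt.continuousWithinAt
  have cψ₁ : ContinuousOn (ψ₁ k) (Icc 0 a) := fun x hx =>
    (hψ₁ k hkδ x hx).continuousAt.continuousWithinAt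
  have cT₁ : ContinuousOn (T₁ k) (Icc 0 a) := fun x hx =>
    (hT₁ k hkδ x hx).continuousAt.continuousWithinAt
  have cζ : ContinuousOn (jacobiMomentum M e H T ψ (T₁ k) (ψ₁ k)) (Icc 0 a) :=
    (cR.pow 2).mul ((cψ₁.sub cψ).add (cJ.mul (cT₁.sub cT)))
  -- The interval is run backwards, `x = a - s`, and everything is divided by `k`. Reversal changes
  -- the sign of the derivatives, and replacing the field by its negative restores nonnegative
  -- coefficients. Initially `η = 0`, since the curves meet at `a`, and `ζ = r²`.
  have key := pos_of_cone_system
    (η := fun s => -(jacobiField M e T ψ (T₁ k) (a - s) / k))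
    (ζ := fun s => jacobiMomentum M e H T ψ (T₁ k) (ψ₁ k) (a - s) / k)
    (A := fun s => omega M e (T (a - s), a - s) /
      (Real.cosh (ψ (a - s)) * rad M e (T (a - s), a - s) ^ 2))
    (B := fun s => rad M e (T (a - s), a - s) ^ 2 *
      jacobiPotential M e H (T (a - s), a - s) (ψ (a - s)) /
        (omega M e (T (a - s), a - s) * Real.cosh (ψ (a - s))))
    (e₁ := fun s => omega M e (T (a - s), a - s) * Real.cosh (ψ (a - s)) * E₁ (a - s) / k)
    (e₂ := fun s => -(rad M e (T (a - s), a - s) ^ 2 *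
      (E₂ (a - s) + jacobiCoeff M e H (T (a - s), a - s) (ψ (a - s)) * E₁ (a - s)) / k))
    (a := a) (A₀ := A₀) (ζ₀ := ζ₀) (ε := D * |k|) ha hA₀pos hζ₀pos
    ((cη.comp (by fun_prop) hmaps).div_const k).neg ((cζ.comp (by fun_prop) hmaps).div_const k)
    ?_ ?_ ?_ ?_ ?_ ?_ ?_ ?_ hk1.le hk2 (by positivity)
  · simp only [sub_self, jacobiMomentum, hψ0, jacobiCoeff_axis, zero_mul, add_zero, sub_zero] at key
    have h1 := pow_pos (hrpos 0 h0I) 2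
    have h2 : 0 < k ^ 2 := by positivity
    have h3 := mul_pos key h2
    rw [show rad M e (T 0, 0) ^ 2 * ψ₁ k 0 / k * k ^ 2 =
      rad M e (T 0, 0) ^ 2 * (k * ψ₁ k 0) by field_simp] at h3
    exact pos_of_mul_pos_right h3 h1.le
  · simp [jacobiField, hTa k hkδ]
  · simp only [sub_zero, jacobiMomentum, hTa k hkδ, hψa k hkδ, sub_self, mul_zero, add_zero,
      add_sub_cancel_left]
    field_simp
    rfl
  · intro s hs'
    have hx := hmaps' s hs'
    convert! (((hη _ ⟨hx.1.le, hx.2.le⟩).comp_const_sub a s).div_const k).neg using 1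
    ring
  · intro s hs'
    have hx := hmaps' s hs'
    convert! ((hζ _ hx).comp_const_sub a s).div_const k using 1
    ring
  · intro s hs'
    have hx := hmaps' s hs'
    exact hmin ⟨hx.1.le, hx.2.le⟩
  · intro s hs'
    have hx := hmaps' s hs'
    have hx' : a - s ∈ Icc 0 a := ⟨hx.1.le, hx.2.le⟩
    have := jacobiPotential_nonneg (H := H) h (hs _ hx').1 (ψ (a - s))
    have := omega_pos M e (T (a - s), a - s)
    have := Real.cosh_pos (ψ (a - s))
    positivity
  · intro s hs'
    have hx := hmaps' s hs'
    have hx' : a - s ∈ Icc 0 a := ⟨hx.1.le, hx.2.le⟩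
    have b1 := hW _ hx'
    have b2 := bE₁ _ hx'
    rw [Real.norm_eq_abs, Pi.mul_apply] at b1
    rw [abs_div, abs_mul, div_le_iff₀ hkpos]
    calc _ ≤ W * (C₁ * (L * |k|) ^ 2) := mul_le_mul b1 b2 (abs_nonneg _) hW0
      _ = W * C₁ * L ^ 2 * |k| * |k| := by ring
      _ ≤ D * |k| * |k| := by
        gcongr
        rw [hD]
        have : 0 ≤ P * C₂ * L ^ 2 := by positivity
        have : 0 ≤ J * C₁ * L ^ 2 := by positivity
        linarith
  · intro s hs'
    have hx := hmaps' s hs'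
    have hx' : a - s ∈ Icc 0 a := ⟨hx.1.le, hx.2.le⟩
    have b1 := hP _ hx'
    have b2 := hJ _ hx'
    have b3 := bE₁ _ hx'
    have b4 := bE₂ _ hx'
    rw [Real.norm_eq_abs, Pi.pow_apply] at b1
    rw [Real.norm_eq_abs, Pi.mul_apply, Pi.pow_apply] at b2
    rw [abs_neg, abs_div, div_le_iff₀ hkpos, mul_add, ← mul_assoc]
    refine (abs_add_le _ _).trans ?_
    rw [abs_mul, abs_mul]
    calc _ ≤ P * (C₂ * (L * |k|) ^ 2) + J * (C₁ * (L * |k|) ^ 2) :=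
          add_le_add (mul_le_mul b1 b4 (abs_nonneg _) hP0) (mul_le_mul b2 b3 (abs_nonneg _) hJ0)
      _ = (P * C₂ * L ^ 2 + J * C₁ * L ^ 2) * |k| * |k| := by ring
      _ ≤ D * |k| * |k| := by
        gcongr
        rw [hD]
        have : 0 ≤ W * C₁ * L ^ 2 := by positivity
        linarith

end ReissnerNordstrom

/-! ### Existence and uniqueness by shooting -/

namespace ReissnerNordstrom

variable {M e H T₀ a : ℝ}

/-- The family of solutions of the cut off system through `(T₀, a)`, parametrized by the
rapidity at `a`. -/
theorem exists_shooting_family {Φ : (ℝ × ℝ) × ℝ → ℝ} (hΦ : ContDiff ℝ ∞ Φ) {C : ℝ}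
    (hC : ∀ z, |Φ z| ≤ C) (T₀ : ℝ) (ha : a ∈ Icc (-1 : ℝ) 1) {B : ℝ} (hB : 0 ≤ B) :
    ∃ τ β : ℝ → ℝ → ℝ, (∀ b, |b| ≤ B → τ b a = T₀ ∧ β b a = b ∧ ∀ t ∈ Ioo (-1 : ℝ) 1,
        HasDerivAt (τ b) (Real.tanh (β b t)) t ∧ HasDerivAt (β b) (Φ ((τ b t, t), β b t)) t) ∧
      ∃ L : ℝ, 0 ≤ L ∧ ∀ b b', |b| ≤ B → |b'| ≤ B → ∀ t ∈ Ioo (-1 : ℝ) 1,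
        |τ b t - τ b' t| ≤ L * |b - b'| ∧ |β b t - β b' t| ≤ L * |b - b'| := by
  obtain ⟨α, hα, L, hL⟩ := exists_flow_graphField hΦ hC (T₀, 0) ha hB
  have hmem : ∀ b, |b| ≤ B → (T₀, b) ∈ Metric.closedBall ((T₀, 0) : ℝ × ℝ) B := fun b hb => by
    simpa [Prod.dist_eq, Real.dist_eq, hB] using hb
  refine ⟨fun b t => (α (T₀, b) t).1, fun b t => (α (T₀, b) t).2, fun b hb => ?_, L, L.2, ?_⟩
  · obtain ⟨h1, h2⟩ := hα _ (hmem b hb)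
    refine ⟨congrArg Prod.fst h1, congrArg Prod.snd h1, fun t ht => ?_⟩
    have hd := (h2 t ⟨ht.1.le, ht.2.le⟩).hasDerivAt (Icc_mem_nhds ht.1 ht.2)
    exact ⟨hd.fst, hd.snd⟩
  · intro b b' hb hb' t ht
    have := (hL t ⟨ht.1.le, ht.2.le⟩).dist_le_mul _ (hmem b hb) _ (hmem b' hb')
    rw [Prod.dist_eq, Prod.dist_eq, dist_self, max_eq_right dist_nonneg] at this
    exact ⟨(le_max_left _ _).trans this, (le_max_right _ _).trans this⟩

theorem diamond_subset_penroseDiagram (h : Subextremal M e) (ha : 0 ≤ a)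
    (hp : (T₀, a) ∈ penroseDiagram M e) : diamond T₀ a ⊆ penroseDiagram M e := by
  rintro ⟨t, x⟩ hq
  refine diamond_subset h hp ?_
  rw [abs_of_nonneg ha]
  exact hq

theorem mem_diamond_of_tanh {T ψ : ℝ → ℝ}
    (hT : ∀ x ∈ Icc 0 a, HasDerivAt T (Real.tanh (ψ x)) x) (hTa : T a = T₀) {x : ℝ}
    (hx : x ∈ Icc 0 a) : (T x, x) ∈ diamond T₀ a :=
  mem_diamond_of_hasDerivWithinAt (fun x hx => (hT x hx).hasDerivWithinAt)
    (fun _ _ => (Real.abs_tanh_lt_one _).le) hTa hx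

/-- Shooting from `(T₀, a)` in the cut off system: the intermediate value theorem selects a rapidity
at `a` for which the rapidity at the axis vanishes. Confinement to the diamond makes the cutoff
invisible over `[0, a]`, and openness leaves a margin `ε` on both sides. -/
theorem exists_isSolAt (h : Subextremal M e) (H : ℝ) (ha : 0 ≤ a)
    (hp : (T₀, a) ∈ penroseDiagram M e) :
    ∃ ε > 0, ∃ T ψ : ℝ → ℝ, (∀ x ∈ Ioo (-ε) (a + ε), IsSolAt M e H T ψ x) ∧ T a = T₀ ∧
      ψ 0 = 0 := by
  have ha1 : a < 1 := (abs_lt.1 hp.1).2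
  obtain ⟨Φ, hΦ, ⟨C, hC⟩, U, hU, hKU, hUD, hΦU⟩ := exists_cutoff_rhs h H
    (isCompact_diamond (T₀ := T₀) (a := a)) (diamond_subset_penroseDiagram h ha hp)
  have hC0 : 0 ≤ C := (abs_nonneg _).trans (hC 0)
  obtain ⟨τ, β, hτβ, L, hL, hlip⟩ := exists_shooting_family hΦ hC T₀
    (a := a) ⟨by linarith, ha1.le⟩ hC0
  have hsub : Icc 0 a ⊆ Ioo (-1 : ℝ) 1 := fun x hx => ⟨by linarith [hx.1], by linarith [hx.2]⟩
  have h0I : (0 : ℝ) ∈ Icc 0 a := ⟨le_rfl, ha⟩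
  have hcont : ContinuousOn (fun b => β b 0) (Icc (-C) C) := by
    have : LipschitzOnWith ⟨L, hL⟩ (fun b => β b 0) (Icc (-C) C) :=
      LipschitzOnWith.of_dist_le_mul fun b hb b' hb' =>
        (hlip b b' (abs_le.2 hb) (abs_le.2 hb') 0 (hsub h0I)).2
    exact this.continuousOn
  -- Since `|Φ| ≤ C` and `a < 1`, the rapidity changes by at most `C` on the way to the axis; so `β
  -- b 0` has opposite weak signs at `b = -C` and `b = C`.
  have hdist : ∀ b, |b| ≤ C → |β b 0 - b| ≤ C := by
    intro b hb
    obtain ⟨-, h2, h3⟩ := hτβ b hb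
    have := (convex_Icc 0 a).norm_image_sub_le_of_norm_hasDerivWithin_le
      (fun x hx => (h3 x (hsub hx)).2.hasDerivWithinAt)
      (fun x _ => by rw [Real.norm_eq_abs]; exact hC _) (right_mem_Icc.2 ha) h0I
    rw [h2, Real.norm_eq_abs, Real.norm_eq_abs, zero_sub, abs_neg, abs_of_nonneg ha] at this
    exact this.trans (mul_le_of_le_one_right hC0 ha1.le)
  obtain ⟨b, hb, hb0⟩ : (0 : ℝ) ∈ (fun b => β b 0) '' Icc (-C) C := by
    refine intermediate_value_Icc (by linarith) hcont ⟨?_, ?_⟩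
    · have := (abs_le.1 (hdist (-C) (by rw [abs_neg, abs_of_nonneg hC0]))).2
      linarith
    · have := (abs_le.1 (hdist C (by rw [abs_of_nonneg hC0]))).1
      linarith
  obtain ⟨h1, h2, h3⟩ := hτβ b (abs_le.2 hb)
  have hV : IsOpen (Ioo (-1 : ℝ) 1 ∩ (fun t => (τ b t, t)) ⁻¹' U) := by
    refine ContinuousOn.isOpen_inter_preimage ?_ isOpen_Ioo hU
    exact fun t ht => ((h3 t ht).1.continuousAt.prodMk continuousAt_id).continuousWithinAt
  have hIV : Icc 0 a ⊆ Ioo (-1 : ℝ) 1 ∩ (fun t => (τ b t, t)) ⁻¹' U := fun x hx =>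
    ⟨hsub hx, hKU (mem_diamond_of_tanh (fun x hx => (h3 x (hsub hx)).1) h1 hx)⟩
  obtain ⟨ε, hε, hεV⟩ := isCompact_Icc.exists_thickening_subset_open hV hIV
  refine ⟨ε, hε, τ b, β b, fun x hx => ?_, h1, hb0⟩
  obtain ⟨hx1, hxU⟩ : x ∈ Ioo (-1 : ℝ) 1 ∩ (fun t => (τ b t, t)) ⁻¹' U := by
    -- The witness is the projection of `x` onto `[0, a]`.
    refine hεV (Metric.mem_thickening_iff.2 ⟨max 0 (min x a), ⟨le_max_left _ _, ?_⟩, ?_⟩)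
    · exact max_le ha (min_le_right _ _)
    · rw [Real.dist_eq, abs_lt]
      obtain ⟨hx1, hx2⟩ := hx
      rcases le_total x 0 with hx0 | hx0
      · rw [max_eq_left ((min_le_left _ _).trans hx0)]
        constructor <;> linarith
      · rw [max_eq_right (le_min hx0 ha)]
        rcases le_total x a with hxa | hxa
        · rw [min_eq_left hxa]
          constructor <;> linarith
        · rw [min_eq_right hxa]
          constructor <;> linarith
  obtain ⟨d1, d2⟩ := h3 x hx1
  rw [hΦU _ hxU] at d2
  exact ⟨hUD hxU, d1, d2⟩

/-- Both solutions are members of one shooting family, and both rapidities at `a` are zeros of the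
same shooting map. Each zero between them gives a genuine solution orthogonal to the axis, so the
map increases strictly through it, and there cannot be two. -/
theorem rapidity_unique (h : Subextremal M e) (ha : 0 ≤ a) (hp : (T₀, a) ∈ penroseDiagram M e)
    {T ψ S σ : ℝ → ℝ} (hT : ∀ x ∈ Icc 0 a, IsSolAt M e H T ψ x)
    (hS : ∀ x ∈ Icc 0 a, IsSolAt M e H S σ x) (hTa : T a = T₀) (hSa : S a = T₀) (hψ : ψ 0 = 0)
    (hσ : σ 0 = 0) : ψ a = σ a := by
  by_contra hne
  wlog hlt : ψ a < σ a generalizing T ψ S σ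
  · exact this hS hT hSa hTa hσ hψ (Ne.symm hne) (lt_of_le_of_ne (not_lt.1 hlt) (Ne.symm hne))
  have ha1 : a < 1 := (abs_lt.1 hp.1).2
  obtain ⟨Φ, hΦ, ⟨C, hC⟩, U, hU, hKU, hUD, hΦU⟩ := exists_cutoff_rhs h H
    (isCompact_diamond (T₀ := T₀) (a := a)) (diamond_subset_penroseDiagram h ha hp)
  set B := max |ψ a| |σ a| with hB
  have hB0 : 0 ≤ B := (abs_nonneg _).trans (le_max_left _ _)
  have hIcc : ∀ b ∈ Icc (ψ a) (σ a), |b| ≤ B := fun b hb => abs_le_max_abs_abs hb.1 hb.2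
  -- The radius `B + 1` leaves room for perturbations `b + k` with `|k| < 1`.
  obtain ⟨τ, β, hτβ, L, hL, hlip⟩ := exists_shooting_family hΦ hC T₀
    (a := a) ⟨by linarith, ha1.le⟩ (by linarith : 0 ≤ B + 1)
  have hsub : Icc 0 a ⊆ Ioo (-1 : ℝ) 1 := fun x hx => ⟨by linarith [hx.1], by linarith [hx.2]⟩
  have h0I : (0 : ℝ) ∈ Icc 0 a := ⟨le_rfl, ha⟩
  -- A solution of the original equation stays in the region where `Φ` equals `rhs`, so it agrees on
  -- `[0, a]` with the member of the family having its rapidity at `a`.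
  have flow : ∀ {T ψ : ℝ → ℝ}, (∀ x ∈ Icc 0 a, IsSolAt M e H T ψ x) → T a = T₀ → |ψ a| ≤ B →
      β (ψ a) 0 = ψ 0 := by
    intro T ψ hT hTa hψa
    obtain ⟨h1, h2, h3⟩ := hτβ (ψ a) (by linarith)
    have hd : ∀ x ∈ Icc 0 a, HasDerivAt (fun x => (τ (ψ a) x, β (ψ a) x))
        (graphField Φ x (τ (ψ a) x, β (ψ a) x)) x := fun x hx =>
      (h3 x (hsub hx)).1.prodMk (h3 x (hsub hx)).2
    have hd' : ∀ x ∈ Icc 0 a, HasDerivAt (fun x => (T x, ψ x))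
        (graphField Φ x (T x, ψ x)) x := by
      intro x hx
      have hx' : (T x, x) ∈ U := hKU (mem_diamond_of_tanh (fun x hx => (hT x hx).2.1) hTa hx)
      simp only [graphField, hΦU _ hx']
      exact (hT x hx).2.1.prodMk (hT x hx).2.2
    have hc : ContinuousOn (fun x => (τ (ψ a) x, β (ψ a) x)) (Icc 0 a) := fun x hx =>
      (hd x hx).continuousAt.continuousWithinAt
    have hc' : ContinuousOn (fun x => (T x, ψ x)) (Icc 0 a) := fun x hx =>
      (hd' x hx).continuousAt.continuousWithinAt
    obtain ⟨R, hR⟩ := isCompact_Icc.exists_bound_of_continuousOn hc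
    obtain ⟨R', hR'⟩ := isCompact_Icc.exists_bound_of_continuousOn hc'
    obtain ⟨K, hK⟩ := exists_lipschitzOnWith_graphField hΦ 0 (max R R')
    have hI : ∀ t ∈ Ioc 0 a, t ∈ Icc 0 a := fun t ht => ⟨ht.1.le, ht.2⟩
    have := ODE_solution_unique_of_mem_Icc_left (v := graphField Φ) (K := K)
      (s := fun _ => Metric.closedBall 0 (max R R'))
      (fun t ht => hK t ⟨by linarith [ht.1], by linarith [ht.2]⟩) hc
      (fun t ht => (hd t (hI t ht)).hasDerivWithinAt)
      (fun t ht => by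
        rw [mem_closedBall_zero_iff]; exact (hR t (hI t ht)).trans (le_max_left _ _))
      hc' (fun t ht => (hd' t (hI t ht)).hasDerivWithinAt)
      (fun t ht => by
        rw [mem_closedBall_zero_iff]; exact (hR' t (hI t ht)).trans (le_max_right _ _))
      (by rw [h1, h2, hTa]) h0I
    exact congrArg Prod.snd this
  refine zero_unique_of_eventually (G := fun b => β b 0) (b₁ := ψ a) (b₂ := σ a) ?_
    ((flow hT hTa (le_max_left _ _)).trans hψ) ((flow hS hSa (le_max_right _ _)).trans hσ) ?_ hlt
  · have : LipschitzOnWith ⟨L, hL⟩ (fun b => β b 0) (Icc (ψ a) (σ a)) :=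
      LipschitzOnWith.of_dist_le_mul fun b hb b' hb' =>
        (hlip b b' (by linarith [hIcc b hb]) (by linarith [hIcc b' hb']) 0 (hsub h0I)).2
    exact this.continuousOn
  · intro b hb hb0
    have hbB := hIcc b hb
    have hbk : ∀ k, |k| < 1 → |b + k| ≤ B + 1 := fun k hk => by
      linarith [abs_add_le b k]
    obtain ⟨h1, h2, h3⟩ := hτβ b (by linarith)
    have hbU : ∀ x ∈ Icc 0 a, (τ b x, x) ∈ U := fun x hx =>
      hKU (mem_diamond_of_tanh (fun x hx => (h3 x (hsub hx)).1) h1 hx)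
    have hsol : ∀ x ∈ Icc 0 a, IsSolAt M e H (τ b) (β b) x := by
      intro x hx
      have := (h3 x (hsub hx)).2
      rw [hΦU _ (hbU x hx)] at this
      exact ⟨hUD (hbU x hx), (h3 x (hsub hx)).1, this⟩
    have hdiff : ∀ k, |k| < 1 → ∀ x ∈ Icc 0 a, |τ (b + k) x - τ b x| ≤ L * |k| ∧
        |β (b + k) x - β b x| ≤ L * |k| := fun k hk x hx => by
      simpa using hlip (b + k) b (hbk k hk) (by linarith) x (hsub hx)
    exact eventually_pos_mul_of_axis h hΦ hU hUD hΦU ha hsol hbU hb0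
      (T₁ := fun k => τ (b + k)) (ψ₁ := fun k => β (b + k)) one_pos hL
      (fun k hk => by rw [(hτβ _ (hbk k hk)).1, h1])
      (fun k hk => by rw [(hτβ _ (hbk k hk)).2.1, h2])
      (fun k hk x hx => ((hτβ _ (hbk k hk)).2.2 x (hsub hx)).1)
      (fun k hk x hx => ((hτβ _ (hbk k hk)).2.2 x (hsub hx)).2)
      (fun k hk x hx => (hdiff k hk x hx).1) (fun k hk x hx => (hdiff k hk x hx).2)

end ReissnerNordstrom

/-! ### Symmetrization, the maximal hypersurface and inextendibility -/

namespace ReissnerNordstrom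

variable {M e H T₀ X₀ : ℝ} {J J' I : Set ℝ} {T S S' ψ σ : ℝ → ℝ} {X : ℝ}

theorem IsSolAt.congr (hs : IsSolAt M e H T ψ X) (h1 : S =ᶠ[𝓝 X] T) (h2 : σ =ᶠ[𝓝 X] ψ) :
    IsSolAt M e H S σ X := by
  obtain ⟨hD, hT, hψ⟩ := hs
  have e1 : S X = T X := h1.self_of_nhds
  have e2 : σ X = ψ X := h2.self_of_nhds
  refine ⟨by rwa [e1], ?_, ?_⟩
  · rw [e2]
    exact hT.congr_of_eventuallyEq h1
  · rw [e1, e2]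
    exact hψ.congr_of_eventuallyEq h2

theorem deriv_zero_of_even (h : ∀ᶠ x in 𝓝 (0 : ℝ), S (-x) = S x)
    (hd : DifferentiableAt ℝ S 0) : deriv S 0 = 0 := by
  have h1 := hd.hasDerivAt
  have h2 : HasDerivAt (fun x => S (-x)) (deriv S 0 * -1) 0 :=
    HasDerivAt.comp (h₂ := S) (h := fun x => -x) 0 (by simpa using h1) (hasDerivAt_neg 0)
  have := h1.unique (h2.congr_of_eventuallyEq (h.mono fun x hx => hx.symm))
  linarith

/-- A solution which is orthogonal to the axis extends to a symmetric one. -/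
theorem exists_symmetrization (h : Subextremal M e) (hJ : IsOpen J) (hc : J.OrdConnected)
    (h0 : (0 : ℝ) ∈ J) (hS : ∀ x ∈ J, IsSolAt M e H S σ x) (hσ : σ 0 = 0) :
    ∃ S' : ℝ → ℝ, IsTSSCMC M e H (J ∪ {x | -x ∈ J}) S' ∧ EqOn S' S J := by
  classical
  have hNo : IsOpen {x : ℝ | -x ∈ J} := hJ.preimage continuous_neg
  have hNc : {x : ℝ | -x ∈ J}.OrdConnected := by
    refine ⟨fun x hx y hy z hz => ?_⟩
    exact hc.out hy hx ⟨neg_le_neg hz.2, neg_le_neg hz.1⟩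
  have h0N : (0 : ℝ) ∈ {x : ℝ | -x ∈ J} := by simpa using h0
  -- The solution and its mirror image have the same data at `0` precisely because `σ 0 = 0`, so
  -- they agree on the overlap and can be glued.
  have heq : ∀ x ∈ J ∩ {x | -x ∈ J}, S x = S (-x) ∧ σ x = -σ (-x) :=
    eqOn_of_isSolAt h (hJ.inter hNo) (hc.inter hNc) (fun x hx => hS x hx.1)
      (fun x hx => IsSolAt.reflect (hS (-x) hx.2)) ⟨h0, h0N⟩ (by simp) (by simp [hσ])
  set S' : ℝ → ℝ := fun x => if x ∈ J then S x else S (-x) with hS'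
  set σ' : ℝ → ℝ := fun x => if x ∈ J then σ x else -σ (-x) with hσ'
  have e1 : ∀ x ∈ J, S' x = S x ∧ σ' x = σ x := fun x hx => by simp [hS', hσ', hx]
  have e2 : ∀ x, -x ∈ J → S' x = S (-x) ∧ σ' x = -σ (-x) := by
    intro x hx
    by_cases hxJ : x ∈ J
    · rw [(e1 x hxJ).1, (e1 x hxJ).2]
      exact heq x ⟨hxJ, hx⟩
    · simp [hS', hσ', hxJ]
  refine ⟨S', ⟨isSSCMC_of_isSolAt (ψ := σ') h (hJ.union hNo) ?_ ⟨0, Or.inl h0⟩ ?_, ?_⟩,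
    fun x hx => (e1 x hx).1⟩
  · exact (IsPreconnected.union 0 h0 h0N hc.isPreconnected hNc.isPreconnected).ordConnected
  · rintro x (hx | hx)
    · exact (hS x hx).congr (eventually_of_mem (hJ.mem_nhds hx) fun y hy => (e1 y hy).1)
        (eventually_of_mem (hJ.mem_nhds hx) fun y hy => (e1 y hy).2)
    · exact (IsSolAt.reflect (hS (-x) hx)).congr
        (eventually_of_mem (hNo.mem_nhds hx) fun y hy => (e2 y hy).1)
        (eventually_of_mem (hNo.mem_nhds hx) fun y hy => (e2 y hy).2)
  · rintro x (hx | hx)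
    · have hx' : - -x ∈ J := by rwa [neg_neg]
      exact ⟨Or.inr hx', by rw [(e1 x hx).1, (e2 (-x) hx').1, neg_neg]⟩
    · exact ⟨Or.inl hx, by rw [(e2 x hx).1, (e1 (-x) hx).1]⟩

/-- A symmetric hypersurface of constant mean curvature through the points `(T₀, ± X₀)`. -/
structure IsTSSCMCThrough (M e H T₀ X₀ : ℝ) (J : Set ℝ) (S : ℝ → ℝ) : Prop where
  isTSSCMC : IsTSSCMC M e H J S
  mem : X₀ ∈ J
  neg_mem : -X₀ ∈ J
  apply_eq : S X₀ = T₀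
  apply_neg_eq : S (-X₀) = T₀

theorem IsTSSCMCThrough.abs (hS : IsTSSCMCThrough M e H T₀ X₀ J S) :
    IsTSSCMCThrough M e H T₀ |X₀| J S := by
  obtain ⟨h, h1, h2, h3, h4⟩ := hS
  rcases abs_choice X₀ with ha | ha <;> rw [ha]
  · exact ⟨h, h1, h2, h3, h4⟩
  · exact ⟨h, h2, by rwa [neg_neg], h4, by rwa [neg_neg]⟩

theorem IsTSSCMCThrough.of_abs (hS : IsTSSCMCThrough M e H T₀ |X₀| J S) :
    IsTSSCMCThrough M e H T₀ X₀ J S := by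
  obtain ⟨h, h1, h2, h3, h4⟩ := hS
  rcases abs_choice X₀ with ha | ha <;> rw [ha] at h1 h2 h3 h4
  · exact ⟨h, h1, h2, h3, h4⟩
  · rw [neg_neg] at h2 h4
    exact ⟨h, h2, h1, h4, h3⟩

theorem IsTSSCMCThrough.Icc_subset (hS : IsTSSCMCThrough M e H T₀ X₀ J S) : Icc 0 |X₀| ⊆ J :=
  (Icc_subset_Icc_left (neg_nonpos.2 (abs_nonneg _))).trans
    (hS.isTSSCMC.1.2.1.out hS.abs.neg_mem hS.abs.mem)

theorem IsTSSCMCThrough.zero_mem (hS : IsTSSCMCThrough M e H T₀ X₀ J S) : (0 : ℝ) ∈ J :=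
  hS.Icc_subset ⟨le_rfl, abs_nonneg _⟩

theorem IsTSSCMC.deriv_zero (hS : IsTSSCMC M e H J S) (h0 : (0 : ℝ) ∈ J) : deriv S 0 = 0 :=
  deriv_zero_of_even (eventually_of_mem (hS.1.1.mem_nhds h0) fun x hx => (hS.2 x hx).2)
    (((hS.1.2.2.2.1 0 h0).contDiffAt (hS.1.1.mem_nhds h0)).differentiableAt (by simp))

/-- Evenness makes both rapidities vanish at the axis, so `rapidity_unique` yields equal rapidities
at `|X₀|`. From there uniqueness for the initial value problem spreads over the whole intersection
of the domains, also beyond the boundary points. -/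
theorem IsTSSCMCThrough.eqOn (h : Subextremal M e) (hS : IsTSSCMCThrough M e H T₀ X₀ J S)
    (hS' : IsTSSCMCThrough M e H T₀ X₀ J' S') : EqOn S S' (J ∩ J') := by
  have d1 := hS.isTSSCMC.deriv_zero hS.zero_mem
  have d2 := hS'.isTSSCMC.deriv_zero hS'.zero_mem
  have s1 := fun x hx => IsSSCMC.isSolAt h hS.isTSSCMC.1 (X := x) hx
  have s2 := fun x hx => IsSSCMC.isSolAt h hS'.isTSSCMC.1 (X := x) hx
  have hp : (T₀, |X₀|) ∈ penroseDiagram M e := by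
    have := (s1 _ hS.abs.mem).1
    rwa [hS.abs.apply_eq] at this
  have hr := rapidity_unique h (abs_nonneg X₀) hp (fun x hx => s1 x (hS.Icc_subset hx))
    (fun x hx => s2 x (hS'.Icc_subset hx)) hS.abs.apply_eq hS'.abs.apply_eq
    (by simp [d1]) (by simp [d2])
  intro x hx
  exact (eqOn_of_isSolAt h (hS.isTSSCMC.1.1.inter hS'.isTSSCMC.1.1)
    (hS.isTSSCMC.1.2.1.inter hS'.isTSSCMC.1.2.1) (fun x hx => s1 x hx.1) (fun x hx => s2 x hx.2)
    ⟨hS.abs.mem, hS'.abs.mem⟩ (hS.abs.apply_eq.trans hS'.abs.apply_eq.symm) hr x hx).1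

theorem exists_isTSSCMCThrough (h : Subextremal M e) (H : ℝ)
    (hp : (T₀, X₀) ∈ penroseDiagram M e) :
    ∃ J S, IsTSSCMCThrough M e H T₀ X₀ J S := by
  have hp' : (T₀, |X₀|) ∈ penroseDiagram M e := by
    rcases abs_choice X₀ with ha | ha <;> rw [ha]
    · exact hp
    · simpa using reflect_mem_penroseDiagram.2 hp
  have ha := abs_nonneg X₀
  obtain ⟨ε, hε, T, ψ, hs, hT, hψ⟩ := exists_isSolAt h H ha hp'
  obtain ⟨S, hS, hST⟩ := exists_symmetrization h isOpen_Ioo ordConnected_Ioo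
    (show (0 : ℝ) ∈ Ioo (-ε) (|X₀| + ε) from ⟨by linarith, by linarith⟩) hs hψ
  have hm : |X₀| ∈ Ioo (-ε) (|X₀| + ε) := ⟨by linarith, by linarith⟩
  have hSa : S |X₀| = T₀ := (hST hm).trans hT
  obtain ⟨hn, hSn⟩ := hS.2 _ (Or.inl hm)
  rw [hSa] at hSn
  exact ⟨_, S, IsTSSCMCThrough.of_abs ⟨hS, Or.inl hm, hn, hSa, hSn⟩⟩

/-- The union of all symmetric hypersurfaces of constant mean curvature with given boundary
data. -/
theorem exists_maximal_isTSSCMCThrough (h : Subextremal M e) (H : ℝ)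
    (hp : (T₀, X₀) ∈ penroseDiagram M e) :
    ∃ I T, IsTSSCMCThrough M e H T₀ X₀ I T ∧
      ∀ J S, IsTSSCMCThrough M e H T₀ X₀ J S → J ⊆ I ∧ EqOn S T J := by
  obtain ⟨J₀, S₀, h₀⟩ := exists_isTSSCMCThrough h H hp
  set C : Set (Set ℝ) := {J | ∃ S, IsTSSCMCThrough M e H T₀ X₀ J S} with hC
  -- By `eqOn` all hypersurfaces defined at `x` share one value there; where none is defined, `0` is
  -- an irrelevant default.
  have hex : ∀ x : ℝ, ∃ t : ℝ, ∀ J S, IsTSSCMCThrough M e H T₀ X₀ J S → x ∈ J → S x = t := by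
    intro x
    by_cases hx : ∃ J S, IsTSSCMCThrough M e H T₀ X₀ J S ∧ x ∈ J
    · obtain ⟨J, S, hS, hxJ⟩ := hx
      exact ⟨S x, fun J' S' hS' hx' => hS'.eqOn h hS ⟨hx', hxJ⟩⟩
    · exact ⟨0, fun J S hS hxJ => absurd ⟨J, S, hS, hxJ⟩ hx⟩
  choose T hT using hex
  have hsub : ∀ J S, IsTSSCMCThrough M e H T₀ X₀ J S → J ⊆ ⋃₀ C ∧ EqOn S T J := fun J S hS =>
    ⟨subset_sUnion_of_mem ⟨S, hS⟩, fun x hx => hT x J S hS hx⟩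
  have hI0 := hsub J₀ S₀ h₀
  refine ⟨⋃₀ C, T, ⟨⟨isSSCMC_of_isSolAt (ψ := fun x => Real.artanh (deriv T x)) h ?_ ?_
    ⟨X₀, hI0.1 h₀.mem⟩ ?_, ?_⟩, hI0.1 h₀.mem, hI0.1 h₀.neg_mem, ?_, ?_⟩, hsub⟩
  · exact isOpen_sUnion fun J ⟨S, hS⟩ => hS.isTSSCMC.1.1
  · exact (isPreconnected_sUnion X₀ C (fun J ⟨S, hS⟩ => hS.mem)
      fun J ⟨S, hS⟩ => hS.isTSSCMC.1.2.1.isPreconnected).ordConnected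
  · rintro x ⟨J, ⟨S, hS⟩, hx⟩
    have hev : T =ᶠ[𝓝 x] S := eventually_of_mem (hS.isTSSCMC.1.1.mem_nhds hx)
      fun y hy => ((hsub J S hS).2 hy).symm
    exact (IsSSCMC.isSolAt h hS.isTSSCMC.1 hx).congr hev
      (hev.deriv.fun_comp Real.artanh)
  · rintro x ⟨J, ⟨S, hS⟩, hx⟩
    obtain ⟨h1, h2⟩ := hS.isTSSCMC.2 x hx
    exact ⟨⟨J, ⟨S, hS⟩, h1⟩, by rw [← (hsub J S hS).2 hx, ← (hsub J S hS).2 h1, h2]⟩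
  · rw [← hI0.2 h₀.mem, h₀.apply_eq]
  · rw [← hI0.2 h₀.neg_mem, h₀.apply_neg_eq]

/-- A maximal symmetric hypersurface is inextendible among all spherically symmetric ones. -/
theorem IsTSSCMCThrough.isInextendible (h : Subextremal M e)
    (hT : IsTSSCMCThrough M e H T₀ X₀ I T)
    (hmax : ∀ J S, IsTSSCMCThrough M e H T₀ X₀ J S → J ⊆ I ∧ EqOn S T J) :
    IsInextendible M e H I T := by
  intro J S hS hIJ hST
  refine Subset.antisymm ?_ hIJ
  have hI := hT.isTSSCMC.1.1
  have h0 := hT.zero_mem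
  have hd : deriv S 0 = 0 := by
    rw [EventuallyEq.deriv_eq (eventually_of_mem (hI.mem_nhds h0) hST : S =ᶠ[𝓝 0] T)]
    exact hT.isTSSCMC.deriv_zero h0
  -- The extension is not assumed symmetric, but it agrees with `T` near the axis and so is
  -- orthogonal to it. Its symmetrization competes in the maximality hypothesis and contains all of
  -- `J`.
  obtain ⟨S', hS', hSS'⟩ := exists_symmetrization h hS.1 hS.2.1 (hIJ h0)
    (fun x hx => IsSSCMC.isSolAt h hS hx) (by simp [hd])
  have hval : ∀ x ∈ I, S' x = T x := fun x hx => (hSS' (hIJ hx)).trans (hST hx)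
  exact subset_union_left.trans (hmax _ S' ⟨hS', Or.inl (hIJ hT.mem), Or.inl (hIJ hT.neg_mem),
    (hval _ hT.mem).trans hT.apply_eq, (hval _ hT.neg_mem).trans hT.apply_neg_eq⟩).1

end ReissnerNordstrom

end

open ReissnerNordstrom in
theorem theorem2 (M e : ℝ) (hM : 0 < M) (he : e ≠ 0) (heM : e ^ 2 < M ^ 2) (H T₀ X₀ : ℝ)
    (hp : (T₀, X₀) ∈ penroseDiagram M e) (hp' : (T₀, -X₀) ∈ penroseDiagram M e) :
    ∃ (I : Set ℝ) (T : ℝ → ℝ),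
      (IsTSSCMC M e H I T ∧ IsInextendible M e H I T ∧
        X₀ ∈ I ∧ -X₀ ∈ I ∧ T X₀ = T₀ ∧ T (-X₀) = T₀) ∧
      ∀ (J : Set ℝ) (S : ℝ → ℝ), IsTSSCMC M e H J S →
        X₀ ∈ J → -X₀ ∈ J → S X₀ = T₀ → S (-X₀) = T₀ → J ⊆ I ∧ Set.EqOn S T J := by
  have h : Subextremal M e := ⟨hM, he, heM⟩
  obtain ⟨I, T, hT, hmax⟩ := exists_maximal_isTSSCMCThrough h H hp
  exact ⟨I, T, ⟨hT.isTSSCMC, hT.isInextendible h hmax, hT.mem, hT.neg_mem, hT.apply_eq,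
    hT.apply_neg_eq⟩, fun J S hS h1 h2 h3 h4 => hmax J S ⟨hS, h1, h2, h3, h4⟩⟩
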